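/- Let $n\ge 1$, and let $F:[0,\infty)\to\mathbb R\cup\{-\infty\}$ be admissible, that is, strictly increasing on $[0,\infty)$, continuous on $(0,\infty)$, and with $F(0)=\lim_{r\to0^+}F(r)$. Let $f_F$ be the inverse function of $F$ on $J_F:=F((0,\infty))$. A function $\phi:\mathbb R^n\to[0,\infty)$ is called $F$-convex if $F(\phi((1-\lambda)x+\lambda y))\le(1-\lambda)F(\phi(x))+\lambda F(\phi(y))$ for all $x,y\in\mathbb R^n$ and $\lambda\in(0,1)$, where $-\infty+b=b-\infty=-\infty$ for $b\in[-\infty,\infty)$ and $\kappa\cdot(-\infty)=-\infty$ for $\kappa>0$. For $t>0$ put $$[e^{t\Delta}\phi](x)=\int_{\mathbb R^n}(4\pi t)^{-n/2}e^{-|x-y|^2/(4t)}\phi(y)\,dy ,$$ and let $T(\phi)\in[0,\infty]$ be the maximal existence time of $e^{t\Delta}\phi$, that is, the largest $T$ such that this integral is finite for all $x\in\mathbb R^n$ and $t\in(0,T)$. We say that $F$-convexity is *preserved under the heat flow* if, for every $F$-convex $\phi\ge0$ with $T(\phi)>0$, the function $e^{t\Delta}\phi$ is $F$-convex for all $t\in(0,T(\phi))$;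 and that it is *only trivially preserved* if every $F$-convex $\phi\ge0$ with $T(\phi)>0$ such that $e^{t\Delta}\phi$ is $F$-convex for all $t\in(0,T(\phi))$ is constant on $\mathbb R^n$. 1. If $\lim_{r\to\infty}F(r)<\infty$, then $F$-convexity is only trivially preserved under the heat flow. 2. If $\lim_{r\to\infty}F(r)=\infty$ and $\int_{F(1)}^\infty e^{-Az^2}f_F(z)\,dz=\infty$ for every $A>0$, then $F$-convexity is only trivially preserved under the heat flow. 3. If $F\in C^2((0,\infty))$, $\lim_{r\to\infty}F(r)=\infty$ and $\int_{F(1)}^\infty e^{-Az^2}f_F(z)\,dz<\infty$ for some $A>0$, then $F$-convexity is preserved under the heat flow if and only if $F'>0$ in $(0,\infty)$ and $g_F:=(\log f_F')'$ is convex on $J_F$. -/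

import Mathlib

open MeasureTheory Filter Set
open scoped Topology ENNReal

noncomputable section

namespace HeatFConvex

/-- A function `F : [0,∞) → ℝ ∪ {-∞}` is admissible if it is strictly increasing on `[0,∞)`,
continuous on `(0,∞)`, and `F 0 = lim_{r → 0⁺} F r`. It is represented by a function on `ℝ` with
values in the extended reals; only its values on `[0,∞)` are ever used. -/
structure Admissible (F : ℝ → EReal) : Prop where
  ne_top : ∀ r, 0 ≤ r → F r ≠ ⊤
  strictMonoOn : StrictMonoOn F (Ici 0)
  continuousOn : ContinuousOn F (Ioi 0)
  tendsto_zero : Tendsto F (𝓝[>] 0) (𝓝 (F 0))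

/-- The real-valued version of `F`; for admissible `F` it agrees with `F` on `(0,∞)`. -/
def realOf (F : ℝ → EReal) (r : ℝ) : ℝ := (F r).toReal

/-- `J_F = F((0,∞))`. -/
def J (F : ℝ → EReal) : Set ℝ := {z | ∃ r : ℝ, 0 < r ∧ F r = (z : EReal)}

/-- `f_F`, the inverse function of `F` on `J_F`, with values in `(0,∞)`
(no meaning is attached to its values outside `J_F`). -/
def inv (F : ℝ → EReal) : ℝ → ℝ := Function.invFunOn (realOf F) (Ioi 0)

/-- `g_F = (log f_F')'`. -/
def g (F : ℝ → EReal) : ℝ → ℝ := deriv fun z => Real.log (deriv (inv F) z)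

/-- The integral of `exp (-A z²) f_F(z)` over `(F(1), ∞)`, as an element of `[0,∞]`. -/
def weightIntegral (F : ℝ → EReal) (A : ℝ) : ℝ≥0∞ :=
  ∫⁻ z in Ioi (realOf F 1), ENNReal.ofReal (Real.exp (-A * z ^ 2) * inv F z)

variable {n : ℕ}

/-- A nonnegative function `f` on `ℝⁿ` is `F`-convex. The arithmetic of `EReal` obeys
`-∞ + b = b + (-∞) = -∞` and `κ * (-∞) = -∞` for `κ > 0`. -/
def FConvex (F : ℝ → EReal) (f : EuclideanSpace ℝ (Fin n) → ℝ) : Prop :=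
  (∀ x, 0 ≤ f x) ∧
    ∀ (x y : EuclideanSpace ℝ (Fin n)) (l : ℝ), 0 < l → l < 1 →
      F (f ((1 - l) • x + l • y)) ≤
        ((1 - l : ℝ) : EReal) * F (f x) + (l : EReal) * F (f y)

/-- The Gauss kernel on `ℝⁿ × (0,∞)`. -/
def gaussKernel (x : EuclideanSpace ℝ (Fin n)) (t : ℝ) : ℝ :=
  (4 * Real.pi * t) ^ (-(n : ℝ) / 2) * Real.exp (-‖x‖ ^ 2 / (4 * t))

/-- The heat flow `e^{tΔ} φ` (meaningful for `0 ≤ t < maxTime φ`). -/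
def heatFlow (φ : EuclideanSpace ℝ (Fin n) → ℝ) (t : ℝ) (x : EuclideanSpace ℝ (Fin n)) : ℝ :=
  if 0 < t then ∫ y, gaussKernel (x - y) t * φ y else φ x

/-- `T(φ)`, the maximal existence time of `e^{tΔ} φ`: the largest `T ∈ [0,∞]` such that the
integral that defines `[e^{tΔ} φ](x)` converges for all `t ∈ (0,T)` and `x ∈ ℝⁿ`. -/
def maxTime (φ : EuclideanSpace ℝ (Fin n) → ℝ) : ℝ≥0∞ :=
  sSup {T | ∀ t : ℝ, 0 < t → ENNReal.ofReal t < T →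
    ∀ x : EuclideanSpace ℝ (Fin n), Integrable fun y => gaussKernel (x - y) t * φ y}

/-- `F`-convexity is preserved under the heat flow on `ℝⁿ`. -/
def Preserved (n : ℕ) (F : ℝ → EReal) : Prop :=
  ∀ φ : EuclideanSpace ℝ (Fin n) → ℝ, FConvex F φ → 0 < maxTime φ →
    ∀ t : ℝ, 0 < t → ENNReal.ofReal t < maxTime φ → FConvex F (heatFlow φ t)

/-- `F`-convexity is only trivially preserved under the heat flow on `ℝⁿ`. -/
def OnlyTriviallyPreserved (n : ℕ) (F : ℝ → EReal) : Prop :=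
  ∀ φ : EuclideanSpace ℝ (Fin n) → ℝ, FConvex F φ → 0 < maxTime φ →
    (∀ t : ℝ, 0 < t → ENNReal.ofReal t < maxTime φ → FConvex F (heatFlow φ t)) →
    ∃ c : ℝ, ∀ x, φ x = c

end HeatFConvex

end

/-!
The transform `w = F (e^{tΔ} φ)` solves `∂ₜ w = Δ w + g_F(w) |∇w|²`.

If `g_F` is convex and `w` is Lipschitz, a maximum principle for
`w((1 - λ) x + λ y) - (1 - λ) w(x) - λ w(y)` shows that convexity of `w` in space persists: at a
contact point the three gradients agree, and convexity of `g_F` compares the reaction terms. The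
Lipschitz bound itself is kept for a short time by comparing `w(x) - w(y)` with `ℓ(t) ‖x - y‖`,
where `ℓ' = a ℓ³`. General `F`-convex data are approximated by truncating `F ∘ φ` from below and
replacing it by its Lipschitz inf-convolutions.

Conversely, the datum `f_F(max(xᵢ, m))` has an `F`-transform that is affine on a half-space, where
`∂ₜ w = g_F(xᵢ)` at `t = 0`, because there `|∇w| = 1` and `Δw = 0`. Preservation of convexity
therefore forces `g_F` to be convex wherever `F' > 0`. A zero of `F'` would make `log f_F'` blow up
at finite distance, which convexity of `g_F` excludes.

If `F ∘ φ` is convex and not constant, then it grows at least linearly along some ray. This is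
impossible for bounded `F`, and for unbounded `F` finiteness of `e^{tΔ} φ` makes
`exp (-A z²) f_F(z)` integrable for some `A > 0`.
-/

noncomputable section

namespace HeatFConvex

open scoped RealInnerProductSpace

section Maxima

lemma second_deriv_nonpos_of_isLocalMax {θ θ' : ℝ → ℝ} {d a : ℝ}
    (hθ : ∀ᶠ s in 𝓝 a, HasDerivAt θ (θ' s) s) (hθ' : HasDerivAt θ' d a) (hmax : IsLocalMax θ a) :
    d ≤ 0 := by
  by_contra! hd
  have hderiv : deriv θ =ᶠ[𝓝 a] θ' := hθ.mono fun s hs => hs.deriv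
  have hd₂ : deriv (deriv θ) a = d := by rw [hderiv.deriv_eq, hθ'.deriv]
  have hmin : IsLocalMin θ a := isLocalMin_of_deriv_deriv_pos (hd₂ ▸ hd) hmax.deriv_eq_zero
    hθ.self_of_nhds.continuousAt
  have hconst : θ =ᶠ[𝓝 a] fun _ => θ a := by
    filter_upwards [hmin, hmax] with s hs hs' using le_antisymm hs' hs
  have hzero : deriv (deriv θ) a = 0 := by
    rw [hconst.deriv.deriv_eq]
    simp
  linarith

lemma deriv_nonpos_of_eventually_le_right {θ : ℝ → ℝ} {d a : ℝ} (h : HasDerivAt θ d a)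
    (hmax : ∀ᶠ s in 𝓝[>] a, θ s ≤ θ a) : d ≤ 0 := by
  have hslope := h.hasDerivWithinAt (s := Ioi a)
  rw [hasDerivWithinAt_iff_tendsto_slope' self_notMem_Ioi] at hslope
  refine le_of_tendsto hslope ?_
  filter_upwards [self_mem_nhdsWithin, hmax] with s hs hle
  rw [slope_def_field]
  exact div_nonpos_of_nonpos_of_nonneg (sub_nonpos.2 hle) (sub_nonneg.2 (mem_Ioi.1 hs).le)

lemma deriv_nonneg_of_eventually_le_left {θ : ℝ → ℝ} {d a : ℝ} (h : HasDerivAt θ d a)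
    (hmax : ∀ᶠ s in 𝓝[<] a, θ s ≤ θ a) : 0 ≤ d := by
  have hslope := h.hasDerivWithinAt (s := Iio a)
  rw [hasDerivWithinAt_iff_tendsto_slope' self_notMem_Iio] at hslope
  refine ge_of_tendsto hslope ?_
  filter_upwards [self_mem_nhdsWithin, hmax] with s hs hle
  rw [slope_def_field]
  exact div_nonneg_of_nonpos (sub_nonpos.2 hle) (sub_nonpos.2 (mem_Iio.1 hs).le)

end Maxima

section Barrier

variable {X : Type*} [TopologicalSpace X] {T : ℝ}

lemma exists_first_nonneg_time [T2Space X] {Φ : ℝ → X → ℝ}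
    (hΦ : ContinuousOn (fun p : ℝ × X => Φ p.1 p.2) (Icc 0 T ×ˢ univ))
    (hout : ∀ᶠ x in cocompact X, ∀ t ∈ Icc 0 T, Φ t x < 0) (hinit : ∀ x, Φ 0 x < 0)
    {t₁ : ℝ} (ht₁ : t₁ ∈ Icc 0 T) {x₁ : X} (hx₁ : 0 ≤ Φ t₁ x₁) :
    ∃ t₀ ∈ Ioc 0 T, ∃ x₀, 0 ≤ Φ t₀ x₀ ∧ ∀ t ∈ Ico 0 t₀, ∀ x, Φ t x < 0 := by
  obtain ⟨S, hS, hSout⟩ := mem_cocompact.1 hout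
  have mem_S : ∀ {t x}, t ∈ Icc 0 T → 0 ≤ Φ t x → x ∈ S := fun {t x} ht hx => by
    by_contra hxS
    exact (hSout hxS t ht).not_ge hx
  have hZ : IsCompact ((Icc 0 T ×ˢ S) ∩ (fun p : ℝ × X => Φ p.1 p.2) ⁻¹' Ici 0) :=
    (isCompact_Icc.prod hS).of_isClosed_subset
      ((hΦ.mono (prod_mono_right (subset_univ S))).preimage_isClosed_of_isClosed
        (isClosed_Icc.prod hS.isClosed) isClosed_Ici) inter_subset_left
  obtain ⟨⟨t₀, x₀⟩, ⟨⟨ht₀, -⟩, hpos⟩, hmin⟩ :=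
    hZ.exists_isMinOn ⟨(t₁, x₁), ⟨ht₁, mem_S ht₁ hx₁⟩, hx₁⟩ continuous_fst.continuousOn
  refine ⟨t₀, ⟨ht₀.1.lt_of_ne ?_, ht₀.2⟩, x₀, hpos, fun t ht x => ?_⟩
  · rintro rfl
    exact (hinit x₀).not_ge hpos
  · by_contra! hx
    have htT : t ∈ Icc 0 T := ⟨ht.1, ht.2.le.trans ht₀.2⟩
    exact ht.2.not_ge (hmin (show (t, x) ∈ _ from ⟨⟨htT, mem_S htT hx⟩, hx⟩))

lemma nonpos_of_neg_before {φ : ℝ → ℝ} (hφ : ContinuousOn φ (Icc 0 T)) {t : ℝ}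
    (ht : t ∈ Ioc 0 T) (hneg : ∀ s ∈ Ico 0 t, φ s < 0) : φ t ≤ 0 := by
  have hlim : Tendsto φ (𝓝[Ioo 0 t] t) (𝓝 (φ t)) :=
    (hφ t ⟨ht.1.le, ht.2⟩).mono_left
      (nhdsWithin_mono _ fun s hs => ⟨hs.1.le, hs.2.le.trans ht.2⟩)
  have : (𝓝[Ioo 0 t] t).NeBot := by
    rw [nhdsWithin_Ioo_eq_nhdsLT ht.1]
    infer_instance
  refine le_of_tendsto hlim ?_
  filter_upwards [self_mem_nhdsWithin] with s hs using (hneg s (Ioo_subset_Ico_self hs)).le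

lemma deriv_le_of_first_contact {θ β : ℝ → ℝ} {t d d' : ℝ} (ht : 0 < t) (hθ : HasDerivAt θ d t)
    (hβ : HasDerivAt β d' t) (hcontact : β t ≤ θ t) (hbefore : ∀ s ∈ Ico 0 t, θ s - β s < 0) :
    d' ≤ d :=
  sub_nonneg.1 <| deriv_nonneg_of_eventually_le_left (hθ.sub hβ) <| by
    filter_upwards [Ioo_mem_nhdsLT ht] with s hs
    exact (hbefore s (Ioo_subset_Ico_self hs)).le.trans (sub_nonneg.2 hcontact)

variable [T2Space X] {Θ : ℝ → X → ℝ} {ψ : X → ℝ} {K : ℝ}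

lemma lt_barrier_of_deriv_lt_at_contact (hK : 0 ≤ K)
    (hΘ : ContinuousOn (fun p : ℝ × X => Θ p.1 p.2) (Icc 0 T ×ˢ univ)) (hψ : Continuous ψ)
    (hψpos : ∀ x, 0 < ψ x) {ε : ℝ} (hε : 0 < ε)
    (hgrowth : ∀ᶠ x in cocompact X, ∀ t ∈ Icc 0 T, Θ t x < ε * ψ x) (hinit : ∀ x, Θ 0 x ≤ 0)
    (hcontact : ∀ t ∈ Ioc 0 T, ∀ q > 0, ∀ x, Θ t x = q * ψ x → (∀ x', Θ t x' ≤ q * ψ x') →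
      ∃ d < K * (q * ψ x), HasDerivAt (fun s => Θ s x) d t)
    {t₁ : ℝ} (ht₁ : t₁ ∈ Icc 0 T) (x₁ : X) : Θ t₁ x₁ < ε * Real.exp (K * t₁) * ψ x₁ := by
  by_contra! hcross
  have hcont : ContinuousOn (fun p : ℝ × X => Θ p.1 p.2 - ε * Real.exp (K * p.1) * ψ p.2)
      (Icc 0 T ×ˢ univ) :=
    hΘ.sub (by fun_prop)
  have hout : ∀ᶠ y in cocompact X, ∀ s ∈ Icc 0 T, Θ s y - ε * Real.exp (K * s) * ψ y < 0 := by
    filter_upwards [hgrowth] with y hy s hs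
    have hexp : ε ≤ ε * Real.exp (K * s) :=
      le_mul_of_one_le_right hε.le (Real.one_le_exp (mul_nonneg hK hs.1))
    linarith [hy s hs, mul_le_mul_of_nonneg_right hexp (hψpos y).le]
  have hneg₀ : ∀ y, Θ 0 y - ε * Real.exp (K * 0) * ψ y < 0 := fun y =>
    sub_neg_of_lt ((hinit y).trans_lt (mul_pos (by positivity) (hψpos y)))
  obtain ⟨t, ht, x, hx, hbefore⟩ := exists_first_nonneg_time hcont hout hneg₀ ht₁
    (sub_nonneg.2 hcross)
  have hle : ∀ x', Θ t x' - ε * Real.exp (K * t) * ψ x' ≤ 0 := fun x' =>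
    nonpos_of_neg_before (φ := fun s => Θ s x' - ε * Real.exp (K * s) * ψ x')
      (hcont.comp (f := fun s => (s, x')) (by fun_prop) fun s hs => ⟨hs, mem_univ _⟩) ht
      fun s hs => hbefore s hs x'
  obtain ⟨d, hd, hderiv⟩ := hcontact t ht (ε * Real.exp (K * t)) (by positivity) x
    (le_antisymm (sub_nonpos.1 (hle x)) (sub_nonneg.1 hx)) fun x' => sub_nonpos.1 (hle x')
  have hbarrier := (((hasDerivAt_id t).const_mul K).exp.const_mul ε).mul_const (ψ x)
  have hle_d := deriv_le_of_first_contact ht.1 hderiv hbarrier (sub_nonneg.1 hx)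
    fun s hs => hbefore s hs x
  simp only [id, mul_one] at hle_d
  linarith

-- At its first contact with `ε e^{Kt} ψ` the function `Θ` grows at least as fast as this barrier.
theorem nonpos_of_deriv_lt_at_contact (hK : 0 ≤ K)
    (hΘ : ContinuousOn (fun p : ℝ × X => Θ p.1 p.2) (Icc 0 T ×ˢ univ)) (hψ : Continuous ψ)
    (hψpos : ∀ x, 0 < ψ x)
    (hgrowth : ∀ ε > 0, ∀ᶠ x in cocompact X, ∀ t ∈ Icc 0 T, Θ t x < ε * ψ x)
    (hinit : ∀ x, Θ 0 x ≤ 0)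
    (hcontact : ∀ t ∈ Ioc 0 T, ∀ q > 0, ∀ x, Θ t x = q * ψ x → (∀ x', Θ t x' ≤ q * ψ x') →
      ∃ d < K * (q * ψ x), HasDerivAt (fun s => Θ s x) d t)
    {t : ℝ} (ht : t ∈ Icc 0 T) (x : X) : Θ t x ≤ 0 := by
  refine le_of_forall_pos_le_add fun δ hδ => ?_
  have hpos : 0 < Real.exp (K * t) * ψ x := mul_pos (Real.exp_pos _) (hψpos x)
  have := lt_barrier_of_deriv_lt_at_contact hK hΘ hψ hψpos (ε := δ / (Real.exp (K * t) * ψ x))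
    (by positivity) (hgrowth _ (by positivity)) hinit hcontact ht x
  rw [mul_assoc, div_mul_cancel₀ _ hpos.ne'] at this
  linarith

end Barrier

section PairWeight

variable {E : Type*} [NormedAddCommGroup E]

/-- The quadratic weight `1 + ‖x‖² + ‖y‖²` on pairs of points; multiples of it are the barriers of
the doubling-of-variables arguments below. -/
def pairWeight (p : E × E) : ℝ := 1 + (‖p.1‖ ^ 2 + ‖p.2‖ ^ 2)

lemma pairWeight_comm (x y : E) : pairWeight (x, y) = pairWeight (y, x) := by
  rw [pairWeight, pairWeight, add_comm (‖x‖ ^ 2)]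

lemma one_le_pairWeight (p : E × E) : 1 ≤ pairWeight p :=
  le_add_of_nonneg_right (by positivity)

lemma pairWeight_pos (p : E × E) : 0 < pairWeight p := one_pos.trans_le (one_le_pairWeight p)

lemma continuous_pairWeight : Continuous (pairWeight : E × E → ℝ) := by
  unfold pairWeight
  fun_prop

lemma norm_sq_le_pairWeight (p : E × E) : ‖p‖ ^ 2 ≤ pairWeight p := by
  rw [Prod.norm_def, pairWeight]
  rcases max_choice ‖p.1‖ ‖p.2‖ with h | h <;> rw [h] <;>
    nlinarith [sq_nonneg ‖p.1‖, sq_nonneg ‖p.2‖]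

lemma eventually_linear_lt_pairWeight [ProperSpace E] (C : ℝ) {ε : ℝ} (hε : 0 < ε) :
    ∀ᶠ p in cocompact (E × E), C * (1 + ‖p‖) < ε * pairWeight p := by
  filter_upwards [tendsto_norm_cocompact_atTop.eventually_gt_atTop (2 * |C| / ε),
    tendsto_norm_cocompact_atTop.eventually_ge_atTop 1] with p hp hp₁
  rw [div_lt_iff₀ hε] at hp
  calc C * (1 + ‖p‖) ≤ |C| * (‖p‖ + ‖p‖) := by gcongr; exact le_abs_self C
    _ = 2 * |C| * ‖p‖ := by ring
    _ < ‖p‖ * ε * ‖p‖ := by gcongr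
    _ = ε * ‖p‖ ^ 2 := by ring
    _ ≤ ε * pairWeight p := by gcongr; exact norm_sq_le_pairWeight p

lemma mul_two_add_norms_le {q C : ℝ} {x y : E} (hq : 0 ≤ q)
    (h : q * pairWeight (x, y) ≤ C * (2 + ‖x‖ + ‖y‖)) : q * (2 + ‖x‖ + ‖y‖) ≤ 12 * C := by
  have hsq : (2 + ‖x‖ + ‖y‖) ^ 2 ≤ 12 * pairWeight (x, y) := by
    rw [pairWeight]
    nlinarith [sq_nonneg (‖x‖ - ‖y‖), sq_nonneg (‖x‖ - 2), sq_nonneg (‖y‖ - 2)]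
  refine le_of_mul_le_mul_right ?_ (by positivity : 0 < 2 + ‖x‖ + ‖y‖)
  linarith [mul_le_mul_of_nonneg_left hsq hq]

lemma norm_sub_mul_norm_le_pairWeight (x y : E) : ‖x - y‖ * ‖x‖ ≤ 2 * pairWeight (x, y) := by
  have := mul_le_mul_of_nonneg_right (norm_sub_le x y) (norm_nonneg x)
  rw [pairWeight]
  nlinarith [sq_nonneg (‖x‖ - ‖y‖)]

lemma one_add_norm_mul_norm_le_pairWeight (x y : E) : (1 + ‖x‖) * ‖x‖ ≤ 2 * pairWeight (x, y) := by
  rw [pairWeight]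
  nlinarith [sq_nonneg (‖x‖ - 1)]

lemma one_add_norm_mul_add_norm_le_pairWeight (x y : E) :
    (1 + ‖y‖) * (‖x‖ + ‖y‖) ≤ 3 * pairWeight (x, y) := by
  rw [pairWeight]
  nlinarith [sq_nonneg (‖x‖ - ‖y‖), sq_nonneg (‖x‖ - 1), sq_nonneg (‖y‖ - 1)]

lemma abs_norm_sq_sub_norm_sq_le (u v : E) : |‖u‖ ^ 2 - ‖v‖ ^ 2| ≤ ‖u - v‖ * (‖u‖ + ‖v‖) := by
  rw [show ‖u‖ ^ 2 - ‖v‖ ^ 2 = (‖u‖ - ‖v‖) * (‖u‖ + ‖v‖) by ring, abs_mul,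
    abs_of_nonneg (by positivity : 0 ≤ ‖u‖ + ‖v‖)]
  gcongr
  exact abs_norm_sub_norm_le u v

end PairWeight

section FlowBounds

variable {E : Type*} [NormedAddCommGroup E]

/-- A priori bounds on `[0,T]` for solutions of the flow equation with reaction term `g`: at most
linear growth of `w` and of `g ∘ w`, a lower bound `m` for `w`, and a one-sided Lipschitz condition
for `g` on `[m,∞)`. -/
structure FlowBounds (g : ℝ → ℝ) (T a B C m : ℝ) (w : ℝ → E → ℝ) : Prop where
  growth : ∀ t ∈ Icc 0 T, ∀ x, |w t x| ≤ C * (1 + ‖x‖)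
  lower : ∀ t ∈ Icc 0 T, ∀ x, m ≤ w t x
  reaction : ∀ t ∈ Icc 0 T, ∀ x, |g (w t x)| ≤ B * (1 + ‖x‖)
  slope_nonneg : 0 ≤ a
  slope : ∀ z z', m ≤ z → z ≤ z' → g z' - g z ≤ a * (z' - z)

variable {g : ℝ → ℝ} {T t a B C m l q : ℝ} {w : ℝ → E → ℝ} {x y : E}

lemma FlowBounds.reaction_const_nonneg (hbd : FlowBounds g T a B C m w) (ht : t ∈ Icc 0 T) :
    0 ≤ B := by
  simpa using (abs_nonneg _).trans (hbd.reaction t ht 0)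

lemma FlowBounds.growth_const_nonneg (hbd : FlowBounds g T a B C m w) (ht : t ∈ Icc 0 T) :
    0 ≤ C := by
  simpa using (abs_nonneg _).trans (hbd.growth t ht 0)

lemma FlowBounds.lip_growth (hbd : FlowBounds g T a B C m w) (ht : t ∈ Icc 0 T) (hl : 0 ≤ l)
    (p : E × E) : w t p.1 - w t p.2 - l * ‖p.1 - p.2‖ ≤ 2 * C * (1 + ‖p‖) := by
  have hC := hbd.growth_const_nonneg ht
  have hfst := mul_le_mul_of_nonneg_left (norm_fst_le p) hC
  have hsnd := mul_le_mul_of_nonneg_left (norm_snd_le p) hC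
  linarith [(abs_le.1 (hbd.growth t ht p.1)).2, (abs_le.1 (hbd.growth t ht p.2)).1,
    mul_nonneg hl (norm_nonneg (p.1 - p.2))]

/-- Contact of `w t x - w t y - l ‖x - y‖` with the barrier `q (1 + ‖x‖² + ‖y‖²)` at `(x, y)`. -/
structure IsLipContact (w : ℝ → E → ℝ) (t l q : ℝ) (x y : E) : Prop where
  eq : w t x - w t y - l * ‖x - y‖ = q * pairWeight (x, y)
  le : ∀ x' y', w t x' - w t y' - l * ‖x' - y'‖ ≤ q * pairWeight (x', y')

lemma IsLipContact.mul_two_add_norms_le (h : IsLipContact w t l q x y)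
    (hbd : FlowBounds g T a B C m w) (ht : t ∈ Icc 0 T) (hl : 0 ≤ l) (hq : 0 ≤ q) :
    q * (2 + ‖x‖ + ‖y‖) ≤ 12 * C := by
  refine HeatFConvex.mul_two_add_norms_le hq ?_
  rw [← h.eq]
  linarith [(abs_le.1 (hbd.growth t ht x)).2, (abs_le.1 (hbd.growth t ht y)).1,
    mul_nonneg hl (norm_nonneg (x - y))]

lemma IsLipContact.mul_norm_fst_le (h : IsLipContact w t l q x y)
    (hbd : FlowBounds g T a B C m w) (ht : t ∈ Icc 0 T) (hl : 0 ≤ l) (hq : 0 ≤ q) :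
    q * ‖x‖ ≤ 12 * C :=
  le_trans (by gcongr; linarith [norm_nonneg y]) (h.mul_two_add_norms_le hbd ht hl hq)

lemma IsLipContact.translation_max (h : IsLipContact w t l q x y) (e : E) :
    ∑ j, (![1, -1] : Fin 2 → ℝ) j * w t ((![x, y] : Fin 2 → E) j + e)
      - q * pairWeight (x + e, y + e) ≤
    ∑ j, (![1, -1] : Fin 2 → ℝ) j * w t ((![x, y] : Fin 2 → E) j) - q * pairWeight (x, y) := by
  have hle := h.le (x + e) (y + e)
  rw [add_sub_add_right_eq_sub] at hle
  simp only [Fin.sum_univ_two, Matrix.cons_val_zero, Matrix.cons_val_one, one_mul, neg_mul]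
  linarith [h.eq]

end FlowBounds

section Flow

lemma hasDerivAt_add_smul {E : Type*} [NormedAddCommGroup E] [NormedSpace ℝ E] (x e : E) (s : ℝ) :
    HasDerivAt (fun s : ℝ => x + s • e) e s := by
  simpa using ((hasDerivAt_id s).smul_const e).const_add x

variable {E : Type*} [NormedAddCommGroup E] [InnerProductSpace ℝ E] {ι : Type*} [Fintype ι]

/-- `w` is a classical solution of `∂ₜ w = ∑ᵢ ∂ᵢᵢ w + g(w) ‖∇w‖²` on `(0,T]`, continuous on `[0,T]`,
where `∂ᵢ` is the derivative along the unit vector `b i`, `P = ∇w` and `H · · i = ∂ᵢᵢ w`. This is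
the equation solved by `F(e^{tΔ}φ)`. -/
structure IsFlow (g : ℝ → ℝ) (T : ℝ) (b : ι → E) (w : ℝ → E → ℝ) (P : ℝ → E → E)
    (H : ℝ → E → ι → ℝ) : Prop where
  norm_dir : ∀ i, ‖b i‖ = 1
  cont : ContinuousOn (fun p : ℝ × E => w p.1 p.2) (Icc 0 T ×ˢ univ)
  grad : ∀ t ∈ Ioc 0 T, ∀ x e, HasDerivAt (fun s : ℝ => w t (x + s • e)) ⟪P t x, e⟫ 0
  hess : ∀ t ∈ Ioc 0 T, ∀ x i, HasDerivAt (fun s : ℝ => ⟪P t (x + s • b i), b i⟫) (H t x i) 0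
  time : ∀ t ∈ Ioc 0 T, ∀ x,
    HasDerivAt (fun s => w s x) (∑ i, H t x i + g (w t x) * ‖P t x‖ ^ 2) t

variable {g : ℝ → ℝ} {T t q : ℝ} {b : ι → E} {w : ℝ → E → ℝ} {P : ℝ → E → E} {H : ℝ → E → ι → ℝ}

lemma IsFlow.hasDerivAt_line (hw : IsFlow g T b w P H) (ht : t ∈ Ioc 0 T) (x e : E) (s : ℝ) :
    HasDerivAt (fun s : ℝ => w t (x + s • e)) ⟪P t (x + s • e), e⟫ s := by
  have h := hw.grad t ht (x + s • e) e
  rw [← sub_self s] at h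
  refine (h.comp_sub_const s s).congr_of_eventuallyEq (Eventually.of_forall fun r => ?_)
  simp only [add_assoc, ← add_smul, add_sub_cancel]

lemma hasDerivAt_norm_sq_line (x e : E) (s : ℝ) :
    HasDerivAt (fun s : ℝ => ‖x + s • e‖ ^ 2) (2 * ⟪x + s • e, e⟫) s :=
  (hasDerivAt_add_smul x e s).norm_sq

lemma hasDerivAt_inner_line (x e : E) (s : ℝ) :
    HasDerivAt (fun s : ℝ => ⟪x + s • e, e⟫) (‖e‖ ^ 2) s := by
  simpa using (hasDerivAt_add_smul x e s).inner ℝ (hasDerivAt_const s e)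

lemma hasDerivAt_pairWeight_line (x y e : E) (s : ℝ) :
    HasDerivAt (fun s : ℝ => pairWeight (x + s • e, y + s • e))
      (2 * ⟪x + s • e, e⟫ + 2 * ⟪y + s • e, e⟫) s :=
  ((hasDerivAt_norm_sq_line x e s).add (hasDerivAt_norm_sq_line y e s)).const_add 1

section TranslationContact

variable {κ : Type*} [Fintype κ] {c : κ → ℝ} {p : κ → E} {x y : E}

lemma IsFlow.hasDerivAt_translation (hw : IsFlow g T b w P H) (ht : t ∈ Ioc 0 T) (e : E) (s : ℝ) :
    HasDerivAt (fun s : ℝ => ∑ j, c j * w t (p j + s • e) - q * pairWeight (x + s • e, y + s • e))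
      (∑ j, c j * ⟪P t (p j + s • e), e⟫ - q * (2 * ⟪x + s • e, e⟫ + 2 * ⟪y + s • e, e⟫)) s :=
  (HasDerivAt.fun_sum fun j _ => (hw.hasDerivAt_line ht (p j) e s).const_mul (c j)).sub
    ((hasDerivAt_pairWeight_line x y e s).const_mul q)

lemma isLocalMax_translation (hmax : ∀ e, ∑ j, c j * w t (p j + e) - q * pairWeight (x + e, y + e) ≤
    ∑ j, c j * w t (p j) - q * pairWeight (x, y)) (e : E) :
    IsLocalMax (fun s : ℝ => ∑ j, c j * w t (p j + s • e)
      - q * pairWeight (x + s • e, y + s • e)) 0 :=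
  Eventually.of_forall fun s => by simpa using hmax (s • e)

lemma IsFlow.sum_grad_eq_of_translation_max (hw : IsFlow g T b w P H) (ht : t ∈ Ioc 0 T)
    (hmax : ∀ e, ∑ j, c j * w t (p j + e) - q * pairWeight (x + e, y + e) ≤
      ∑ j, c j * w t (p j) - q * pairWeight (x, y)) :
    ∑ j, c j • P t (p j) = (2 * q) • (x + y) := by
  refine ext_inner_right ℝ fun e => ?_
  have h := (isLocalMax_translation hmax e).hasDerivAt_eq_zero (hw.hasDerivAt_translation ht e 0)
  simp only [zero_smul, add_zero] at h
  simp only [sum_inner, inner_add_left, real_inner_smul_left]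
  linarith

lemma IsFlow.sum_laplacian_le_of_translation_max (hw : IsFlow g T b w P H) (ht : t ∈ Ioc 0 T)
    (hmax : ∀ e, ∑ j, c j * w t (p j + e) - q * pairWeight (x + e, y + e) ≤
      ∑ j, c j * w t (p j) - q * pairWeight (x, y)) :
    ∑ j, c j * ∑ i, H t (p j) i ≤ 4 * Fintype.card ι * q := by
  have hdir : ∀ i, ∑ j, c j * H t (p j) i ≤ 4 * q := fun i => by
    have hess := (HasDerivAt.fun_sum fun j (_ : j ∈ Finset.univ) =>
      (hw.hess t ht (p j) i).const_mul (c j)).sub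
      ((((hasDerivAt_inner_line x (b i) 0).const_mul 2).add
        ((hasDerivAt_inner_line y (b i) 0).const_mul 2)).const_mul q)
    have := second_deriv_nonpos_of_isLocalMax
      (Eventually.of_forall (hw.hasDerivAt_translation ht (b i))) hess
      (isLocalMax_translation hmax (b i))
    rw [hw.norm_dir i] at this
    linarith
  calc ∑ j, c j * ∑ i, H t (p j) i = ∑ i, ∑ j, c j * H t (p j) i := by
        simp only [Finset.mul_sum]
        exact Finset.sum_comm
    _ ≤ ∑ _i : ι, 4 * q := Finset.sum_le_sum fun i _ => hdir i
    _ = 4 * Fintype.card ι * q := by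
        rw [Finset.sum_const, Finset.card_univ, nsmul_eq_mul]
        ring

end TranslationContact

lemma IsFlow.norm_grad_sub_le_of_max (hw : IsFlow g T b w P H) (ht : t ∈ Ioc 0 T) {l : ℝ}
    (hl : 0 ≤ l) {x y : E}
    (hmax : ∀ x', w t x' - q * ‖x'‖ ^ 2 - l * ‖x' - y‖ ≤ w t x - q * ‖x‖ ^ 2 - l * ‖x - y‖) :
    ‖P t x - (2 * q) • x‖ ≤ l := by
  have hdir : ∀ e : E, ⟪P t x - (2 * q) • x, e⟫ ≤ l * ‖e‖ := fun e => by
    have hderiv := ((hw.grad t ht x e).sub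
      ((hasDerivAt_norm_sq_line x e 0).const_mul q)).sub
      ((hasDerivAt_id (0 : ℝ)).mul_const (l * ‖e‖))
    have hle := deriv_nonpos_of_eventually_le_right hderiv (by
      filter_upwards [self_mem_nhdsWithin] with s hs
      have hnorm : ‖x + s • e - y‖ ≤ ‖x - y‖ + s * ‖e‖ := by
        rw [add_sub_right_comm, ← Real.norm_of_nonneg (mem_Ioi.1 hs).le, ← norm_smul,
          Real.norm_of_nonneg (mem_Ioi.1 hs).le]
        exact norm_add_le _ _
      simp only [Pi.sub_apply, id, zero_smul, add_zero, zero_mul, sub_zero]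
      linarith [hmax (x + s • e), mul_le_mul_of_nonneg_left hnorm hl])
    simp only [zero_smul, add_zero, one_mul] at hle
    rw [inner_sub_left, real_inner_smul_left]
    linarith
  have hself := hdir (P t x - (2 * q) • x)
  rw [real_inner_self_eq_norm_sq] at hself
  by_contra! hlt
  nlinarith

section Lipschitz

variable {a B C m l Λ K : ℝ} {x y : E}

lemma IsLipContact.norm_grad_le (h : IsLipContact w t l q x y) (hw : IsFlow g T b w P H)
    (ht : t ∈ Ioc 0 T) (hl : 0 ≤ l) (hq : 0 ≤ q) : ‖P t x‖ ≤ l + 2 * (q * ‖x‖) := by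
  have hmax := hw.norm_grad_sub_le_of_max (q := q) (x := x) (y := y) ht hl fun x' => by
    have hle := h.le x' y
    have heq := h.eq
    simp only [pairWeight] at hle heq
    linarith
  calc ‖P t x‖ = ‖(P t x - (2 * q) • x) + (2 * q) • x‖ := by rw [sub_add_cancel]
    _ ≤ ‖P t x - (2 * q) • x‖ + ‖(2 * q) • x‖ := norm_add_le _ _
    _ ≤ l + 2 * (q * ‖x‖) := by
      rw [norm_smul, Real.norm_of_nonneg (by positivity : 0 ≤ 2 * q)]
      linarith

lemma IsLipContact.norm_grad_sub_grad_le (h : IsLipContact w t l q x y)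
    (hw : IsFlow g T b w P H) (ht : t ∈ Ioc 0 T) (hq : 0 ≤ q) :
    ‖P t x - P t y‖ ≤ 2 * (q * (‖x‖ + ‖y‖)) := by
  have hsum := hw.sum_grad_eq_of_translation_max ht h.translation_max
  simp only [Fin.sum_univ_two, Matrix.cons_val_zero, Matrix.cons_val_one, one_smul, neg_smul,
    ← sub_eq_add_neg] at hsum
  rw [hsum, norm_smul, Real.norm_of_nonneg (by positivity : 0 ≤ 2 * q), mul_assoc]
  gcongr
  exact norm_add_le x y

-- The term `a l³ d` is the one that a Lipschitz constant with `ℓ' = a ℓ³` absorbs.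
lemma reaction_increment_le {X d S c : ℝ} (ha : 0 ≤ a) (hl : 0 ≤ l) (hlΛ : l ≤ Λ) (hq : 0 ≤ q)
    (hX : 0 ≤ X) (hqX : q * X ≤ c) (hdX : d * X ≤ 2 * S) (hS : 0 ≤ S) :
    a * (l * d + q * S) * (l + 2 * (q * X)) ^ 2 ≤
      a * l ^ 3 * d + (8 * a * Λ * (Λ + c) + a * (Λ + 2 * c) ^ 2) * (q * S) := by
  have hΛ : 0 ≤ Λ := hl.trans hlΛ
  have : 0 ≤ c := (mul_nonneg hq hX).trans hqX
  have hcross : a * l * 4 * (l + q * X) * q * (d * X) ≤ a * Λ * 4 * (Λ + c) * q * (2 * S) :=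
    (mul_le_mul_of_nonneg_left hdX (by positivity)).trans (by gcongr)
  have hsq : a * (q * S) * (l + 2 * (q * X)) ^ 2 ≤ a * (q * S) * (Λ + 2 * c) ^ 2 := by gcongr
  linarith

/-- Bound for the growth of `g(w(x)) ‖∇w(x)‖² - g(w(y)) ‖∇w(y)‖²` at a Lipschitz contact, relative
to the barrier. -/
def lipReactionRate (a B C Λ : ℝ) : ℝ :=
  8 * a * Λ * (Λ + 12 * C) + a * (Λ + 2 * (12 * C)) ^ 2 + 6 * B * (2 * Λ + 6 * (12 * C))

lemma IsLipContact.reaction_fst_le (h : IsLipContact w t l q x y) (hw : IsFlow g T b w P H)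
    (hbd : FlowBounds g T a B C m w) (ht : t ∈ Ioc 0 T) (hl : 0 ≤ l) (hlΛ : l ≤ Λ) (hq : 0 ≤ q) :
    (g (w t x) - g (w t y)) * ‖P t x‖ ^ 2 ≤ a * l ^ 3 * ‖x - y‖ +
      (8 * a * Λ * (Λ + 12 * C) + a * (Λ + 2 * (12 * C)) ^ 2) * (q * pairWeight (x, y)) := by
  have hS := (pairWeight_pos (x, y)).le
  have hbarrier : 0 ≤ l * ‖x - y‖ + q * pairWeight (x, y) := by positivity
  have hdiff : w t x - w t y = l * ‖x - y‖ + q * pairWeight (x, y) := by linarith [h.eq]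
  have hg : g (w t x) - g (w t y) ≤ a * (l * ‖x - y‖ + q * pairWeight (x, y)) := by
    rw [← hdiff]
    exact hbd.slope _ _ (hbd.lower t (Ioc_subset_Icc_self ht) y) (by linarith)
  calc (g (w t x) - g (w t y)) * ‖P t x‖ ^ 2
      ≤ a * (l * ‖x - y‖ + q * pairWeight (x, y)) * (l + 2 * (q * ‖x‖)) ^ 2 :=
        mul_le_mul hg (by gcongr; exact h.norm_grad_le hw ht hl hq) (by positivity)
          (mul_nonneg hbd.slope_nonneg hbarrier)
    _ ≤ _ := reaction_increment_le hbd.slope_nonneg hl hlΛ hq (norm_nonneg x)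
        (h.mul_norm_fst_le hbd (Ioc_subset_Icc_self ht) hl hq)
        (norm_sub_mul_norm_le_pairWeight x y) hS

lemma IsLipContact.reaction_snd_le (h : IsLipContact w t l q x y) (hw : IsFlow g T b w P H)
    (hbd : FlowBounds g T a B C m w) (ht : t ∈ Ioc 0 T) (hl : 0 ≤ l) (hlΛ : l ≤ Λ) (hq : 0 ≤ q) :
    g (w t y) * (‖P t x‖ ^ 2 - ‖P t y‖ ^ 2) ≤
      6 * B * (2 * Λ + 6 * (12 * C)) * (q * pairWeight (x, y)) := by
  have htI := Ioc_subset_Icc_self ht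
  have hB := hbd.reaction_const_nonneg htI
  have hC := hbd.growth_const_nonneg htI
  have hdiff := h.norm_grad_sub_grad_le hw ht hq
  have hnorms : ‖P t x‖ + ‖P t y‖ ≤ 2 * Λ + 6 * (12 * C) := by
    have htri : ‖P t y‖ ≤ ‖P t x‖ + ‖P t x - P t y‖ := norm_le_insert _ _
    linarith [h.norm_grad_le hw ht hl hq, h.mul_norm_fst_le hbd htI hl hq,
      h.mul_two_add_norms_le hbd htI hl hq]
  have hsq : |‖P t x‖ ^ 2 - ‖P t y‖ ^ 2| ≤
      2 * (q * (‖x‖ + ‖y‖)) * (2 * Λ + 6 * (12 * C)) :=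
    (abs_norm_sq_sub_norm_sq_le _ _).trans (mul_le_mul hdiff hnorms (by positivity) (by positivity))
  have hΛ : 0 ≤ Λ := hl.trans hlΛ
  calc g (w t y) * (‖P t x‖ ^ 2 - ‖P t y‖ ^ 2)
      ≤ |g (w t y)| * |‖P t x‖ ^ 2 - ‖P t y‖ ^ 2| := by rw [← abs_mul]; exact le_abs_self _
    _ ≤ (B * (1 + ‖y‖)) * (2 * (q * (‖x‖ + ‖y‖)) * (2 * Λ + 6 * (12 * C))) :=
        mul_le_mul (hbd.reaction t htI y) hsq (abs_nonneg _) (by positivity)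
    _ = 2 * B * (2 * Λ + 6 * (12 * C)) * q * ((1 + ‖y‖) * (‖x‖ + ‖y‖)) := by ring
    _ ≤ 2 * B * (2 * Λ + 6 * (12 * C)) * q * (3 * pairWeight (x, y)) :=
        mul_le_mul_of_nonneg_left (one_add_norm_mul_add_norm_le_pairWeight x y) (by positivity)
    _ = _ := by ring

lemma IsLipContact.deriv_lt (h : IsLipContact w t l q x y) (hw : IsFlow g T b w P H)
    (hbd : FlowBounds g T a B C m w) (ht : t ∈ Ioc 0 T) (hl : 0 ≤ l) (hlΛ : l ≤ Λ) (hq : 0 < q)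
    (hK : 4 * Fintype.card ι + lipReactionRate a B C Λ < K) :
    (∑ i, H t x i + g (w t x) * ‖P t x‖ ^ 2) - (∑ i, H t y i + g (w t y) * ‖P t y‖ ^ 2)
      - a * l ^ 3 * ‖x - y‖ < K * (q * pairWeight (x, y)) := by
  have hlap := hw.sum_laplacian_le_of_translation_max ht h.translation_max
  simp only [Fin.sum_univ_two, Matrix.cons_val_zero, Matrix.cons_val_one, one_mul, neg_mul] at hlap
  have hfst := h.reaction_fst_le hw hbd ht hl hlΛ hq.le
  have hsnd := h.reaction_snd_le hw hbd ht hl hlΛ hq.le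
  have hq_le : 4 * Fintype.card ι * q ≤ 4 * Fintype.card ι * (q * pairWeight (x, y)) := by
    gcongr
    exact le_mul_of_one_le_right hq.le (one_le_pairWeight _)
  have hKlt := mul_lt_mul_of_pos_right hK (mul_pos hq (pairWeight_pos (x, y)))
  rw [lipReactionRate] at hKlt
  linarith

theorem IsFlow.lipschitz [ProperSpace E] (hw : IsFlow g T b w P H)
    (hbd : FlowBounds g T a B C m w) {ℓ : ℝ → ℝ} (hℓc : ContinuousOn ℓ (Icc 0 T))
    (hℓ_nonneg : ∀ t ∈ Icc 0 T, 0 ≤ ℓ t) (hℓΛ : ∀ t ∈ Icc 0 T, ℓ t ≤ Λ)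
    (hℓ : ∀ t ∈ Ioc 0 T, HasDerivAt ℓ (a * ℓ t ^ 3) t)
    (hinit : ∀ x y, w 0 x - w 0 y ≤ ℓ 0 * ‖x - y‖) (ht : t ∈ Icc 0 T) (x y : E) :
    w t x - w t y ≤ ℓ t * ‖x - y‖ := by
  have ha := hbd.slope_nonneg
  have hB := hbd.reaction_const_nonneg ht
  have hC := hbd.growth_const_nonneg ht
  have hΛ : 0 ≤ Λ := (hℓ_nonneg t ht).trans (hℓΛ t ht)
  have hcomp : ∀ f : ℝ × (E × E) → E, Continuous f →
      ContinuousOn (fun p : ℝ × (E × E) => w p.1 (f p)) (Icc 0 T ×ˢ univ) := fun f hf =>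
    hw.cont.comp (f := fun p : ℝ × (E × E) => (p.1, f p)) (by fun_prop)
      fun p hp => ⟨hp.1, mem_univ _⟩
  have hcont : ContinuousOn (fun p : ℝ × (E × E) =>
      w p.1 p.2.1 - w p.1 p.2.2 - ℓ p.1 * ‖p.2.1 - p.2.2‖) (Icc 0 T ×ˢ univ) :=
    ((hcomp _ (by fun_prop)).sub (hcomp _ (by fun_prop))).sub
      ((hℓc.comp continuousOn_fst fun p hp => hp.1).mul (by fun_prop))
  refine sub_nonpos.1 (nonpos_of_deriv_lt_at_contact (X := E × E)
    (Θ := fun t p => w t p.1 - w t p.2 - ℓ t * ‖p.1 - p.2‖)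
    (K := 4 * Fintype.card ι + lipReactionRate a B C Λ + 1) (by unfold lipReactionRate; positivity)
    hcont continuous_pairWeight pairWeight_pos (fun ε hε => ?_)
    (fun p => sub_nonpos.2 (hinit p.1 p.2)) (fun s hs q hq p heq hle => ?_) ht (x, y))
  · filter_upwards [eventually_linear_lt_pairWeight (2 * C) hε] with p hp s hs
    exact (hbd.lip_growth hs (hℓ_nonneg s hs) p).trans_lt hp
  · have hsI := Ioc_subset_Icc_self hs
    have hcontact : IsLipContact w s (ℓ s) q p.1 p.2 := ⟨heq, fun x' y' => hle (x', y')⟩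
    exact ⟨_, hcontact.deriv_lt hw hbd hs (hℓ_nonneg s hsI) (hℓΛ s hsI) hq (lt_add_one _),
      ((hw.time s hs p.1).sub (hw.time s hs p.2)).sub ((hℓ s hs).mul_const _)⟩

end Lipschitz

end Flow

section Convexity

variable {E : Type*} [NormedAddCommGroup E] [InnerProductSpace ℝ E] {ι : Type*} [Fintype ι]
  {g : ℝ → ℝ} {T t q a B C m Λ K α β : ℝ} {b : ι → E} {w : ℝ → E → ℝ} {P : ℝ → E → E}
  {H : ℝ → E → ι → ℝ} {x y z : E}

lemma IsFlow.smul_grad_sub_grad_eq (hw : IsFlow g T b w P H) (ht : t ∈ Ioc 0 T) {γ : ℝ}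
    (hmax : ∀ e, w t (z + γ • e) - γ * w t (x + e) - q * ‖x + e‖ ^ 2 ≤
      w t z - γ * w t x - q * ‖x‖ ^ 2) :
    γ • (P t z - P t x) = (2 * q) • x := by
  refine ext_inner_right ℝ fun e => ?_
  have hderiv := ((hw.grad t ht z (γ • e)).sub ((hw.grad t ht x e).const_mul γ)).sub
    ((hasDerivAt_norm_sq_line x e 0).const_mul q)
  have hzero := IsLocalMax.hasDerivAt_eq_zero (Eventually.of_forall fun s => by
    have := hmax (s • e)
    rw [smul_comm] at this
    simpa using this) hderiv
  simp only [zero_smul, add_zero, real_inner_smul_right] at hzero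
  simp only [real_inner_smul_left, inner_sub_left]
  linarith

lemma IsFlow.norm_grad_le_of_lipschitz (hw : IsFlow g T b w P H) (ht : t ∈ Ioc 0 T) (hΛ : 0 ≤ Λ)
    (hlip : ∀ x y, w t x - w t y ≤ Λ * ‖x - y‖) (x : E) : ‖P t x‖ ≤ Λ := by
  simpa using hw.norm_grad_sub_le_of_max (q := 0) (x := x) (y := x) ht hΛ fun x' => by
    simpa [add_comm] using hlip x' x

/-- Contact of the convexity defect `w t (α x + β y) - α w t x - β w t y` with the barrier
`q (1 + ‖x‖² + ‖y‖²)` at `(x, y)`. -/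
structure IsConvContact (w : ℝ → E → ℝ) (t α β q : ℝ) (x y : E) : Prop where
  eq : w t (α • x + β • y) - α * w t x - β * w t y = q * pairWeight (x, y)
  le : ∀ x' y', w t (α • x' + β • y') - α * w t x' - β * w t y' ≤ q * pairWeight (x', y')

lemma IsConvContact.swap (h : IsConvContact w t α β q x y) : IsConvContact w t β α q y x where
  eq := by
    have := h.eq
    rw [add_comm, pairWeight_comm] at this
    linarith
  le x' y' := by
    have := h.le y' x'
    rw [add_comm, pairWeight_comm] at this
    linarith

lemma IsConvContact.smul_grad_sub_grad_eq (h : IsConvContact w t α β q x y)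
    (hw : IsFlow g T b w P H) (ht : t ∈ Ioc 0 T) :
    α • (P t (α • x + β • y) - P t x) = (2 * q) • x :=
  hw.smul_grad_sub_grad_eq ht fun e => by
    have hle := h.le (x + e) y
    have heq := h.eq
    rw [smul_add, add_right_comm] at hle
    simp only [pairWeight] at hle heq
    linarith

lemma IsConvContact.laplacian_le (h : IsConvContact w t α β q x y) (hw : IsFlow g T b w P H)
    (ht : t ∈ Ioc 0 T) (hαβ : α + β = 1) :
    ∑ i, H t (α • x + β • y) i - α * ∑ i, H t x i - β * ∑ i, H t y i ≤
      4 * Fintype.card ι * q := by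
  have hlap := hw.sum_laplacian_le_of_translation_max ht (c := ![1, -α, -β])
    (p := ![α • x + β • y, x, y]) (x := x) (y := y) (q := q) fun e => by
      have hle := h.le (x + e) (y + e)
      have hshift : α • (x + e) + β • (y + e) = α • x + β • y + e := by
        rw [smul_add, smul_add, add_add_add_comm, ← add_smul, hαβ, one_smul]
      rw [hshift] at hle
      simp only [Fin.sum_univ_three, Matrix.cons_val, one_mul, neg_mul]
      linarith [h.eq]
  simp only [Fin.sum_univ_three, Matrix.cons_val, one_mul, neg_mul] at hlap
  linarith

lemma IsConvContact.reaction_mid_le (h : IsConvContact w t α β q x y)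
    (hbd : FlowBounds g T a B C m w) (hgc : ConvexOn ℝ (Ici m) g) (ht : t ∈ Ioc 0 T)
    (hα : 0 ≤ α) (hβ : 0 ≤ β) (hαβ : α + β = 1) (hq : 0 ≤ q) :
    g (w t (α • x + β • y)) - α * g (w t x) - β * g (w t y) ≤ a * (q * pairWeight (x, y)) := by
  have hm := hbd.lower t (Ioc_subset_Icc_self ht)
  have hconv := hgc.2 (hm x) (hm y) hα hβ hαβ
  have hmid : m ≤ α * w t x + β * w t y := (convex_Ici m) (hm x) (hm y) hα hβ hαβ
  have hdiff : w t (α • x + β • y) - (α * w t x + β * w t y) = q * pairWeight (x, y) := by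
    linarith [h.eq]
  have hbarrier : 0 ≤ q * pairWeight (x, y) := mul_nonneg hq (pairWeight_pos _).le
  have hslope := hbd.slope _ (w t (α • x + β • y)) hmid (by linarith)
  rw [hdiff] at hslope
  simp only [smul_eq_mul] at hconv
  linarith

lemma IsConvContact.reaction_end_le (h : IsConvContact w t α β q x y) (hw : IsFlow g T b w P H)
    (hbd : FlowBounds g T a B C m w) (ht : t ∈ Ioc 0 T) (hα : 0 ≤ α) (hq : 0 ≤ q)
    (hP : ∀ x, ‖P t x‖ ≤ Λ) :
    α * (g (w t x) * (‖P t (α • x + β • y)‖ ^ 2 - ‖P t x‖ ^ 2)) ≤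
      8 * Λ * B * (q * pairWeight (x, y)) := by
  set z := α • x + β • y
  have hΛ : 0 ≤ Λ := (norm_nonneg _).trans (hP x)
  have hB := hbd.reaction_const_nonneg (Ioc_subset_Icc_self ht)
  have hgrad : α * ‖P t z - P t x‖ = 2 * q * ‖x‖ := by
    rw [← Real.norm_of_nonneg hα, ← norm_smul, h.smul_grad_sub_grad_eq hw ht, norm_smul,
      Real.norm_of_nonneg (by positivity)]
  have hsq : α * |‖P t z‖ ^ 2 - ‖P t x‖ ^ 2| ≤ 2 * q * ‖x‖ * (2 * Λ) :=
    calc α * |‖P t z‖ ^ 2 - ‖P t x‖ ^ 2| ≤ α * (‖P t z - P t x‖ * (‖P t z‖ + ‖P t x‖)) := by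
          gcongr
          exact abs_norm_sq_sub_norm_sq_le _ _
      _ = 2 * q * ‖x‖ * (‖P t z‖ + ‖P t x‖) := by rw [← mul_assoc, hgrad]
      _ ≤ 2 * q * ‖x‖ * (2 * Λ) := by
          gcongr
          linarith [hP z, hP x]
  have hweight : (1 + ‖x‖) * ‖x‖ ≤ 2 * pairWeight (x, y) := one_add_norm_mul_norm_le_pairWeight x y
  calc α * (g (w t x) * (‖P t z‖ ^ 2 - ‖P t x‖ ^ 2))
      ≤ α * (|g (w t x)| * |‖P t z‖ ^ 2 - ‖P t x‖ ^ 2|) := by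
        rw [← abs_mul]
        gcongr
        exact le_abs_self _
    _ = |g (w t x)| * (α * |‖P t z‖ ^ 2 - ‖P t x‖ ^ 2|) := by ring
    _ ≤ (B * (1 + ‖x‖)) * (2 * q * ‖x‖ * (2 * Λ)) :=
        mul_le_mul (hbd.reaction t (Ioc_subset_Icc_self ht) x) hsq (by positivity) (by positivity)
    _ = 4 * Λ * B * q * ((1 + ‖x‖) * ‖x‖) := by ring
    _ ≤ 4 * Λ * B * q * (2 * pairWeight (x, y)) := by gcongr
    _ = _ := by ring

lemma IsConvContact.deriv_lt (h : IsConvContact w t α β q x y) (hw : IsFlow g T b w P H)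
    (hbd : FlowBounds g T a B C m w) (hgc : ConvexOn ℝ (Ici m) g) (ht : t ∈ Ioc 0 T)
    (hα : 0 ≤ α) (hβ : 0 ≤ β) (hαβ : α + β = 1) (hq : 0 < q) (hP : ∀ x, ‖P t x‖ ≤ Λ)
    (hK : 4 * Fintype.card ι + a * Λ ^ 2 + 16 * Λ * B < K) :
    (∑ i, H t (α • x + β • y) i + g (w t (α • x + β • y)) * ‖P t (α • x + β • y)‖ ^ 2)
      - α * (∑ i, H t x i + g (w t x) * ‖P t x‖ ^ 2)
      - β * (∑ i, H t y i + g (w t y) * ‖P t y‖ ^ 2) < K * (q * pairWeight (x, y)) := by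
  have hbarrier : 0 < q * pairWeight (x, y) := mul_pos hq (pairWeight_pos _)
  have hlap : _ ≤ 4 * Fintype.card ι * (q * pairWeight (x, y)) :=
    (h.laplacian_le hw ht hαβ).trans (by
      gcongr
      exact le_mul_of_one_le_right hq.le (one_le_pairWeight _))
  have hmid : (g (w t (α • x + β • y)) - α * g (w t x) - β * g (w t y)) *
      ‖P t (α • x + β • y)‖ ^ 2 ≤ a * (q * pairWeight (x, y)) * Λ ^ 2 :=
    mul_le_mul (h.reaction_mid_le hbd hgc ht hα hβ hαβ hq.le) (by gcongr; exact hP _)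
      (by positivity) (mul_nonneg hbd.slope_nonneg hbarrier.le)
  have hx := h.reaction_end_le hw hbd ht hα hq.le hP
  have hy := h.swap.reaction_end_le hw hbd ht hβ hq.le hP
  rw [add_comm (β • y), pairWeight_comm y x] at hy
  linarith [mul_lt_mul_of_pos_right hK hbarrier]

lemma FlowBounds.conv_growth (hbd : FlowBounds g T a B C m w) (ht : t ∈ Icc 0 T) (hα : 0 ≤ α)
    (hβ : 0 ≤ β) (hαβ : α + β = 1) (p : E × E) :
    w t (α • p.1 + β • p.2) - α * w t p.1 - β * w t p.2 ≤ 2 * C * (1 + ‖p‖) := by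
  have hC := hbd.growth_const_nonneg ht
  have hgrowth : ∀ z : E, ‖z‖ ≤ ‖p‖ → |w t z| ≤ C * (1 + ‖p‖) := fun z hz =>
    (hbd.growth t ht z).trans (by gcongr)
  have hmid : ‖α • p.1 + β • p.2‖ ≤ ‖p‖ := by
    simpa using (convex_closedBall (0 : E) ‖p‖) (mem_closedBall_zero_iff.2 (norm_fst_le p))
      (mem_closedBall_zero_iff.2 (norm_snd_le p)) hα hβ hαβ
  have hfst := mul_le_mul_of_nonneg_left (neg_le_of_abs_le (hgrowth p.1 (norm_fst_le p))) hα
  have hsnd := mul_le_mul_of_nonneg_left (neg_le_of_abs_le (hgrowth p.2 (norm_snd_le p))) hβ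
  have hone : α * (C * (1 + ‖p‖)) + β * (C * (1 + ‖p‖)) = C * (1 + ‖p‖) := by
    rw [← add_mul, hαβ, one_mul]
  linarith [le_of_abs_le (hgrowth _ hmid)]

theorem IsFlow.convexOn [ProperSpace E] (hw : IsFlow g T b w P H)
    (hbd : FlowBounds g T a B C m w) (hgc : ConvexOn ℝ (Ici m) g) (hΛ : 0 ≤ Λ)
    (hlip : ∀ t ∈ Icc 0 T, ∀ x y, w t x - w t y ≤ Λ * ‖x - y‖) (hconv : ConvexOn ℝ univ (w 0))
    (ht : t ∈ Icc 0 T) : ConvexOn ℝ univ (w t) := by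
  refine ⟨convex_univ, fun x _ y _ α β hα hβ hαβ => ?_⟩
  have ha := hbd.slope_nonneg
  have hB := hbd.reaction_const_nonneg ht
  have hcomp : ∀ f : ℝ × (E × E) → E, Continuous f →
      ContinuousOn (fun p : ℝ × (E × E) => w p.1 (f p)) (Icc 0 T ×ˢ univ) := fun f hf =>
    hw.cont.comp (f := fun p : ℝ × (E × E) => (p.1, f p)) (by fun_prop)
      fun p hp => ⟨hp.1, mem_univ _⟩
  have hcont : ContinuousOn (fun p : ℝ × (E × E) =>
      w p.1 (α • p.2.1 + β • p.2.2) - α * w p.1 p.2.1 - β * w p.1 p.2.2) (Icc 0 T ×ˢ univ) :=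
    ((hcomp _ (by fun_prop)).sub ((hcomp _ (by fun_prop)).const_mul α)).sub
      ((hcomp _ (by fun_prop)).const_mul β)
  have hdefect : w t (α • x + β • y) - α * w t x - β * w t y ≤ 0 :=
    nonpos_of_deriv_lt_at_contact (X := E × E)
    (Θ := fun t p => w t (α • p.1 + β • p.2) - α * w t p.1 - β * w t p.2)
    (K := 4 * Fintype.card ι + a * Λ ^ 2 + 16 * Λ * B + 1) (by positivity)
    hcont continuous_pairWeight pairWeight_pos (fun ε hε => ?_) (fun p => ?_)
    (fun s hs q hq p heq hle => ?_) ht (x, y)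
  · simp only [smul_eq_mul]
    linarith
  · filter_upwards [eventually_linear_lt_pairWeight (2 * C) hε] with p hp s hs
    exact (hbd.conv_growth hs hα hβ hαβ p).trans_lt hp
  · have := hconv.2 (mem_univ p.1) (mem_univ p.2) hα hβ hαβ
    simp only [smul_eq_mul] at this
    linarith
  · have hcontact : IsConvContact w s α β q p.1 p.2 := ⟨heq, fun x' y' => hle (x', y')⟩
    exact ⟨_, hcontact.deriv_lt hw hbd hgc hs hα hβ hαβ hq
      (hw.norm_grad_le_of_lipschitz hs hΛ (hlip s (Ioc_subset_Icc_self hs))) (lt_add_one _),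
      ((hw.time s hs _).sub ((hw.time s hs p.1).const_mul α)).sub
        ((hw.time s hs p.2).const_mul β)⟩

end Convexity

section GaussianBounds

variable {V : Type*} [NormedAddCommGroup V] [InnerProductSpace ℝ V] [FiniteDimensional ℝ V]
  [MeasurableSpace V] [BorelSpace V] {b : ℝ}

lemma integrable_exp_neg_mul_norm_sq (hb : 0 < b) :
    Integrable fun y : V => Real.exp (-b * ‖y‖ ^ 2) := by
  refine not_imp_comm.1 integral_undef ?_
  rw [GaussianFourier.integral_rexp_neg_mul_sq_norm hb]
  positivity

lemma integrable_exp_quadratic (hb : 0 < b) (A c : ℝ) :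
    Integrable fun y : V => A * Real.exp (-b * ‖y‖ ^ 2 + c * ‖y‖) := by
  refine (((integrable_exp_neg_mul_norm_sq (half_pos hb)).const_mul
    (Real.exp (c ^ 2 / (2 * b)))).mono' (by fun_prop)
      (Eventually.of_forall fun y => ?_)).const_mul A
  rw [Real.norm_of_nonneg (Real.exp_pos _).le, ← Real.exp_add, Real.exp_le_exp, ← sub_nonneg]
  have hsq : c ^ 2 / (2 * b) + -(b / 2) * ‖y‖ ^ 2 - (-b * ‖y‖ ^ 2 + c * ‖y‖) =
      (c - b * ‖y‖) ^ 2 / (2 * b) := by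
    field_simp
    ring
  rw [hsq]
  positivity

lemma integrable_of_norm_le_exp_quadratic {G : Type*} [NormedAddCommGroup G] {ψ : V → G}
    (hψ : Continuous ψ) {A c : ℝ} (hb : 0 < b)
    (h : ∀ y, ‖ψ y‖ ≤ A * Real.exp (-b * ‖y‖ ^ 2 + c * ‖y‖)) : Integrable ψ :=
  (integrable_exp_quadratic hb A c).mono' hψ.aestronglyMeasurable (Eventually.of_forall h)

end GaussianBounds

section GaussianGrowth

/-- Continuous functions of growth at most `C exp (β ‖y‖²)`, the class on which the heat flow is
studied. -/
structure GaussianGrowth {V : Type*} [NormedAddCommGroup V] (C β : ℝ) (φ : V → ℝ) : Prop where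
  continuous : Continuous φ
  abs_le : ∀ y, |φ y| ≤ C * Real.exp (β * ‖y‖ ^ 2)

variable {V : Type*} [NormedAddCommGroup V] {C β A b c : ℝ} {φ : V → ℝ}

lemma GaussianGrowth.const_nonneg (hφ : GaussianGrowth C β φ) : 0 ≤ C := by
  simpa using (abs_nonneg _).trans (hφ.abs_le 0)

lemma gaussianGrowth_const (c : ℝ) : GaussianGrowth |c| 0 fun _ : V => c :=
  ⟨continuous_const, fun y => by simp⟩

lemma GaussianGrowth.norm_smul_le {G : Type*} [NormedAddCommGroup G] [NormedSpace ℝ G]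
    (hφ : GaussianGrowth C β φ) {k : V → G} {y : V}
    (hk : ‖k y‖ ≤ A * Real.exp (-b * ‖y‖ ^ 2 + c * ‖y‖)) :
    ‖φ y • k y‖ ≤ C * A * Real.exp (-(b - β) * ‖y‖ ^ 2 + c * ‖y‖) := by
  have hC := hφ.const_nonneg
  calc ‖φ y • k y‖
      ≤ (C * Real.exp (β * ‖y‖ ^ 2)) * (A * Real.exp (-b * ‖y‖ ^ 2 + c * ‖y‖)) := by
        rw [norm_smul]
        exact mul_le_mul (hφ.abs_le y) hk (norm_nonneg _) (by positivity)
    _ = C * A * (Real.exp (β * ‖y‖ ^ 2) * Real.exp (-b * ‖y‖ ^ 2 + c * ‖y‖)) := by ring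
    _ = _ := by
        rw [← Real.exp_add]
        ring_nf

variable [InnerProductSpace ℝ V] [FiniteDimensional ℝ V] [MeasurableSpace V] [BorelSpace V]

lemma GaussianGrowth.integrable_smul {G : Type*} [NormedAddCommGroup G] [NormedSpace ℝ G]
    (hφ : GaussianGrowth C β φ) (hβ : β < b) {k : V → G} (hkc : Continuous k)
    (hk : ∀ y, ‖k y‖ ≤ A * Real.exp (-b * ‖y‖ ^ 2 + c * ‖y‖)) :
    Integrable fun y => φ y • k y :=
  integrable_of_norm_le_exp_quadratic (hφ.continuous.smul hkc) (sub_pos.2 hβ)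
    fun y => hφ.norm_smul_le (hk y)

lemma GaussianGrowth.hasDerivAt_integral (hφ : GaussianGrowth C β φ) (hβ : β < b)
    {k k' : ℝ → V → ℝ} {s : ℝ} {U : Set ℝ} (hU : U ∈ 𝓝 s) (hk : ∀ r, Continuous (k r))
    (hk' : Continuous (k' s)) (hint : Integrable fun y => φ y * k s y)
    (hbound : ∀ r ∈ U, ∀ y, |k' r y| ≤ A * Real.exp (-b * ‖y‖ ^ 2 + c * ‖y‖))
    (hderiv : ∀ r ∈ U, ∀ y, HasDerivAt (fun r => k r y) (k' r y) r) :
    HasDerivAt (fun r => ∫ y, φ y * k r y) (∫ y, φ y * k' s y) s :=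
  (hasDerivAt_integral_of_dominated_loc_of_deriv_le (F := fun r y => φ y * k r y)
    (F' := fun r y => φ y * k' r y) hU
    (Eventually.of_forall fun r => (hφ.continuous.mul (hk r)).aestronglyMeasurable) hint
    (hφ.continuous.mul hk').aestronglyMeasurable
    (Eventually.of_forall fun y r hr => hφ.norm_smul_le (hbound r hr y))
    (integrable_exp_quadratic (sub_pos.2 hβ) _ _)
    (Eventually.of_forall fun y r hr => (hderiv r hr y).const_mul (φ y))).2

end GaussianGrowth

section HeatKernel

variable {n : ℕ} {t : ℝ}

lemma gaussKernel_pos (z : EuclideanSpace ℝ (Fin n)) (ht : 0 < t) : 0 < gaussKernel z t := by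
  unfold gaussKernel
  positivity

@[fun_prop]
lemma continuous_gaussKernel (t : ℝ) :
    Continuous fun z : EuclideanSpace ℝ (Fin n) => gaussKernel z t := by
  unfold gaussKernel
  fun_prop

lemma gaussKernel_le {t₀ t₁ : ℝ} (ht₀ : 0 < t₀) (ht : t ∈ Icc t₀ t₁)
    (z : EuclideanSpace ℝ (Fin n)) :
    gaussKernel z t ≤
      (4 * Real.pi * t₀) ^ (-(n : ℝ) / 2) * Real.exp (-(1 / (4 * t₁)) * ‖z‖ ^ 2) := by
  have htpos : 0 < t := ht₀.trans_le ht.1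
  unfold gaussKernel
  refine mul_le_mul ?_ (Real.exp_le_exp.2 ?_) (Real.exp_pos _).le (by positivity)
  · refine Real.rpow_le_rpow_of_nonpos (by positivity) (by gcongr; exact ht.1) ?_
    have : (0 : ℝ) ≤ n := n.cast_nonneg
    linarith
  · have hinv : 1 / (4 * t₁) ≤ 1 / (4 * t) := by
      gcongr
      exact ht.2
    calc -‖z‖ ^ 2 / (4 * t) = -(1 / (4 * t) * ‖z‖ ^ 2) := by ring
      _ ≤ -(1 / (4 * t₁) * ‖z‖ ^ 2) := by gcongr
      _ = -(1 / (4 * t₁)) * ‖z‖ ^ 2 := by ring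

lemma sq_norm_sub_linear_le {V : Type*} [NormedAddCommGroup V] {x : V} {R : ℝ} (hx : ‖x‖ ≤ R)
    (y : V) : ‖y‖ ^ 2 - 2 * R * ‖y‖ ≤ ‖x - y‖ ^ 2 := by
  have hsq : (‖x‖ - ‖y‖) ^ 2 ≤ ‖x - y‖ ^ 2 := sq_le_sq.2 <| by
    rw [abs_norm]
    exact abs_norm_sub_norm_le x y
  nlinarith [sq_nonneg ‖x‖, mul_le_mul_of_nonneg_right hx (norm_nonneg y)]

-- The factor `exp (2 ‖x - y‖)` leaves room for coefficients polynomial in `x - y`.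
lemma abs_mul_gaussKernel_le {t₀ t₁ R D d : ℝ} (ht₀ : 0 < t₀) (ht : t ∈ Icc t₀ t₁) (hD : 0 ≤ D)
    {x : EuclideanSpace ℝ (Fin n)} (hx : ‖x‖ ≤ R) (y : EuclideanSpace ℝ (Fin n))
    (hd : |d| ≤ D * Real.exp (2 * ‖x - y‖)) :
    |d * gaussKernel (x - y) t| ≤ D * Real.exp (2 * R) * (4 * Real.pi * t₀) ^ (-(n : ℝ) / 2) *
      Real.exp (-(1 / (4 * t₁)) * ‖y‖ ^ 2 + (2 * R / (4 * t₁) + 2) * ‖y‖) := by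
  have ht₁ : 0 < t₁ := ht₀.trans_le (ht.1.trans ht.2)
  have hd' : |d| ≤ D * Real.exp (2 * R + 2 * ‖y‖) := hd.trans <| by
    gcongr
    linarith [norm_sub_le x y]
  have hexp : Real.exp (-(1 / (4 * t₁)) * ‖x - y‖ ^ 2) ≤
      Real.exp (-(1 / (4 * t₁)) * (‖y‖ ^ 2 - 2 * R * ‖y‖)) := by
    rw [neg_mul, neg_mul]
    gcongr
    exact sq_norm_sub_linear_le hx y
  rw [abs_mul, abs_of_pos (gaussKernel_pos _ (ht₀.trans_le ht.1))]
  calc |d| * gaussKernel (x - y) t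
      ≤ (D * Real.exp (2 * R + 2 * ‖y‖)) * ((4 * Real.pi * t₀) ^ (-(n : ℝ) / 2) *
          Real.exp (-(1 / (4 * t₁)) * (‖y‖ ^ 2 - 2 * R * ‖y‖))) :=
        mul_le_mul hd' ((gaussKernel_le ht₀ ht _).trans (by gcongr))
          (gaussKernel_pos _ (ht₀.trans_le ht.1)).le (by positivity)
    _ = D * (4 * Real.pi * t₀) ^ (-(n : ℝ) / 2) * (Real.exp (2 * R + 2 * ‖y‖) *
          Real.exp (-(1 / (4 * t₁)) * (‖y‖ ^ 2 - 2 * R * ‖y‖))) := by ring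
    _ = D * (4 * Real.pi * t₀) ^ (-(n : ℝ) / 2) * (Real.exp (2 * R) *
          Real.exp (-(1 / (4 * t₁)) * ‖y‖ ^ 2 + (2 * R / (4 * t₁) + 2) * ‖y‖)) := by
        rw [← Real.exp_add, ← Real.exp_add]
        ring_nf
    _ = _ := by ring

lemma le_exp_two_mul {s : ℝ} (hs : 0 ≤ s) : s ≤ Real.exp (2 * s) := by
  linarith [Real.add_one_le_exp (2 * s)]

lemma sq_le_exp_two_mul {s : ℝ} (hs : 0 ≤ s) : s ^ 2 ≤ Real.exp (2 * s) := by
  rw [two_mul, Real.exp_add, ← sq]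
  gcongr
  linarith [Real.add_one_le_exp s]

lemma hasDerivAt_gaussKernel_line (z e : EuclideanSpace ℝ (Fin n)) (t s : ℝ) :
    HasDerivAt (fun s : ℝ => gaussKernel (z + s • e) t)
      (-(1 / (2 * t)) * ⟪z + s • e, e⟫ * gaussKernel (z + s • e) t) s := by
  refine ((((hasDerivAt_norm_sq_line z e s).neg.div_const (4 * t)).exp).const_mul
    ((4 * Real.pi * t) ^ (-(n : ℝ) / 2))).congr_deriv ?_
  unfold gaussKernel
  simp only [Pi.neg_apply]
  rw [show -(2 * ⟪z + s • e, e⟫) / (4 * t) = -(1 / (2 * t)) * ⟪z + s • e, e⟫ by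
    rcases eq_or_ne t 0 with rfl | ht
    · simp
    · field_simp; ring]
  ring

lemma hasDerivAt_gaussKernel_line_snd (z e : EuclideanSpace ℝ (Fin n)) (t s : ℝ) :
    HasDerivAt (fun s : ℝ => -(1 / (2 * t)) * ⟪z + s • e, e⟫ * gaussKernel (z + s • e) t)
      ((⟪z + s • e, e⟫ ^ 2 / (4 * t ^ 2) - ‖e‖ ^ 2 / (2 * t)) * gaussKernel (z + s • e) t) s := by
  refine (((hasDerivAt_inner_line z e s).const_mul (-(1 / (2 * t)))).mul
    (hasDerivAt_gaussKernel_line z e t s)).congr_deriv ?_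
  rcases eq_or_ne t 0 with rfl | ht
  · simp
  · field_simp
    ring

lemma hasDerivAt_gaussKernel_time (z : EuclideanSpace ℝ (Fin n)) (ht : 0 < t) :
    HasDerivAt (fun t : ℝ => gaussKernel z t)
      ((‖z‖ ^ 2 / (4 * t ^ 2) - n / (2 * t)) * gaussKernel z t) t := by
  have hpow := ((hasDerivAt_id t).const_mul (4 * Real.pi)).rpow_const (p := -(n : ℝ) / 2)
    (Or.inl (by simp only [id]; positivity))
  have hexponent : HasDerivAt (fun t : ℝ => -‖z‖ ^ 2 / (4 * t)) (‖z‖ ^ 2 / (4 * t ^ 2)) t := by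
    refine ((hasDerivAt_const t (-‖z‖ ^ 2)).div ((hasDerivAt_id t).const_mul (4 : ℝ))
      (by simp only [id]; positivity)).congr_deriv ?_
    simp only [id]
    field_simp
    ring
  refine (hpow.mul hexponent.exp).congr_deriv ?_
  unfold gaussKernel
  simp only [id]
  rw [Real.rpow_sub_one (by positivity)]
  field_simp
  ring

lemma abs_grad_coeff_le (z e : EuclideanSpace ℝ (Fin n)) (ht : 0 < t) :
    |-(1 / (2 * t)) * ⟪z, e⟫| ≤ ‖e‖ / (2 * t) * Real.exp (2 * ‖z‖) :=
  calc |-(1 / (2 * t)) * ⟪z, e⟫| = 1 / (2 * t) * |⟪z, e⟫| := by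
        rw [abs_mul, abs_neg, abs_of_pos (by positivity : 0 < 1 / (2 * t))]
    _ ≤ 1 / (2 * t) * (Real.exp (2 * ‖z‖) * ‖e‖) := by
        gcongr
        exact (abs_real_inner_le_norm z e).trans
          (by gcongr; exact le_exp_two_mul (norm_nonneg z))
    _ = _ := by ring

lemma abs_sub_le_add_mul_exp {u v U W s : ℝ} (hs : 0 ≤ s) (hu : 0 ≤ u) (hv : 0 ≤ v)
    (huU : u ≤ U * Real.exp (2 * s)) (hvW : v ≤ W) : |u - v| ≤ (U + W) * Real.exp (2 * s) := by
  have hW : W ≤ W * Real.exp (2 * s) :=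
    le_mul_of_one_le_right (hv.trans hvW) (Real.one_le_exp (by positivity))
  rw [abs_le]
  constructor <;> linarith

lemma abs_hess_coeff_le (z e : EuclideanSpace ℝ (Fin n)) (ht : 0 < t) :
    |⟪z, e⟫ ^ 2 / (4 * t ^ 2) - ‖e‖ ^ 2 / (2 * t)| ≤
      (‖e‖ ^ 2 / (4 * t ^ 2) + ‖e‖ ^ 2 / (2 * t)) * Real.exp (2 * ‖z‖) := by
  have hinner : ⟪z, e⟫ ^ 2 ≤ Real.exp (2 * ‖z‖) * ‖e‖ ^ 2 :=
    calc ⟪z, e⟫ ^ 2 ≤ (‖z‖ * ‖e‖) ^ 2 := by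
          rw [← sq_abs]
          gcongr
          exact abs_real_inner_le_norm z e
      _ ≤ Real.exp (2 * ‖z‖) * ‖e‖ ^ 2 := by
          rw [mul_pow]
          gcongr
          exact sq_le_exp_two_mul (norm_nonneg z)
  refine abs_sub_le_add_mul_exp (norm_nonneg z) (by positivity) (by positivity) ?_ le_rfl
  rw [div_mul_eq_mul_div, mul_comm (‖e‖ ^ 2)]
  gcongr

lemma abs_time_coeff_le {t₀ : ℝ} (ht₀ : 0 < t₀) (ht : t₀ ≤ t) (z : EuclideanSpace ℝ (Fin n)) :
    |‖z‖ ^ 2 / (4 * t ^ 2) - n / (2 * t)| ≤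
      (1 / (4 * t₀ ^ 2) + n / (2 * t₀)) * Real.exp (2 * ‖z‖) := by
  have htpos : 0 < t := ht₀.trans_le ht
  refine abs_sub_le_add_mul_exp (norm_nonneg z) (by positivity) (by positivity) ?_ (by gcongr)
  rw [div_mul_eq_mul_div, one_mul]
  gcongr
  exact sq_le_exp_two_mul (norm_nonneg z)

lemma sum_hess_coeff (z : EuclideanSpace ℝ (Fin n)) (t : ℝ) :
    ∑ i, (⟪z, EuclideanSpace.basisFun (Fin n) ℝ i⟫ ^ 2 / (4 * t ^ 2)
      - ‖EuclideanSpace.basisFun (Fin n) ℝ i‖ ^ 2 / (2 * t)) =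
    ‖z‖ ^ 2 / (4 * t ^ 2) - n / (2 * t) := by
  rw [Finset.sum_sub_distrib, ← Finset.sum_div, ← Finset.sum_div,
    OrthonormalBasis.sum_sq_inner_left]
  simp

end HeatKernel

section HeatFlow

variable {n : ℕ} {C β t : ℝ} {φ : EuclideanSpace ℝ (Fin n) → ℝ}

/-- The spatial gradient of the heat flow. -/
def heatGrad (φ : EuclideanSpace ℝ (Fin n) → ℝ) (t : ℝ) (x : EuclideanSpace ℝ (Fin n)) :
    EuclideanSpace ℝ (Fin n) :=
  ∫ y, φ y • ((-(1 / (2 * t)) * gaussKernel (x - y) t) • (x - y))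

/-- The second derivative of the heat flow in the direction `e`. -/
def heatHess (φ : EuclideanSpace ℝ (Fin n) → ℝ) (t : ℝ) (x e : EuclideanSpace ℝ (Fin n)) : ℝ :=
  ∫ y, φ y * ((⟪x - y, e⟫ ^ 2 / (4 * t ^ 2) - ‖e‖ ^ 2 / (2 * t)) * gaussKernel (x - y) t)

lemma heatFlow_eq_integral (φ : EuclideanSpace ℝ (Fin n) → ℝ) (ht : 0 < t)
    (x : EuclideanSpace ℝ (Fin n)) : heatFlow φ t x = ∫ y, φ y * gaussKernel (x - y) t := by
  simp only [heatFlow, if_pos ht, mul_comm]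

lemma GaussianGrowth.integrable_mul_gaussKernel (hφ : GaussianGrowth C β φ) (ht : 0 < t)
    (htβ : β < 1 / (4 * t)) (x : EuclideanSpace ℝ (Fin n)) {a : EuclideanSpace ℝ (Fin n) → ℝ}
    (ha : Continuous a) {D : ℝ} (hD : 0 ≤ D) (haD : ∀ z, |a z| ≤ D * Real.exp (2 * ‖z‖)) :
    Integrable fun y => φ y * (a (x - y) * gaussKernel (x - y) t) :=
  hφ.integrable_smul htβ (by fun_prop) fun y =>
    abs_mul_gaussKernel_le ht ⟨le_rfl, le_rfl⟩ hD le_rfl y (haD (x - y))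

lemma GaussianGrowth.integrable_gaussKernel_mul (hφ : GaussianGrowth C β φ) (ht : 0 < t)
    (htβ : β < 1 / (4 * t)) (x : EuclideanSpace ℝ (Fin n)) :
    Integrable fun y => gaussKernel (x - y) t * φ y := by
  simpa [mul_comm] using hφ.integrable_mul_gaussKernel ht htβ x (a := fun _ => 1)
    continuous_const zero_le_one fun z => by simp

lemma integrable_gaussKernel (ht : 0 < t) (x : EuclideanSpace ℝ (Fin n)) :
    Integrable fun y => gaussKernel (x - y) t := by
  simpa using (gaussianGrowth_const 1).integrable_gaussKernel_mul ht (by positivity) x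

lemma GaussianGrowth.inner_heatGrad (hφ : GaussianGrowth C β φ) (ht : 0 < t)
    (htβ : β < 1 / (4 * t)) (x e : EuclideanSpace ℝ (Fin n)) :
    ⟪heatGrad φ t x, e⟫ =
      ∫ y, φ y * (-(1 / (2 * t)) * ⟪x - y, e⟫ * gaussKernel (x - y) t) := by
  have hint : Integrable fun y => φ y • ((-(1 / (2 * t)) * gaussKernel (x - y) t) • (x - y)) := by
    refine hφ.integrable_smul (c := 2 * ‖x‖ / (4 * t) + 2)
      (A := 1 / (2 * t) * Real.exp (2 * ‖x‖) * (4 * Real.pi * t) ^ (-(n : ℝ) / 2))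
      htβ (by fun_prop) fun y => ?_
    rw [norm_smul, ← norm_norm (x - y), ← norm_mul, mul_right_comm, Real.norm_eq_abs]
    refine abs_mul_gaussKernel_le ht ⟨le_rfl, le_rfl⟩ (by positivity : 0 ≤ 1 / (2 * t)) le_rfl y ?_
    rw [abs_mul, abs_neg, abs_of_pos (by positivity : 0 < 1 / (2 * t)), abs_norm]
    gcongr
    exact le_exp_two_mul (norm_nonneg _)
  rw [heatGrad, real_inner_comm, ← integral_inner hint e]
  refine integral_congr_ae (Eventually.of_forall fun y => ?_)
  simp only [real_inner_smul_right, real_inner_comm e]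
  ring

lemma GaussianGrowth.hasDerivAt_integral_line (hφ : GaussianGrowth C β φ) (ht : 0 < t)
    (htβ : β < 1 / (4 * t)) (x e : EuclideanSpace ℝ (Fin n))
    {a a' : EuclideanSpace ℝ (Fin n) → ℝ} (ha : Continuous a) (ha' : Continuous a') {D D' : ℝ}
    (hD : 0 ≤ D) (hD' : 0 ≤ D') (haD : ∀ z, |a z| ≤ D * Real.exp (2 * ‖z‖))
    (haD' : ∀ z, |a' z| ≤ D' * Real.exp (2 * ‖z‖))
    (hderiv : ∀ z s, HasDerivAt (fun s : ℝ => a (z + s • e) * gaussKernel (z + s • e) t)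
      (a' (z + s • e) * gaussKernel (z + s • e) t) s) :
    HasDerivAt (fun s : ℝ => ∫ y, φ y * (a (x + s • e - y) * gaussKernel (x + s • e - y) t))
      (∫ y, φ y * (a' (x - y) * gaussKernel (x - y) t)) 0 := by
  have hball : ∀ s ∈ Metric.ball (0 : ℝ) 1, ‖x + s • e‖ ≤ ‖x‖ + ‖e‖ := fun s hs => by
    refine (norm_add_le _ _).trans ?_
    rw [norm_smul]
    gcongr
    exact mul_le_of_le_one_left (norm_nonneg e) (mem_ball_zero_iff.1 hs).le
  have h := hφ.hasDerivAt_integral htβ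
    (k := fun s y => a (x + s • e - y) * gaussKernel (x + s • e - y) t)
    (k' := fun s y => a' (x + s • e - y) * gaussKernel (x + s • e - y) t)
    (Metric.ball_mem_nhds 0 one_pos) (fun s => by fun_prop) (by fun_prop)
    (by simpa using hφ.integrable_mul_gaussKernel ht htβ x ha hD haD)
    (fun s hs y => abs_mul_gaussKernel_le ht ⟨le_rfl, le_rfl⟩ hD' (hball s hs) y
      (haD' (x + s • e - y)))
    fun s _ y => by simpa only [add_sub_right_comm] using hderiv (x - y) s
  simpa only [zero_smul, add_zero] using h

lemma GaussianGrowth.hasDerivAt_heatFlow_line (hφ : GaussianGrowth C β φ) (ht : 0 < t)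
    (htβ : β < 1 / (4 * t)) (x e : EuclideanSpace ℝ (Fin n)) :
    HasDerivAt (fun s : ℝ => heatFlow φ t (x + s • e)) ⟪heatGrad φ t x, e⟫ 0 := by
  rw [hφ.inner_heatGrad ht htβ]
  simp only [heatFlow_eq_integral φ ht]
  simpa only [one_mul] using hφ.hasDerivAt_integral_line ht htβ x e (a := fun _ => 1)
    continuous_const (by fun_prop) zero_le_one (by positivity) (fun z => by simp)
    (fun z => abs_grad_coeff_le z e ht)
    fun z s => by simpa only [one_mul] using hasDerivAt_gaussKernel_line z e t s

lemma GaussianGrowth.hasDerivAt_heatGrad_line (hφ : GaussianGrowth C β φ) (ht : 0 < t)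
    (htβ : β < 1 / (4 * t)) (x e : EuclideanSpace ℝ (Fin n)) :
    HasDerivAt (fun s : ℝ => ⟪heatGrad φ t (x + s • e), e⟫) (heatHess φ t x e) 0 := by
  simp only [hφ.inner_heatGrad ht htβ]
  exact hφ.hasDerivAt_integral_line ht htβ x e (by fun_prop) (by fun_prop) (by positivity)
    (by positivity) (fun z => abs_grad_coeff_le z e ht) (fun z => abs_hess_coeff_le z e ht)
    fun z s => hasDerivAt_gaussKernel_line_snd z e t s

lemma GaussianGrowth.sum_heatHess (hφ : GaussianGrowth C β φ) (ht : 0 < t)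
    (htβ : β < 1 / (4 * t)) (x : EuclideanSpace ℝ (Fin n)) :
    ∑ i, heatHess φ t x (EuclideanSpace.basisFun (Fin n) ℝ i) =
      ∫ y, φ y * ((‖x - y‖ ^ 2 / (4 * t ^ 2) - n / (2 * t)) * gaussKernel (x - y) t) := by
  unfold heatHess
  rw [← integral_finsetSum _ fun i _ => hφ.integrable_mul_gaussKernel ht htβ x (by fun_prop)
    (by positivity) fun z => abs_hess_coeff_le z (EuclideanSpace.basisFun (Fin n) ℝ i) ht]
  simp only [← Finset.mul_sum, ← Finset.sum_mul, sum_hess_coeff]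

lemma GaussianGrowth.hasDerivAt_heatFlow_time (hφ : GaussianGrowth C β φ) (ht : 0 < t)
    (htβ : β < 1 / (4 * t)) (x : EuclideanSpace ℝ (Fin n)) :
    HasDerivAt (fun s : ℝ => heatFlow φ s x)
      (∑ i, heatHess φ t x (EuclideanSpace.basisFun (Fin n) ℝ i)) t := by
  obtain ⟨t₁, ht₁, htt₁⟩ : ∃ t₁, β < 1 / (4 * t₁) ∧ t < t₁ := by
    have hcont : ContinuousAt (fun s : ℝ => 1 / (4 * s)) t :=
      continuousAt_const.div (by fun_prop) (by positivity)
    have hev : ∀ᶠ s in 𝓝[>] t, β < 1 / (4 * s) :=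
      (hcont.eventually_const_lt htβ).filter_mono nhdsWithin_le_nhds
    exact (hev.and self_mem_nhdsWithin).exists
  rw [hφ.sum_heatHess ht htβ]
  refine (hφ.hasDerivAt_integral ht₁ (k := fun s y => gaussKernel (x - y) s)
    (k' := fun s y => (‖x - y‖ ^ 2 / (4 * s ^ 2) - n / (2 * s)) * gaussKernel (x - y) s)
    (Icc_mem_nhds (half_lt_self ht) htt₁) (fun s => by fun_prop) (by fun_prop)
    (by simpa only [mul_comm] using hφ.integrable_gaussKernel_mul ht htβ x)
    (fun s hs y => abs_mul_gaussKernel_le (half_pos ht) hs (by positivity) le_rfl y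
      (abs_time_coeff_le (half_pos ht) hs.1 (x - y)))
    fun s hs y => hasDerivAt_gaussKernel_time (x - y)
      ((half_pos ht).trans_le hs.1)).congr_of_eventuallyEq ?_
  filter_upwards [lt_mem_nhds ht] with s hs using heatFlow_eq_integral φ hs x

lemma integral_gaussKernel_one : ∫ z : EuclideanSpace ℝ (Fin n), gaussKernel z 1 = 1 := by
  have hexponent : ∀ z : EuclideanSpace ℝ (Fin n), -‖z‖ ^ 2 / (4 * 1) = -(1 / 4) * ‖z‖ ^ 2 :=
    fun z => by ring
  simp only [gaussKernel, hexponent]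
  rw [integral_const_mul, GaussianFourier.integral_rexp_neg_mul_sq_norm (by norm_num),
    finrank_euclideanSpace, Fintype.card_fin, mul_one,
    show Real.pi / (1 / 4) = 4 * Real.pi by ring, ← Real.rpow_add (by positivity)]
  rw [neg_div, neg_add_cancel, Real.rpow_zero]

lemma sqrt_pow_mul_gaussKernel_sqrt_smul (ht : 0 < t) (z : EuclideanSpace ℝ (Fin n)) :
    √t ^ n * gaussKernel (√t • z) t = gaussKernel z 1 := by
  have hexponent : -(t * ‖z‖ ^ 2) / (4 * t) = -‖z‖ ^ 2 / 4 := by field_simp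
  have hpow : √t ^ n * t ^ (-(n : ℝ) / 2) = 1 := by
    rw [Real.sqrt_eq_rpow, ← Real.rpow_natCast, ← Real.rpow_mul ht.le, ← Real.rpow_add ht,
      show 1 / 2 * (n : ℝ) + -(n : ℝ) / 2 = 0 by ring, Real.rpow_zero]
  unfold gaussKernel
  rw [norm_smul, mul_pow, Real.norm_of_nonneg (Real.sqrt_nonneg t), Real.sq_sqrt ht.le,
    Real.mul_rpow (by positivity) ht.le, mul_one, mul_one, hexponent]
  linear_combination ((4 * Real.pi) ^ (-(n : ℝ) / 2) * Real.exp (-‖z‖ ^ 2 / 4)) * hpow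

lemma heatFlow_eq_scaled (φ : EuclideanSpace ℝ (Fin n) → ℝ) (ht : 0 ≤ t)
    (x : EuclideanSpace ℝ (Fin n)) :
    heatFlow φ t x = ∫ z, gaussKernel z 1 * φ (x - √t • z) := by
  rcases ht.eq_or_lt with rfl | ht
  · simp [heatFlow, integral_mul_const, integral_gaussKernel_one]
  have : 0 < √t := Real.sqrt_pos.2 ht
  have hscale := Measure.integral_comp_smul (volume : Measure (EuclideanSpace ℝ (Fin n)))
    (fun y => gaussKernel y t * φ (x - y)) √t
  rw [finrank_euclideanSpace, Fintype.card_fin, abs_of_pos (by positivity), smul_eq_mul] at hscale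
  calc heatFlow φ t x = ∫ y, gaussKernel (x - y) t * φ y := by simp only [heatFlow, if_pos ht]
    _ = ∫ y, gaussKernel y t * φ (x - y) := by
        rw [← integral_sub_left_eq_self (fun y => gaussKernel (x - y) t * φ y) volume x]
        simp only [sub_sub_cancel]
    _ = √t ^ n * ∫ z, gaussKernel (√t • z) t * φ (x - √t • z) := by
        rw [hscale]
        field_simp
    _ = ∫ z, gaussKernel z 1 * φ (x - √t • z) := by
        rw [← integral_const_mul]
        simp only [← mul_assoc, sqrt_pow_mul_gaussKernel_sqrt_smul ht]

lemma norm_sub_sqrt_smul_le {T : ℝ} (htT : t ≤ T) (x z : EuclideanSpace ℝ (Fin n)) :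
    ‖x - √t • z‖ ≤ ‖x‖ + √T * ‖z‖ := by
  refine (norm_sub_le _ _).trans ?_
  rw [norm_smul, Real.norm_of_nonneg (Real.sqrt_nonneg t)]
  gcongr

lemma GaussianGrowth.abs_scaled_le (hφ : GaussianGrowth C β φ) (hβ : 0 ≤ β) {T R : ℝ}
    (hT : 0 ≤ T) (htT : t ≤ T) {x : EuclideanSpace ℝ (Fin n)} (hx : ‖x‖ ≤ R)
    (z : EuclideanSpace ℝ (Fin n)) :
    |gaussKernel z 1 * φ (x - √t • z)| ≤ (4 * Real.pi * 1) ^ (-(n : ℝ) / 2) * C *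
      Real.exp (β * R ^ 2) * Real.exp (-(1 / 4 - β * T) * ‖z‖ ^ 2 + 2 * β * R * √T * ‖z‖) := by
  have hC := hφ.const_nonneg
  have hnorm : ‖x - √t • z‖ ≤ R + √T * ‖z‖ :=
    (norm_sub_sqrt_smul_le htT x z).trans (by gcongr)
  rw [abs_mul, abs_of_pos (gaussKernel_pos z one_pos)]
  calc gaussKernel z 1 * |φ (x - √t • z)|
      ≤ gaussKernel z 1 * (C * Real.exp (β * (R + √T * ‖z‖) ^ 2)) :=
        mul_le_mul_of_nonneg_left ((hφ.abs_le _).trans (by gcongr)) (gaussKernel_pos z one_pos).le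
    _ = (4 * Real.pi * 1) ^ (-(n : ℝ) / 2) * C *
        (Real.exp (-‖z‖ ^ 2 / (4 * 1)) * Real.exp (β * (R + √T * ‖z‖) ^ 2)) := by
        unfold gaussKernel
        ring
    _ = (4 * Real.pi * 1) ^ (-(n : ℝ) / 2) * C * (Real.exp (β * R ^ 2) *
          Real.exp (-(1 / 4 - β * T) * ‖z‖ ^ 2 + 2 * β * R * √T * ‖z‖)) := by
        rw [← Real.exp_add, ← Real.exp_add]
        congr 2
        linear_combination β * ‖z‖ ^ 2 * Real.sq_sqrt hT
    _ = _ := by ring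

lemma GaussianGrowth.integrable_scaled (hφ : GaussianGrowth C β φ) (hβ : 0 ≤ β) (ht : 0 ≤ t)
    (htβ : β * t < 1 / 4) (x : EuclideanSpace ℝ (Fin n)) :
    Integrable fun z => gaussKernel z 1 * φ (x - √t • z) := by
  have := hφ.continuous
  exact integrable_of_norm_le_exp_quadratic (by fun_prop) (sub_pos.2 htβ)
    fun z => hφ.abs_scaled_le hβ ht le_rfl le_rfl z

lemma GaussianGrowth.continuousOn_heatFlow (hφ : GaussianGrowth C β φ) (hβ : 0 ≤ β) {T : ℝ}
    (hTβ : β * T < 1 / 4) :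
    ContinuousOn (fun p : ℝ × EuclideanSpace ℝ (Fin n) => heatFlow φ p.1 p.2)
      (Icc 0 T ×ˢ univ) := by
  have hφc := hφ.continuous
  suffices ContinuousOn (fun p : ℝ × EuclideanSpace ℝ (Fin n) =>
      ∫ z, gaussKernel z 1 * φ (p.2 - √p.1 • z)) (Icc 0 T ×ˢ univ) from
    this.congr fun p hp => heatFlow_eq_scaled φ hp.1.1 p.2
  rintro ⟨t, x⟩ ⟨ht, -⟩
  refine continuousWithinAt_of_dominated
    (Eventually.of_forall fun p => Continuous.aestronglyMeasurable (by fun_prop)) ?_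
    (integrable_exp_quadratic (sub_pos.2 hTβ) ((4 * Real.pi * 1) ^ (-(n : ℝ) / 2) * C *
      Real.exp (β * (‖x‖ + 1) ^ 2)) (2 * β * (‖x‖ + 1) * √T))
    (Eventually.of_forall fun z => Continuous.continuousWithinAt (by fun_prop))
  have hnear : ∀ᶠ p : ℝ × EuclideanSpace ℝ (Fin n) in 𝓝[Icc 0 T ×ˢ univ] (t, x),
      ‖p.2‖ < ‖x‖ + 1 :=
    ((show Continuous fun p : ℝ × EuclideanSpace ℝ (Fin n) => ‖p.2‖ by fun_prop).tendsto
      (t, x)).eventually_lt_const (lt_add_one _) |>.filter_mono nhdsWithin_le_nhds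
  filter_upwards [hnear, self_mem_nhdsWithin] with p hp hpT
  exact Eventually.of_forall fun z => hφ.abs_scaled_le hβ (ht.1.trans ht.2) hpT.1.2 hp.le z

lemma heatFlow_const (c : ℝ) (ht : 0 ≤ t) (x : EuclideanSpace ℝ (Fin n)) :
    heatFlow (fun _ => c) t x = c := by
  rw [heatFlow_eq_scaled _ ht, integral_mul_const, integral_gaussKernel_one, one_mul]

end HeatFlow

section Inverse

variable {F : ℝ → EReal} {r z z' : ℝ}

/-- The derivative of `f_F`, written as the reciprocal of `F'`; it takes the junk value `0` where
`F'` vanishes. -/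
def invDeriv (F : ℝ → EReal) (z : ℝ) : ℝ := (deriv (realOf F) (inv F z))⁻¹

lemma Admissible.coe_realOf (hF : Admissible F) (hr : 0 < r) : ((realOf F r : ℝ) : EReal) = F r :=
  EReal.coe_toReal (hF.ne_top r hr.le)
    (bot_le.trans_lt (hF.strictMonoOn self_mem_Ici hr.le hr)).ne'

lemma Admissible.strictMonoOn_realOf (hF : Admissible F) : StrictMonoOn (realOf F) (Ioi 0) := by
  intro r hr s hs hrs
  have h := hF.strictMonoOn (mem_Ici.2 (mem_Ioi.1 hr).le) (mem_Ici.2 (mem_Ioi.1 hs).le) hrs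
  rwa [← hF.coe_realOf hr, ← hF.coe_realOf hs, EReal.coe_lt_coe_iff] at h

lemma Admissible.continuousOn_realOf (hF : Admissible F) : ContinuousOn (realOf F) (Ioi 0) := by
  intro r hr
  have hne : F r ≠ ⊤ ∧ F r ≠ ⊥ := by
    rw [← hF.coe_realOf hr]
    exact ⟨EReal.coe_ne_top _, EReal.coe_ne_bot _⟩
  exact (EReal.tendsto_toReal hne.1 hne.2).comp (hF.continuousOn r hr)

lemma Admissible.realOf_mem_J (hF : Admissible F) (hr : 0 < r) : realOf F r ∈ J F :=
  ⟨r, hr, (hF.coe_realOf hr).symm⟩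

lemma exists_realOf_eq_of_mem_J (hz : z ∈ J F) : ∃ r ∈ Ioi (0 : ℝ), realOf F r = z := by
  obtain ⟨r, hr, h⟩ := hz
  exact ⟨r, hr, by rw [realOf, h, EReal.toReal_coe]⟩

lemma Admissible.J_eq_image (hF : Admissible F) : J F = realOf F '' Ioi 0 :=
  Subset.antisymm (fun _ => exists_realOf_eq_of_mem_J)
    (image_subset_iff.2 fun _ hr => hF.realOf_mem_J hr)

lemma inv_pos_of_mem_J (hz : z ∈ J F) : 0 < inv F z :=
  Function.invFunOn_mem (exists_realOf_eq_of_mem_J hz)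

lemma realOf_inv (hz : z ∈ J F) : realOf F (inv F z) = z :=
  Function.invFunOn_eq (exists_realOf_eq_of_mem_J hz)

lemma Admissible.inv_realOf (hF : Admissible F) (hr : 0 < r) : inv F (realOf F r) = r :=
  hF.strictMonoOn_realOf.injOn (inv_pos_of_mem_J (hF.realOf_mem_J hr)) hr
    (realOf_inv (hF.realOf_mem_J hr))

lemma Admissible.strictMonoOn_inv (hF : Admissible F) : StrictMonoOn (inv F) (J F) := by
  intro z hz z' hz' hlt
  rwa [← hF.strictMonoOn_realOf.lt_iff_lt (inv_pos_of_mem_J hz) (inv_pos_of_mem_J hz'),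
    realOf_inv hz, realOf_inv hz']

lemma Admissible.le_inv_iff (hF : Admissible F) (hr : 0 < r) (hz : z ∈ J F) :
    r ≤ inv F z ↔ realOf F r ≤ z := by
  rw [← hF.strictMonoOn_realOf.le_iff_le hr (inv_pos_of_mem_J hz), realOf_inv hz]

lemma Admissible.ordConnected_J (hF : Admissible F) : (J F).OrdConnected := by
  rw [hF.J_eq_image]
  exact (isPreconnected_Ioi.image _ hF.continuousOn_realOf).ordConnected

lemma Admissible.isOpen_J (hF : Admissible F) : IsOpen (J F) := by
  refine isOpen_iff_mem_nhds.2 fun z hz => ?_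
  obtain ⟨r, hr, rfl⟩ := exists_realOf_eq_of_mem_J hz
  rw [mem_Ioi] at hr
  have hlt : realOf F (r / 2) < realOf F r :=
    hF.strictMonoOn_realOf (half_pos hr) hr (half_lt_self hr)
  have hgt : realOf F r < realOf F (r * 2) :=
    hF.strictMonoOn_realOf hr (mem_Ioi.2 (by positivity)) (by linarith)
  exact mem_of_superset (Icc_mem_nhds hlt hgt)
    (hF.ordConnected_J.out (hF.realOf_mem_J (half_pos hr)) (hF.realOf_mem_J (by positivity)))

lemma Admissible.mem_J_of_le (hF : Admissible F) (hT : Tendsto F atTop (𝓝 ⊤)) (hz : z ∈ J F)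
    (h : z ≤ z') : z' ∈ J F := by
  obtain ⟨r, hr, hr0⟩ :=
    ((hT.eventually_const_lt (EReal.coe_lt_top z')).and (eventually_gt_atTop 0)).exists
  rw [← hF.coe_realOf hr0, EReal.coe_lt_coe_iff] at hr
  exact hF.ordConnected_J.out hz (hF.realOf_mem_J hr0) ⟨h, hr.le⟩

lemma Admissible.continuousAt_inv (hF : Admissible F) (hz : z ∈ J F) : ContinuousAt (inv F) z :=
  hF.strictMonoOn_inv.continuousAt_of_image_mem_nhds (hF.isOpen_J.mem_nhds hz) <|
    mem_of_superset (Ioi_mem_nhds (inv_pos_of_mem_J hz)) fun r hr =>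
      ⟨realOf F r, hF.realOf_mem_J hr, hF.inv_realOf hr⟩

lemma hasDerivAt_realOf (hC : ContDiffOn ℝ 2 (realOf F) (Ioi 0)) (hr : 0 < r) :
    HasDerivAt (realOf F) (deriv (realOf F) r) r :=
  ((hC.contDiffAt (Ioi_mem_nhds hr)).differentiableAt (by norm_num)).hasDerivAt

lemma hasDerivAt_deriv_realOf (hC : ContDiffOn ℝ 2 (realOf F) (Ioi 0)) (hr : 0 < r) :
    HasDerivAt (deriv (realOf F)) (deriv (deriv (realOf F)) r) r := by
  have h : ContDiffOn ℝ 1 (deriv (realOf F)) (Ioi 0) :=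
    ((contDiffOn_succ_iff_deriv_of_isOpen (n := 1) isOpen_Ioi).1 hC).2.2
  exact ((h.contDiffAt (Ioi_mem_nhds hr)).differentiableAt (by norm_num)).hasDerivAt

lemma Admissible.hasDerivAt_inv (hF : Admissible F) (hC : ContDiffOn ℝ 2 (realOf F) (Ioi 0))
    (hz : z ∈ J F) (hpos : 0 < deriv (realOf F) (inv F z)) :
    HasDerivAt (inv F) (invDeriv F z) z := by
  refine HasDerivAt.of_local_left_inverse (hF.continuousAt_inv hz)
    (hasDerivAt_realOf hC (inv_pos_of_mem_J hz)) hpos.ne' ?_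
  filter_upwards [hF.isOpen_J.mem_nhds hz] with y hy using realOf_inv hy

lemma Admissible.hasDerivAt_deriv_realOf_inv (hF : Admissible F)
    (hC : ContDiffOn ℝ 2 (realOf F) (Ioi 0)) (hz : z ∈ J F)
    (hpos : 0 < deriv (realOf F) (inv F z)) :
    HasDerivAt (fun y => deriv (realOf F) (inv F y))
      (deriv (deriv (realOf F)) (inv F z) * invDeriv F z) z :=
  HasDerivAt.comp z (hasDerivAt_deriv_realOf hC (inv_pos_of_mem_J hz))
    (hF.hasDerivAt_inv hC hz hpos)

lemma Admissible.deriv_inv_eventuallyEq (hF : Admissible F)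
    (hC : ContDiffOn ℝ 2 (realOf F) (Ioi 0)) (hz : z ∈ J F)
    (hpos : 0 < deriv (realOf F) (inv F z)) : deriv (inv F) =ᶠ[𝓝 z] invDeriv F := by
  have hc := (hF.hasDerivAt_deriv_realOf_inv hC hz hpos).continuousAt
  filter_upwards [hF.isOpen_J.mem_nhds hz, hc.eventually_const_lt hpos] with y hy hy'
  exact (hF.hasDerivAt_inv hC hy hy').deriv

lemma Admissible.hasDerivAt_log_invDeriv (hF : Admissible F)
    (hC : ContDiffOn ℝ 2 (realOf F) (Ioi 0)) (hz : z ∈ J F)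
    (hpos : 0 < deriv (realOf F) (inv F z)) :
    HasDerivAt (fun y => Real.log (invDeriv F y)) (g F z) z := by
  have hlog := ((hF.hasDerivAt_deriv_realOf_inv hC hz hpos).inv hpos.ne').log (inv_pos.2 hpos).ne'
  have hg : g F z = deriv (fun y => Real.log (invDeriv F y)) z :=
    ((hF.deriv_inv_eventuallyEq hC hz hpos).fun_comp Real.log).deriv_eq
  rw [hg]
  exact hlog.differentiableAt.hasDerivAt

lemma Admissible.hasDerivAt_invDeriv (hF : Admissible F) (hC : ContDiffOn ℝ 2 (realOf F) (Ioi 0))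
    (hz : z ∈ J F) (hpos : 0 < deriv (realOf F) (inv F z)) :
    HasDerivAt (invDeriv F) (invDeriv F z * g F z) z := by
  have hinv : HasDerivAt (invDeriv F) _ z :=
    (hF.hasDerivAt_deriv_realOf_inv hC hz hpos).inv hpos.ne'
  have hne : invDeriv F z ≠ 0 := (inv_pos.2 hpos).ne'
  refine hinv.congr_deriv ?_
  rw [(hF.hasDerivAt_log_invDeriv hC hz hpos).unique (hinv.log hne), mul_div_cancel₀ _ hne]

lemma Admissible.g_eq (hF : Admissible F) (hC : ContDiffOn ℝ 2 (realOf F) (Ioi 0))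
    (hz : z ∈ J F) (hpos : 0 < deriv (realOf F) (inv F z)) :
    g F z = -deriv (deriv (realOf F)) (inv F z) / deriv (realOf F) (inv F z) ^ 2 := by
  have hlog := ((hF.hasDerivAt_deriv_realOf_inv hC hz hpos).inv hpos.ne').log (inv_pos.2 hpos).ne'
  rw [(hF.hasDerivAt_log_invDeriv hC hz hpos).unique hlog, invDeriv]
  simp only [Pi.inv_apply]
  field_simp

end Inverse

section ConvexBounds

variable {E : Type*} [AddCommGroup E] [Module ℝ E] {u : E → ℝ}

lemma add_mul_sub_le_of_convexOn (hu : ConvexOn ℝ univ u) (x y : E) {s : ℝ} (hs : 1 ≤ s) :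
    u x + s * (u y - u x) ≤ u (x + s • (y - x)) := by
  have hs0 : 0 < s := one_pos.trans_le hs
  have hy : (1 - s⁻¹) • x + s⁻¹ • (x + s • (y - x)) = y := by
    rw [smul_add, inv_smul_smul₀ hs0.ne', sub_smul, one_smul]
    abel
  have hconv := hu.2 (mem_univ x) (mem_univ (x + s • (y - x)))
    (sub_nonneg.2 (inv_le_one_of_one_le₀ hs)) (inv_nonneg.2 hs0.le) (sub_add_cancel 1 s⁻¹)
  rw [hy, smul_eq_mul, smul_eq_mul] at hconv
  have h := mul_le_mul_of_nonneg_left hconv hs0.le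
  field_simp at h
  linarith

lemma le_of_convexOn_of_bounded (hu : ConvexOn ℝ univ u) {M : ℝ} (hM : ∀ x, u x ≤ M) (x y : E) :
    u x ≤ u y := by
  by_contra! hlt
  have hd : 0 < u x - u y := sub_pos.2 hlt
  have hs : 1 ≤ 1 + (M - u y) / (u x - u y) :=
    le_add_of_nonneg_right (div_nonneg (sub_nonneg.2 (hM y)) hd.le)
  have h := (add_mul_sub_le_of_convexOn hu y x hs).trans (hM _)
  rw [add_mul, div_mul_cancel₀ _ hd.ne'] at h
  linarith

end ConvexBounds

section FConvexity

variable {n : ℕ} {F : ℝ → EReal} {φ : EuclideanSpace ℝ (Fin n) → ℝ}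

lemma FConvex.le_mul_add_mul_max (hF : Admissible F) (hφ : FConvex F φ) {r : ℝ} (hr : 0 < r)
    (x y : EuclideanSpace ℝ (Fin n)) {a b : ℝ} (ha : 0 < a) (hb : 0 < b) (hab : a + b = 1) :
    F (φ (a • x + b • y)) ≤ (a : EReal) * F (max (φ x) r) + (b : EReal) * F (max (φ y) r) := by
  have hle : ∀ x, F (φ x) ≤ F (max (φ x) r) := fun x =>
    hF.strictMonoOn.monotoneOn (hφ.1 x) (hr.le.trans (le_max_right _ _)) (le_max_left _ _)
  have h := hφ.2 x y b hb (by linarith)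
  rw [show 1 - b = a by linarith] at h
  exact h.trans (add_le_add (mul_le_mul_of_nonneg_left (hle x) (EReal.coe_nonneg.2 ha.le))
    (mul_le_mul_of_nonneg_left (hle y) (EReal.coe_nonneg.2 hb.le)))

/- `F ∘ φ` itself takes the value `-∞` where `φ` vanishes; truncating `φ` from below at `r > 0`
keeps everything in real arithmetic. -/
lemma FConvex.convexOn_max (hF : Admissible F) (hφ : FConvex F φ) {r : ℝ} (hr : 0 < r) :
    ConvexOn ℝ univ fun x => realOf F (max (φ x) r) := by
  have hpos : ∀ x, 0 < max (φ x) r := fun x => lt_max_of_lt_right hr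
  refine convexOn_iff_forall_pos.2 ⟨convex_univ, fun x _ y _ a b ha hb hab => ?_⟩
  simp only [smul_eq_mul]
  rcases le_total (φ (a • x + b • y)) r with h | h
  · have hlr : ∀ x, realOf F r ≤ realOf F (max (φ x) r) := fun x =>
      hF.strictMonoOn_realOf.monotoneOn hr (hpos x) (le_max_right _ _)
    calc realOf F (max (φ (a • x + b • y)) r) = a * realOf F r + b * realOf F r := by
          rw [max_eq_right h, ← add_mul, hab, one_mul]
      _ ≤ a * realOf F (max (φ x) r) + b * realOf F (max (φ y) r) := by gcongr <;> apply hlr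
  · have key := hφ.le_mul_add_mul_max hF hr x y ha hb hab
    rw [max_eq_left h]
    rw [← hF.coe_realOf (hr.trans_le h), ← hF.coe_realOf (hpos x), ← hF.coe_realOf (hpos y)] at key
    exact_mod_cast key

lemma fconvex_of_convexOn (hF : Admissible F) (hpos : ∀ x, 0 < φ x)
    (h : ConvexOn ℝ univ fun x => realOf F (φ x)) : FConvex F φ := by
  refine ⟨fun x => (hpos x).le, fun x y l hl hl1 => ?_⟩
  have := h.2 (mem_univ x) (mem_univ y) (by linarith : 0 ≤ 1 - l) hl.le (by ring)
  rw [← hF.coe_realOf (hpos _), ← hF.coe_realOf (hpos x), ← hF.coe_realOf (hpos y)]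
  simp only [smul_eq_mul] at this
  exact_mod_cast this

lemma FConvex.le_max (hF : Admissible F) (hφ : FConvex F φ) (y h : EuclideanSpace ℝ (Fin n)) :
    φ y ≤ max (φ (y + h)) (φ (y - h)) := by
  by_contra! hlt
  obtain ⟨r, hr, hry⟩ := exists_between hlt
  have hplus : φ (y + h) ≤ r := (le_max_left _ _).trans hr.le
  have hminus : φ (y - h) ≤ r := (le_max_right _ _).trans hr.le
  have hr0 : 0 < r := ((hφ.1 (y + h)).trans (le_max_left _ _)).trans_lt hr
  have hmid : (1 / 2 : ℝ) • (y + h) + (1 / 2 : ℝ) • (y - h) = y := by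
    rw [← smul_add, add_add_sub_cancel, ← two_smul ℝ y, smul_smul]
    norm_num
  have hconv := (hφ.convexOn_max hF hr0).2 (mem_univ (y + h)) (mem_univ (y - h))
    (by norm_num : (0 : ℝ) ≤ 1 / 2) (by norm_num : (0 : ℝ) ≤ 1 / 2) (by norm_num)
  rw [hmid] at hconv
  simp only [max_eq_left hry.le, max_eq_right hplus, max_eq_right hminus, smul_eq_mul] at hconv
  linarith [hF.strictMonoOn_realOf hr0 (hr0.trans hry) hry]

lemma FConvex.continuous_max (hF : Admissible F) (hφ : FConvex F φ) {r : ℝ} (hr : 0 < r) :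
    Continuous fun x => max (φ x) r := by
  have hpos : ∀ x, 0 < max (φ x) r := fun x => lt_max_of_lt_right hr
  have hc : Continuous fun x => realOf F (max (φ x) r) :=
    continuousOn_univ.1 ((hφ.convexOn_max hF hr).continuousOn isOpen_univ)
  have hinv : Continuous fun x => inv F (realOf F (max (φ x) r)) :=
    continuous_iff_continuousAt.2 fun x =>
      ContinuousAt.comp (f := fun x => realOf F (max (φ x) r))
        (hF.continuousAt_inv (hF.realOf_mem_J (hpos x))) hc.continuousAt
  simpa only [hF.inv_realOf (hpos _)] using hinv

lemma FConvex.continuous (hF : Admissible F) (hφ : FConvex F φ) : Continuous φ := by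
  have hunif : TendstoUniformly (fun (r : ℝ) x => max (φ x) r) φ (𝓝[>] 0) := by
    rw [Metric.tendstoUniformly_iff]
    intro ε hε
    filter_upwards [Ioo_mem_nhdsGT hε] with r hr x
    rw [dist_comm, Real.dist_eq, abs_of_nonneg (sub_nonneg.2 (le_max_left _ _)), sub_lt_iff_lt_add]
    exact max_lt (by linarith) (by linarith [hr.2, hφ.1 x])
  refine hunif.continuous (Eventually.frequently ?_)
  filter_upwards [self_mem_nhdsWithin] with r hr using hφ.continuous_max hF hr

end FConvexity

section Growth

variable {n : ℕ} {F : ℝ → EReal} {φ : EuclideanSpace ℝ (Fin n) → ℝ} {t T : ℝ}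

lemma integrable_of_lt_maxTime (ht : 0 < t) (h : ENNReal.ofReal t < maxTime φ)
    (x : EuclideanSpace ℝ (Fin n)) : Integrable fun y => gaussKernel (x - y) t * φ y := by
  obtain ⟨T, hT, hlt⟩ := lt_sSup_iff.1 h
  exact hT t ht hlt x

lemma exists_gt_of_lt_maxTime (h : ENNReal.ofReal t < maxTime φ) :
    ∃ T, t < T ∧ ENNReal.ofReal T < maxTime φ := by
  obtain ⟨T, -, htT, hT⟩ := ENNReal.lt_iff_exists_real_btwn.1 h
  exact ⟨T, lt_of_not_ge fun hle => htT.not_ge (ENNReal.ofReal_le_ofReal hle), hT⟩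

lemma mul_volume_ball_le_two_mul_integral {ψ : EuclideanSpace ℝ (Fin n) → ℝ} (hψ : Integrable ψ)
    (hψ0 : ∀ y, 0 ≤ ψ y) {y : EuclideanSpace ℝ (Fin n)} {b : ℝ}
    (hb : ∀ h : EuclideanSpace ℝ (Fin n), ‖h‖ < 1 → b ≤ ψ (y + h) + ψ (y - h)) :
    volume.real (Metric.ball (0 : EuclideanSpace ℝ (Fin n)) 1) * b ≤ 2 * ∫ z, ψ z := by
  have hp : Integrable fun h => ψ (y + h) := hψ.comp_add_left y
  have hm : Integrable fun h => ψ (y - h) := hψ.comp_sub_left y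
  calc volume.real (Metric.ball (0 : EuclideanSpace ℝ (Fin n)) 1) * b
      = ∫ _h in Metric.ball (0 : EuclideanSpace ℝ (Fin n)) 1, b := by
        rw [setIntegral_const, smul_eq_mul]
    _ ≤ ∫ h in Metric.ball (0 : EuclideanSpace ℝ (Fin n)) 1, (ψ (y + h) + ψ (y - h)) :=
        setIntegral_mono_on (integrableOn_const measure_ball_lt_top.ne) (hp.add hm).integrableOn
          measurableSet_ball fun h hh => hb h (mem_ball_zero_iff.1 hh)
    _ ≤ ∫ h, (ψ (y + h) + ψ (y - h)) :=
        setIntegral_le_integral (hp.add hm)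
          (Eventually.of_forall fun h => add_nonneg (hψ0 _) (hψ0 _))
    _ = 2 * ∫ z, ψ z := by
        rw [integral_add hp hm, integral_add_left_eq_self (fun h => ψ h),
          integral_sub_left_eq_self (fun h => ψ h), two_mul]

lemma exp_le_gaussKernel (hT : 0 < T) {y : EuclideanSpace ℝ (Fin n)} {R : ℝ} (hy : ‖y‖ ≤ R) :
    (4 * Real.pi * T) ^ (-(n : ℝ) / 2) * Real.exp (-(R ^ 2 / (4 * T))) ≤ gaussKernel (0 - y) T := by
  rw [gaussKernel, zero_sub, norm_neg, neg_div (4 * T)]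
  gcongr

lemma FConvex.growth (hF : Admissible F) (hφ : FConvex F φ) (hT : 0 < T)
    (hint : Integrable fun y => gaussKernel (0 - y) T * φ y) :
    ∃ C, 0 < C ∧ ∀ y, φ y ≤ C * Real.exp ((‖y‖ + 1) ^ 2 / (4 * T)) := by
  set V := volume.real (Metric.ball (0 : EuclideanSpace ℝ (Fin n)) 1)
  have hV : 0 < V := ENNReal.toReal_pos (Metric.measure_ball_pos _ _ one_pos).ne'
    measure_ball_lt_top.ne
  set A : ℝ := (4 * Real.pi * T) ^ (-(n : ℝ) / 2)
  have hA : 0 < A := by positivity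
  set I := ∫ y, gaussKernel (0 - y) T * φ y
  have hnonneg : ∀ y, 0 ≤ gaussKernel (0 - y) T * φ y := fun y =>
    mul_nonneg (gaussKernel_pos _ hT).le (hφ.1 y)
  have hI : 0 ≤ I := integral_nonneg hnonneg
  refine ⟨(2 * I + 1) / (V * A), by positivity, fun y => ?_⟩
  have hbound : V * (A * Real.exp (-((‖y‖ + 1) ^ 2 / (4 * T))) * φ y) ≤ 2 * I := by
    refine mul_volume_ball_le_two_mul_integral (y := y) hint hnonneg fun h hh => ?_
    have hplus : ‖y + h‖ ≤ ‖y‖ + 1 := (norm_add_le y h).trans (by gcongr)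
    have hminus : ‖y - h‖ ≤ ‖y‖ + 1 := (norm_sub_le y h).trans (by gcongr)
    calc A * Real.exp (-((‖y‖ + 1) ^ 2 / (4 * T))) * φ y
        ≤ A * Real.exp (-((‖y‖ + 1) ^ 2 / (4 * T))) * (φ (y + h) + φ (y - h)) := by
          gcongr
          exact (hφ.le_max hF y h).trans (max_le_add_of_nonneg (hφ.1 _) (hφ.1 _))
      _ ≤ _ := by
          rw [mul_add]
          gcongr
          exacts [hφ.1 _, exp_le_gaussKernel hT hplus, hφ.1 _, exp_le_gaussKernel hT hminus]
  rw [Real.exp_neg] at hbound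
  field_simp at hbound ⊢
  linarith [Real.exp_pos ((‖y‖ + 1) ^ 2 / (4 * T))]

lemma FConvex.gaussianGrowth (hF : Admissible F) (hφ : FConvex F φ) (hT : 0 < T)
    (hint : Integrable fun y => gaussKernel (0 - y) T * φ y) {β : ℝ} (hβ : 1 / (4 * T) < β) :
    ∃ C, GaussianGrowth C β φ := by
  obtain ⟨C, hC, h⟩ := hφ.growth hF hT hint
  set δ := β - 1 / (4 * T) with hδ
  have hδ0 : 0 < δ := sub_pos.2 hβ
  refine ⟨C * Real.exp ((1 / (2 * T)) ^ 2 / (4 * δ) + 1 / (4 * T)), hφ.continuous hF, fun y => ?_⟩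
  rw [abs_of_nonneg (hφ.1 y), mul_assoc, ← Real.exp_add]
  refine (h y).trans ?_
  gcongr
  have hsq : δ * (‖y‖ - 1 / (2 * T) / (2 * δ)) ^ 2 =
      δ * ‖y‖ ^ 2 - 1 / (2 * T) * ‖y‖ + (1 / (2 * T)) ^ 2 / (4 * δ) := by
    field_simp
    ring
  have hexpand : (‖y‖ + 1) ^ 2 / (4 * T) =
      1 / (4 * T) * ‖y‖ ^ 2 + 1 / (2 * T) * ‖y‖ + 1 / (4 * T) := by
    field_simp
    ring
  have hβ' : β = δ + 1 / (4 * T) := by rw [hδ]; ring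
  rw [hexpand, hβ', add_mul]
  linarith [mul_nonneg hδ0.le (sq_nonneg (‖y‖ - 1 / (2 * T) / (2 * δ)))]

/- A convex function `F ∘ φ` with a positive slope `k` grows at least linearly along a ray, while
`φ` has Gaussian growth. -/
lemma FConvex.inv_growth (hF : Admissible F) (hφ : FConvex F φ) (hT : 0 < T)
    (hint : Integrable fun y => gaussKernel (0 - y) T * φ y) {r : ℝ} (hr : 0 < r)
    {x y : EuclideanSpace ℝ (Fin n)} {k : ℝ} (hk : 0 < k) (hxy : x ≠ y)
    (hslope : realOf F (max (φ x) r) + k * ‖y - x‖ ≤ realOf F (max (φ y) r)) :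
    ∃ C c : ℝ, 0 < C ∧ ∀ z ∈ J F, realOf F (max (φ y) r) ≤ z →
      inv F z ≤ C * Real.exp ((z / k + c) ^ 2 / (4 * T)) := by
  obtain ⟨C, hC, hgrowth⟩ := hφ.growth hF hT hint
  set u := fun x => realOf F (max (φ x) r)
  change u x + k * ‖y - x‖ ≤ u y at hslope
  have hd : 0 < ‖y - x‖ := norm_pos_iff.2 (sub_ne_zero.2 hxy.symm)
  refine ⟨C + r, ‖x‖ + 1 - u x / k, by positivity, fun z hz hyz => ?_⟩
  change u y ≤ z at hyz
  set s := (z - u x) / (k * ‖y - x‖) with hs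
  have hs1 : 1 ≤ s := (one_le_div (by positivity)).2 (by linarith)
  have hsk : s * (k * ‖y - x‖) = z - u x := div_mul_cancel₀ _ (by positivity)
  set p := x + s • (y - x)
  have hp : 0 < max (φ p) r := lt_max_of_lt_right hr
  have hzp : z ≤ u p := calc
    z = u x + s * (k * ‖y - x‖) := by rw [hsk]; ring
    _ ≤ u x + s * (u y - u x) := by gcongr; linarith
    _ ≤ u p := add_mul_sub_le_of_convexOn (hφ.convexOn_max hF hr) x y hs1
  have hnorm : ‖p‖ + 1 ≤ z / k + (‖x‖ + 1 - u x / k) := calc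
    ‖p‖ + 1 ≤ ‖x‖ + s * ‖y - x‖ + 1 := by
      gcongr
      exact (norm_add_le _ _).trans_eq (by rw [norm_smul, Real.norm_of_nonneg (by positivity)])
    _ = z / k + (‖x‖ + 1 - u x / k) := by rw [hs]; field_simp; ring
  have hφp : φ p ≤ C * Real.exp ((z / k + (‖x‖ + 1 - u x / k)) ^ 2 / (4 * T)) :=
    (hgrowth p).trans (by gcongr)
  calc inv F z ≤ inv F (u p) := hF.strictMonoOn_inv.monotoneOn hz (hF.realOf_mem_J hp) hzp
    _ = max (φ p) r := hF.inv_realOf hp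
    _ ≤ φ p + r := max_le_add_of_nonneg (hφ.1 p) hr.le
    _ ≤ C * Real.exp ((z / k + (‖x‖ + 1 - u x / k)) ^ 2 / (4 * T)) +
        r * Real.exp ((z / k + (‖x‖ + 1 - u x / k)) ^ 2 / (4 * T)) := by
      gcongr
      exact le_mul_of_one_le_right hr.le (Real.one_le_exp (by positivity))
    _ = _ := (add_mul _ _ _).symm

end Growth

section TrivialPreservation

variable {n : ℕ} {F : ℝ → EReal} {φ : EuclideanSpace ℝ (Fin n) → ℝ}

lemma exists_eq_const_of_forall_le {α β : Type*} [Nonempty α] [PartialOrder β] {f : α → β}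
    (h : ∀ x y, f x ≤ f y) : ∃ c, ∀ x, f x = c :=
  ⟨f (Classical.arbitrary α), fun _ => le_antisymm (h _ _) (h _ _)⟩

theorem onlyTriviallyPreserved_of_bounded (hF : Admissible F)
    (hL : ∃ L : EReal, L < ⊤ ∧ Tendsto F atTop (𝓝 L)) : OnlyTriviallyPreserved n F := by
  intro φ hφ _ _
  obtain ⟨L, hL, hlim⟩ := hL
  have hbd : ∀ r : ℝ, 0 < r → realOf F r ≤ L.toReal := by
    intro r hr
    have hle : F r ≤ L := ge_of_tendsto hlim <| by
      filter_upwards [eventually_ge_atTop r] with s hs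
      exact hF.strictMonoOn.monotoneOn hr.le (hr.le.trans hs) hs
    refine EReal.toReal_le_toReal hle ?_ hL.ne
    rw [← hF.coe_realOf hr]
    exact EReal.coe_ne_bot _
  refine exists_eq_const_of_forall_le fun x y => ?_
  by_contra! hlt
  obtain ⟨r, hyr, hrx⟩ := exists_between hlt
  have hr : 0 < r := (hφ.1 y).trans_lt hyr
  have hle := le_of_convexOn_of_bounded (hφ.convexOn_max hF hr)
    (fun x => hbd _ (lt_max_of_lt_right hr)) x y
  rw [max_eq_left hrx.le, max_eq_right hyr.le] at hle
  exact hle.not_gt (hF.strictMonoOn_realOf hr (hr.trans hrx) hrx)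

lemma Admissible.weightIntegral_lt_top (hF : Admissible F) (hT : Tendsto F atTop (𝓝 ⊤)) {U B D : ℝ}
    (hU : U ∈ J F) (hB : 0 ≤ B)
    (hinv : ∀ z ∈ J F, U ≤ z → inv F z ≤ D * Real.exp (B * z ^ 2)) :
    weightIntegral F (B + 1) < ⊤ := by
  have hD : 0 ≤ D := le_of_mul_le_mul_right
    ((zero_mul _).trans_le ((inv_pos_of_mem_J hU).le.trans (hinv U hU le_rfl))) (Real.exp_pos _)
  have hinvU := inv_pos_of_mem_J hU
  have hbound : ∀ z ∈ Ioi (realOf F 1),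
      Real.exp (-(B + 1) * z ^ 2) * inv F z ≤ (D + inv F U) * Real.exp (-1 * z ^ 2) := by
    intro z hz
    have hzJ : z ∈ J F := hF.mem_J_of_le hT (hF.realOf_mem_J one_pos) (mem_Ioi.1 hz).le
    have hle : inv F z ≤ (D + inv F U) * Real.exp (B * z ^ 2) := by
      rcases le_total U z with h | h
      · exact (hinv z hzJ h).trans (by gcongr; linarith)
      · calc inv F z ≤ inv F U := hF.strictMonoOn_inv.monotoneOn hzJ hU h
          _ ≤ D + inv F U := by linarith
          _ ≤ _ := le_mul_of_one_le_right (by positivity) (Real.one_le_exp (by positivity))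
    calc Real.exp (-(B + 1) * z ^ 2) * inv F z
        ≤ Real.exp (-(B + 1) * z ^ 2) * ((D + inv F U) * Real.exp (B * z ^ 2)) := by gcongr
      _ = (D + inv F U) * Real.exp (-1 * z ^ 2) := by
        rw [mul_left_comm, ← Real.exp_add]
        ring_nf
  calc weightIntegral F (B + 1)
      ≤ ∫⁻ z in Ioi (realOf F 1), ENNReal.ofReal ((D + inv F U) * Real.exp (-1 * z ^ 2)) :=
        setLIntegral_mono' measurableSet_Ioi fun z hz => ENNReal.ofReal_le_ofReal (hbound z hz)
    _ ≤ ∫⁻ z, ENNReal.ofReal ((D + inv F U) * Real.exp (-1 * z ^ 2)) :=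
        setLIntegral_le_lintegral _ _
    _ < ⊤ := ((integrable_exp_neg_mul_sq one_pos).const_mul (D + inv F U)).lintegral_lt_top

lemma FConvex.exists_weightIntegral_lt_top (hF : Admissible F) (hT : Tendsto F atTop (𝓝 ⊤))
    (hφ : FConvex F φ) (hmax : 0 < maxTime φ) {x y : EuclideanSpace ℝ (Fin n)}
    (hxy : φ x < φ y) : ∃ A, 0 < A ∧ weightIntegral F A < ⊤ := by
  obtain ⟨r, hxr, hry⟩ := exists_between hxy
  have hr : 0 < r := (hφ.1 x).trans_lt hxr
  obtain ⟨T, hT0, hTm⟩ := exists_gt_of_lt_maxTime (t := 0) (φ := φ) (by simpa using hmax)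
  have hne : x ≠ y := by rintro rfl; exact lt_irrefl _ hxy
  have hd : 0 < ‖y - x‖ := norm_pos_iff.2 (sub_ne_zero.2 hne.symm)
  have hlt : realOf F (max (φ x) r) < realOf F (max (φ y) r) := by
    rw [max_eq_left hry.le, max_eq_right hxr.le]
    exact hF.strictMonoOn_realOf hr (hr.trans hry) hry
  set k := (realOf F (max (φ y) r) - realOf F (max (φ x) r)) / ‖y - x‖ with hk
  have hk0 : 0 < k := div_pos (sub_pos.2 hlt) hd
  obtain ⟨C, c, hC, hinv⟩ := hφ.inv_growth hF hT0 (integrable_of_lt_maxTime hT0 hTm 0) hr hk0 hne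
    (by rw [hk, div_mul_cancel₀ _ hd.ne', add_sub_cancel])
  have hyJ : realOf F (max (φ y) r) ∈ J F := hF.realOf_mem_J (lt_max_of_lt_right hr)
  set B := 2 * (1 / k) ^ 2 / (4 * T) with hB
  refine ⟨B + 1, by positivity,
    hF.weightIntegral_lt_top hT (D := C * Real.exp (2 * c ^ 2 / (4 * T))) hyJ (by positivity)
      fun z hz hyz => ?_⟩
  refine (hinv z hz hyz).trans ?_
  rw [mul_assoc, ← Real.exp_add]
  gcongr
  have hsplit : 2 * c ^ 2 / (4 * T) + B * z ^ 2 - (z / k + c) ^ 2 / (4 * T) =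
      (z / k - c) ^ 2 / (4 * T) := by
    rw [hB]
    ring
  linarith [show 0 ≤ (z / k - c) ^ 2 / (4 * T) by positivity]

theorem onlyTriviallyPreserved_of_weightIntegral_eq_top (hF : Admissible F)
    (hT : Tendsto F atTop (𝓝 ⊤)) (hW : ∀ A : ℝ, 0 < A → weightIntegral F A = ⊤) :
    OnlyTriviallyPreserved n F := by
  intro φ hφ hmax _
  refine exists_eq_const_of_forall_le fun x y => ?_
  by_contra! hlt
  obtain ⟨A, hA, hfin⟩ := hφ.exists_weightIntegral_lt_top hF hT hmax hlt
  exact hfin.ne (hW A hA)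

end TrivialPreservation

section InfConvolution

variable {E : Type*} [NormedAddCommGroup E]

/-- The infimal convolution of `u` with `k ‖·‖`, for `u` bounded below the largest `k`-Lipschitz
function below `u`. -/
def infConv (u : E → ℝ) (k : ℝ) (x : E) : ℝ := ⨅ y, (u y + k * ‖x - y‖)

variable {u : E → ℝ} {k m : ℝ}

lemma infConv_le (hm : ∀ x, m ≤ u x) (hk : 0 ≤ k) (x y : E) : infConv u k x ≤ u y + k * ‖x - y‖ :=
  ciInf_le ⟨m, by rintro _ ⟨y, rfl⟩; exact le_add_of_le_of_nonneg (hm y) (by positivity)⟩ y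

lemma infConv_le_self (hm : ∀ x, m ≤ u x) (hk : 0 ≤ k) (x : E) : infConv u k x ≤ u x := by
  simpa using infConv_le hm hk x x

lemma le_infConv (hm : ∀ x, m ≤ u x) (hk : 0 ≤ k) (x : E) : m ≤ infConv u k x :=
  le_ciInf fun y => le_add_of_le_of_nonneg (hm y) (by positivity)

lemma infConv_sub_le (hm : ∀ x, m ≤ u x) (hk : 0 ≤ k) (x y : E) :
    infConv u k x - infConv u k y ≤ k * ‖x - y‖ := by
  refine sub_le_comm.1 (le_ciInf fun z => ?_)
  have htri : k * ‖x - z‖ ≤ k * (‖x - y‖ + ‖y - z‖) := by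
    gcongr
    exact norm_sub_le_norm_sub_add_norm_sub x y z
  linarith [infConv_le hm hk x z]

lemma convexOn_infConv [NormedSpace ℝ E] (hm : ∀ x, m ≤ u x) (hk : 0 ≤ k)
    (hu : ConvexOn ℝ univ u) : ConvexOn ℝ univ (infConv u k) := by
  refine ⟨convex_univ, fun x _ y _ α β hα hβ hαβ => le_of_forall_pos_le_add fun ε hε => ?_⟩
  obtain ⟨p, hp⟩ := exists_lt_of_ciInf_lt (lt_add_of_pos_right (infConv u k x) hε)
  obtain ⟨q, hq⟩ := exists_lt_of_ciInf_lt (lt_add_of_pos_right (infConv u k y) hε)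
  have hnorm : ‖α • x + β • y - (α • p + β • q)‖ ≤ α * ‖x - p‖ + β * ‖y - q‖ := by
    rw [add_sub_add_comm, ← smul_sub, ← smul_sub]
    refine (norm_add_le _ _).trans_eq ?_
    rw [norm_smul, norm_smul, Real.norm_of_nonneg hα, Real.norm_of_nonneg hβ]
  simp only [smul_eq_mul]
  calc infConv u k (α • x + β • y)
      ≤ u (α • p + β • q) + k * ‖α • x + β • y - (α • p + β • q)‖ := infConv_le hm hk _ _
    _ ≤ (α * u p + β * u q) + k * (α * ‖x - p‖ + β * ‖y - q‖) := by
      gcongr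
      exact hu.2 (mem_univ p) (mem_univ q) hα hβ hαβ
    _ = α * (u p + k * ‖x - p‖) + β * (u q + k * ‖y - q‖) := by ring
    _ ≤ α * (infConv u k x + ε) + β * (infConv u k y + ε) := by gcongr
    _ = α * infConv u k x + β * infConv u k y + ε := by linear_combination ε * hαβ

lemma tendsto_infConv (hm : ∀ x, m ≤ u x) (hu : Continuous u) (x : E) :
    Tendsto (fun k : ℕ => infConv u k x) atTop (𝓝 (u x)) := by
  refine tendsto_order.2 ⟨fun c hc => ?_, fun c hc => Eventually.of_forall fun k =>
    (infConv_le_self hm (Nat.cast_nonneg k) x).trans_lt hc⟩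
  obtain ⟨c', hcc', hc'⟩ := exists_between hc
  obtain ⟨δ, hδ, hball⟩ := Metric.eventually_nhds_iff.1 (hu.continuousAt.eventually_const_lt hc')
  obtain ⟨K, hK⟩ := exists_nat_ge ((c' - m) / δ)
  filter_upwards [eventually_ge_atTop K] with k hk
  refine hcc'.trans_le (le_ciInf fun y => ?_)
  rcases lt_or_ge (dist y x) δ with h | h
  · exact le_add_of_le_of_nonneg (hball h).le (by positivity)
  · have hkδ : c' - m ≤ k * δ := (div_le_iff₀ hδ).1 (hK.trans (by exact_mod_cast hk))
    have hfar : k * δ ≤ k * ‖x - y‖ := by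
      rw [norm_sub_rev, ← dist_eq_norm]
      gcongr
    linarith [hm y]

end InfConvolution

section RealLemmas

variable {q q' : ℝ → ℝ} {N s a c : ℝ}

lemma le_of_hasDerivAt_le_linear (hs : 0 ≤ s) (hq : ∀ z ∈ Icc N (N + s), HasDerivAt q (q' z) z)
    (hle : ∀ z ∈ Icc N (N + s), q' z ≤ c + a * (z - N)) :
    q (N + s) ≤ q N + (c * s + a * s ^ 2 / 2) := by
  have hderiv : ∀ z ∈ Icc N (N + s), HasDerivAt
      (fun z => q z - (c * (z - N) + a * (z - N) ^ 2 / 2)) (q' z - (c + a * (z - N))) z := by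
    intro z hz
    have hsub : HasDerivAt (fun z => z - N) 1 z := (hasDerivAt_id z).sub_const N
    refine ((hq z hz).sub ((hsub.const_mul c).add
      (((hsub.pow 2).const_mul a).div_const 2))).congr_deriv ?_
    push_cast
    ring
  have hanti := antitoneOn_of_hasDerivWithinAt_nonpos (convex_Icc N (N + s))
    (fun z hz => (hderiv z hz).continuousAt.continuousWithinAt)
    (fun z hz => (hderiv z (interior_subset hz)).hasDerivWithinAt)
    (fun z hz => sub_nonpos.2 (hle z (interior_subset hz)))
  have h := hanti (left_mem_Icc.2 (by linarith)) (right_mem_Icc.2 (by linarith)) (by linarith)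
  simp only [add_sub_cancel_left, sub_self] at h
  linarith

lemma le_of_linear_le_hasDerivAt (hs : 0 ≤ s) (hq : ∀ z ∈ Icc N (N + s), HasDerivAt q (q' z) z)
    (hle : ∀ z ∈ Icc N (N + s), c + a * (z - N) ≤ q' z) :
    q N + (c * s + a * s ^ 2 / 2) ≤ q (N + s) := by
  have h := le_of_hasDerivAt_le_linear (q := fun z => -q z) (c := -c) (a := -a) hs
    (fun z hz => (hq z hz).fun_neg) fun z hz => by linarith [hle z hz]
  linarith

lemma leadingCoeff_nonpos_of_quadratic_nonpos {A B C z₀ : ℝ}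
    (h : ∀ z, z₀ ≤ z → A * z ^ 2 + B * z + C ≤ 0) : A ≤ 0 := by
  by_contra! hA
  have hlim : Tendsto (fun z : ℝ => z * (A * z + B) + C) atTop atTop :=
    tendsto_atTop_add_const_right _ C <| tendsto_id.atTop_mul_atTop₀ <|
      tendsto_atTop_add_const_right _ B (tendsto_id.const_mul_atTop hA)
  obtain ⟨z, hpos, hz⟩ := ((hlim.eventually_gt_atTop 0).and (eventually_ge_atTop z₀)).exists
  linarith [h z hz]

end RealLemmas

section Profile

/-- The conditions on `F` under which `F`-convexity is preserved. -/
structure ConvexProfile (F : ℝ → EReal) : Prop where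
  admissible : Admissible F
  contDiffOn : ContDiffOn ℝ 2 (realOf F) (Ioi 0)
  tendsto_top : Tendsto F atTop (𝓝 ⊤)
  deriv_pos : ∀ r : ℝ, 0 < r → 0 < deriv (realOf F) r
  convexOn : ConvexOn ℝ (J F) (g F)

variable {F : ℝ → EReal} {N s a c M m x y z : ℝ}

lemma ConvexProfile.invDeriv_pos (h : ConvexProfile F) (hz : z ∈ J F) : 0 < invDeriv F z :=
  inv_pos.2 (h.deriv_pos _ (inv_pos_of_mem_J hz))

lemma ConvexProfile.hasDerivAt_inv (h : ConvexProfile F) (hz : z ∈ J F) :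
    HasDerivAt (inv F) (invDeriv F z) z :=
  h.admissible.hasDerivAt_inv h.contDiffOn hz (h.deriv_pos _ (inv_pos_of_mem_J hz))

lemma ConvexProfile.hasDerivAt_log (h : ConvexProfile F) (hz : z ∈ J F) :
    HasDerivAt (fun y => Real.log (invDeriv F y)) (g F z) z :=
  h.admissible.hasDerivAt_log_invDeriv h.contDiffOn hz (h.deriv_pos _ (inv_pos_of_mem_J hz))

lemma ConvexProfile.mem_J (h : ConvexProfile F) (hx : x ∈ J F) (hxy : x ≤ y) : y ∈ J F :=
  h.admissible.mem_J_of_le h.tendsto_top hx hxy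

lemma ConvexProfile.invDeriv_add_le (h : ConvexProfile F) (hN : N ∈ J F) (hs : 0 ≤ s)
    (hg : ∀ z ∈ Icc N (N + s), g F z ≤ c + a * (z - N)) :
    invDeriv F (N + s) ≤ invDeriv F N * Real.exp (c * s + a * s ^ 2 / 2) := by
  have hlog := le_of_hasDerivAt_le_linear hs (fun z hz => h.hasDerivAt_log (h.mem_J hN hz.1)) hg
  rw [← Real.exp_log (h.invDeriv_pos (h.mem_J hN (le_add_of_nonneg_right hs)))]
  conv_rhs => rw [← Real.exp_log (h.invDeriv_pos hN), ← Real.exp_add]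
  exact Real.exp_le_exp.2 hlog

lemma ConvexProfile.le_invDeriv_add (h : ConvexProfile F) (hN : N ∈ J F) (hs : 0 ≤ s)
    (hg : ∀ z ∈ Icc N (N + s), c + a * (z - N) ≤ g F z) :
    invDeriv F N * Real.exp (c * s + a * s ^ 2 / 2) ≤ invDeriv F (N + s) := by
  have hlog := le_of_linear_le_hasDerivAt hs (fun z hz => h.hasDerivAt_log (h.mem_J hN hz.1)) hg
  rw [← Real.exp_log (h.invDeriv_pos (h.mem_J hN (le_add_of_nonneg_right hs)))]
  conv_lhs => rw [← Real.exp_log (h.invDeriv_pos hN), ← Real.exp_add]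
  exact Real.exp_le_exp.2 hlog

lemma ConvexProfile.inv_add_le (h : ConvexProfile F) (hN : N ∈ J F) (hs : 0 ≤ s)
    (hM : ∀ z ∈ Icc N (N + s), invDeriv F z ≤ M) : inv F (N + s) ≤ inv F N + M * s := by
  simpa using le_of_hasDerivAt_le_linear (c := M) (a := 0) hs
    (fun z hz => h.hasDerivAt_inv (h.mem_J hN hz.1)) (by simpa using hM)

lemma ConvexProfile.le_inv_add (h : ConvexProfile F) (hN : N ∈ J F) (hs : 0 ≤ s)
    (hM : ∀ z ∈ Icc N (N + s), M ≤ invDeriv F z) : inv F N + M * s ≤ inv F (N + s) := by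
  simpa using le_of_linear_le_hasDerivAt (c := M) (a := 0) hs
    (fun z hz => h.hasDerivAt_inv (h.mem_J hN hz.1)) (by simpa using hM)

lemma ConvexProfile.secant_le_g (h : ConvexProfile F) (hx : x ∈ J F) (hxy : x < y) (hyz : y ≤ z) :
    g F y + (g F y - g F x) / (y - x) * (z - y) ≤ g F z := by
  rcases hyz.eq_or_lt with rfl | hlt
  · simp
  have hslope := h.convexOn.slope_mono_adjacent hx (h.mem_J hx (hxy.le.trans hyz)) hxy hlt
  rw [le_div_iff₀ (by linarith)] at hslope
  linarith

lemma ConvexProfile.g_linear_bound (h : ConvexProfile F) (hm : m ∈ J F) (ha : 0 ≤ a)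
    (hga : ∀ z, m ≤ z → g F z - g F m ≤ a * (z - m)) :
    ∃ C, 0 ≤ C ∧ ∀ z, m ≤ z → |g F z| ≤ C * (1 + |z|) := by
  obtain ⟨p, hpJ, hpm⟩ : ∃ p ∈ J F, p < m :=
    ((eventually_nhdsWithin_of_eventually_nhds (h.admissible.isOpen_J.mem_nhds hm)).and
      (self_mem_nhdsWithin (s := Iio m))).exists
  set σ := (g F m - g F p) / (m - p)
  refine ⟨|g F m| + (|σ| + a) * (1 + |m|), by positivity, fun z hz => ?_⟩
  have hlower := h.secant_le_g hpJ hpm hz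
  have hupper := hga z hz
  have : 0 ≤ z - m := sub_nonneg.2 hz
  have habs : |g F z| ≤ |g F m| + (|σ| + a) * (z - m) := by
    have hσ : -|σ| * (z - m) ≤ σ * (z - m) := by
      gcongr
      exact neg_abs_le σ
    have hσ0 : 0 ≤ |σ| * (z - m) := by positivity
    have ha0 : 0 ≤ a * (z - m) := by positivity
    exact abs_le.2 ⟨by linarith [neg_abs_le (g F m)], by linarith [le_abs_self (g F m)]⟩
  calc |g F z| ≤ |g F m| + (|σ| + a) * (z - m) := habs
    _ ≤ |g F m| * (1 + |z|) + (|σ| + a) * ((1 + |m|) * (1 + |z|)) := by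
      gcongr
      · exact le_mul_of_one_le_right (abs_nonneg _) (by linarith [abs_nonneg z])
      · nlinarith [le_abs_self z, neg_abs_le m, abs_nonneg z, abs_nonneg m]
    _ = _ := by ring

lemma ConvexProfile.exp_sq_le_inv (h : ConvexProfile F) {p q σ d : ℝ} (hp : p ∈ J F) (hpq : p < q)
    (hσ : σ = (g F q - g F p) / (q - p)) (hσ0 : 0 ≤ σ) (hd : 0 ≤ d) :
    invDeriv F q * Real.exp (-|g F q| * (d + 1) + σ * d ^ 2 / 2) ≤ inv F (q + d + 1) := by
  have hq : q ∈ J F := h.mem_J hp hpq.le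
  have hqd : q + d ∈ J F := h.mem_J hq (by linarith)
  have hslope : ∀ z ∈ Icc (q + d) (q + d + 1),
      invDeriv F q * Real.exp (-|g F q| * (d + 1) + σ * d ^ 2 / 2) ≤ invDeriv F z := by
    intro z hz
    have hdz : d ≤ z - q := by linarith [hz.1]
    have hz1 : z - q ≤ d + 1 := by linarith [hz.2]
    have hlow := h.le_invDeriv_add (c := g F q) (a := σ) hq (hd.trans hdz) fun y hy =>
      hσ ▸ h.secant_le_g hp hpq hy.1
    rw [add_sub_cancel] at hlow
    refine le_trans (mul_le_mul_of_nonneg_left (Real.exp_le_exp.2 ?_) (h.invDeriv_pos hq).le) hlow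
    have hlin : |g F q| * (z - q) ≤ |g F q| * (d + 1) := by gcongr
    have habs : -|g F q| * (z - q) ≤ g F q * (z - q) :=
      mul_le_mul_of_nonneg_right (neg_abs_le _) (hd.trans hdz)
    have hsq : σ * d ^ 2 / 2 ≤ σ * (z - q) ^ 2 / 2 := by gcongr
    linarith
  linarith [h.le_inv_add hqd zero_le_one hslope, inv_pos_of_mem_J hqd]

lemma half_le_of_exp_sq_le {A B C D σ κ c z₀ : ℝ} (hA : 0 < A) (hC : 0 < C)
    (h : ∀ d, z₀ ≤ d →
      A * Real.exp (B * (d + 1) + σ * d ^ 2 / 2) ≤ C * Real.exp ((κ * d + c) ^ 2 / D)) :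
    σ / 2 ≤ κ ^ 2 / D := by
  refine sub_nonpos.1 (leadingCoeff_nonpos_of_quadratic_nonpos (z₀ := z₀) (B := B - 2 * κ * c / D)
    (C := Real.log A + B - Real.log C - c ^ 2 / D) fun d hd => ?_)
  have hlog := Real.log_le_log (by positivity) (h d hd)
  rw [Real.log_mul hA.ne' (Real.exp_pos _).ne', Real.log_mul hC.ne' (Real.exp_pos _).ne',
    Real.log_exp, Real.log_exp] at hlog
  have hexpand : (κ * d + c) ^ 2 / D = κ ^ 2 / D * d ^ 2 + 2 * κ * c / D * d + c ^ 2 / D := by ring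
  linarith

/- A secant slope `σ` of `g_F` makes `f_F` grow at least like `exp (σ z² / 2)`, while a slope `k` of
`F ∘ φ` allows at most `exp (z² / (4 k² T))`. -/
lemma ConvexProfile.slope_bound {n : ℕ} {φ : EuclideanSpace ℝ (Fin n) → ℝ} (h : ConvexProfile F)
    (hφ : FConvex F φ) {T : ℝ} (hT : 0 < T)
    (hint : Integrable fun y => gaussKernel (0 - y) T * φ y) {r : ℝ} (hr : 0 < r)
    {x y : EuclideanSpace ℝ (Fin n)} {k : ℝ} (hk : 0 < k) (hxy : x ≠ y)
    (hslope : realOf F (max (φ x) r) + k * ‖y - x‖ ≤ realOf F (max (φ y) r))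
    {p q : ℝ} (hp : p ∈ J F) (hpq : p < q) (hσ : 0 ≤ (g F q - g F p) / (q - p)) :
    2 * ((g F q - g F p) / (q - p)) * k ^ 2 * T ≤ 1 := by
  obtain ⟨C, c, hC, hinv⟩ := hφ.inv_growth h.admissible hT hint hr hk hxy hslope
  have hq : q ∈ J F := h.mem_J hp hpq.le
  set U := realOf F (max (φ y) r)
  have hrate : (g F q - g F p) / (q - p) / 2 ≤ (1 / k) ^ 2 / (4 * T) := by
    refine half_le_of_exp_sq_le (z₀ := max 0 (U - q - 1)) (B := -|g F q|)
      (c := (q + 1) / k + c) (h.invDeriv_pos hq) hC fun d hd => ?_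
    have hd0 : 0 ≤ d := (le_max_left _ _).trans hd
    have hdU : U ≤ q + d + 1 := by linarith [(le_max_right _ _).trans hd]
    have hlow := h.exp_sq_le_inv hp hpq rfl hσ hd0
    rw [show 1 / k * d + ((q + 1) / k + c) = (q + d + 1) / k + c by ring]
    exact hlow.trans (hinv (q + d + 1) (h.mem_J hq (by linarith)) hdU)
  have hmul := mul_le_mul_of_nonneg_right hrate (by positivity : 0 ≤ 4 * T * k ^ 2)
  have hone : (1 / k) ^ 2 / (4 * T) * (4 * T * k ^ 2) = 1 := by field_simp
  linarith

end Profile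

section FlowEquation

variable {n : ℕ} {F : ℝ → EReal} {φ : EuclideanSpace ℝ (Fin n) → ℝ} {C β ρ T t : ℝ}

lemma integrable_gaussKernel_one :
    Integrable fun z : EuclideanSpace ℝ (Fin n) => gaussKernel z 1 := by
  simpa using (gaussianGrowth_const 1).integrable_scaled (n := n) le_rfl zero_le_one (by norm_num) 0

lemma GaussianGrowth.le_heatFlow (hφ : GaussianGrowth C β φ) (hβ : 0 ≤ β) (hρ : ∀ y, ρ ≤ φ y)
    (ht : 0 ≤ t) (htβ : β * t < 1 / 4) (x : EuclideanSpace ℝ (Fin n)) : ρ ≤ heatFlow φ t x := by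
  rw [heatFlow_eq_scaled φ ht, ← heatFlow_const ρ ht x, heatFlow_eq_scaled _ ht]
  exact integral_mono (integrable_gaussKernel_one.mul_const ρ) (hφ.integrable_scaled hβ ht htβ x)
    fun z => mul_le_mul_of_nonneg_left (hρ _) (gaussKernel_pos z one_pos).le

lemma GaussianGrowth.heatFlow_le (hφ : GaussianGrowth C β φ) (hβ : 0 ≤ β) (ht : 0 ≤ t)
    (htβ : β * t < 1 / 4) {x : EuclideanSpace ℝ (Fin n)} {Q : EuclideanSpace ℝ (Fin n) → ℝ}
    (hQ : Integrable fun z => gaussKernel z 1 * Q z) (K A : ℝ)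
    (h : ∀ z, φ (x - √t • z) ≤ K + A * Q z) :
    heatFlow φ t x ≤ K + A * ∫ z, gaussKernel z 1 * Q z := by
  have hK := (integrable_gaussKernel_one (n := n)).mul_const K
  calc heatFlow φ t x = ∫ z, gaussKernel z 1 * φ (x - √t • z) := heatFlow_eq_scaled φ ht x
    _ ≤ ∫ z, (gaussKernel z 1 * K + A * (gaussKernel z 1 * Q z)) :=
      integral_mono (hφ.integrable_scaled hβ ht htβ x) (hK.add (hQ.const_mul A)) fun z =>
        (mul_le_mul_of_nonneg_left (h z) (gaussKernel_pos z one_pos).le).trans_eq (by ring)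
    _ = K + A * ∫ z, gaussKernel z 1 * Q z := by
      rw [integral_add hK (hQ.const_mul A), integral_mul_const, integral_gaussKernel_one, one_mul,
        integral_const_mul]

lemma GaussianGrowth.hasDerivAt_realOf_heatFlow_line (hφ : GaussianGrowth C β φ)
    (hC : ContDiffOn ℝ 2 (realOf F) (Ioi 0)) (ht : 0 < t) (htβ : β < 1 / (4 * t))
    {x : EuclideanSpace ℝ (Fin n)} (hv : 0 < heatFlow φ t x) (e : EuclideanSpace ℝ (Fin n)) :
    HasDerivAt (fun s : ℝ => realOf F (heatFlow φ t (x + s • e)))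
      ⟪deriv (realOf F) (heatFlow φ t x) • heatGrad φ t x, e⟫ 0 := by
  rw [real_inner_smul_left]
  have hF : HasDerivAt (realOf F) (deriv (realOf F) (heatFlow φ t x))
      (heatFlow φ t (x + (0 : ℝ) • e)) := by
    simpa using hasDerivAt_realOf hC hv
  exact HasDerivAt.comp (0 : ℝ) hF (hφ.hasDerivAt_heatFlow_line ht htβ x e)

lemma GaussianGrowth.hasDerivAt_smul_heatGrad_line (hφ : GaussianGrowth C β φ)
    (hC : ContDiffOn ℝ 2 (realOf F) (Ioi 0)) (ht : 0 < t) (htβ : β < 1 / (4 * t))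
    {x : EuclideanSpace ℝ (Fin n)} (hv : 0 < heatFlow φ t x) (e : EuclideanSpace ℝ (Fin n)) :
    HasDerivAt
      (fun s : ℝ =>
        ⟪deriv (realOf F) (heatFlow φ t (x + s • e)) • heatGrad φ t (x + s • e), e⟫)
      (deriv (realOf F) (heatFlow φ t x) * heatHess φ t x e +
        deriv (deriv (realOf F)) (heatFlow φ t x) * ⟪heatGrad φ t x, e⟫ ^ 2) 0 := by
  have hF' : HasDerivAt (deriv (realOf F)) (deriv (deriv (realOf F)) (heatFlow φ t x))
      (heatFlow φ t (x + (0 : ℝ) • e)) := by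
    simpa using hasDerivAt_deriv_realOf hC hv
  have hprod := (HasDerivAt.comp (0 : ℝ) hF' (hφ.hasDerivAt_heatFlow_line ht htβ x e)).mul
    (hφ.hasDerivAt_heatGrad_line ht htβ x e)
  simp only [real_inner_smul_left]
  refine hprod.congr_deriv ?_
  simp only [Function.comp_apply, zero_smul, add_zero]
  ring

lemma ConvexProfile.hasDerivAt_realOf_heatFlow_time (h : ConvexProfile F)
    (hφ : GaussianGrowth C β φ) (ht : 0 < t) (htβ : β < 1 / (4 * t))
    {x : EuclideanSpace ℝ (Fin n)} (hv : 0 < heatFlow φ t x) :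
    HasDerivAt (fun s => realOf F (heatFlow φ s x))
      ((∑ i, (deriv (realOf F) (heatFlow φ t x) *
            heatHess φ t x (EuclideanSpace.basisFun (Fin n) ℝ i) +
          deriv (deriv (realOf F)) (heatFlow φ t x) *
            ⟪heatGrad φ t x, EuclideanSpace.basisFun (Fin n) ℝ i⟫ ^ 2)) +
        g F (realOf F (heatFlow φ t x)) *
          ‖deriv (realOf F) (heatFlow φ t x) • heatGrad φ t x‖ ^ 2) t := by
  refine (HasDerivAt.comp t (hasDerivAt_realOf h.contDiffOn hv)
    (hφ.hasDerivAt_heatFlow_time ht htβ x)).congr_deriv ?_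
  have hd := h.deriv_pos _ hv
  have hinv := h.admissible.inv_realOf hv
  rw [h.admissible.g_eq h.contDiffOn (h.admissible.realOf_mem_J hv) (by rwa [hinv]), hinv,
    norm_smul, mul_pow, Real.norm_of_nonneg hd.le, Finset.sum_add_distrib, ← Finset.mul_sum,
    ← Finset.mul_sum, OrthonormalBasis.sum_sq_inner_left]
  field_simp
  ring

lemma lt_one_div_four_mul (ht : 0 < t) : β < 1 / (4 * t) ↔ β * t < 1 / 4 := by
  rw [lt_div_iff₀ (by positivity), lt_div_iff₀ four_pos, mul_assoc, mul_comm 4]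

lemma ConvexProfile.isFlow (h : ConvexProfile F) (hφ : GaussianGrowth C β φ) (hβ : 0 ≤ β)
    (hρ₀ : 0 < ρ) (hρ : ∀ y, ρ ≤ φ y) (hTβ : β * T < 1 / 4) :
    IsFlow (g F) T (fun i => EuclideanSpace.basisFun (Fin n) ℝ i)
      (fun t x => realOf F (heatFlow φ t x))
      (fun t x => deriv (realOf F) (heatFlow φ t x) • heatGrad φ t x)
      (fun t x i => deriv (realOf F) (heatFlow φ t x) *
          heatHess φ t x (EuclideanSpace.basisFun (Fin n) ℝ i) +
        deriv (deriv (realOf F)) (heatFlow φ t x) *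
          ⟪heatGrad φ t x, EuclideanSpace.basisFun (Fin n) ℝ i⟫ ^ 2) := by
  have htβ : ∀ t ≤ T, β * t < 1 / 4 := fun t ht =>
    (mul_le_mul_of_nonneg_left ht hβ).trans_lt hTβ
  have htβ' : ∀ t ∈ Ioc 0 T, β < 1 / (4 * t) := fun t ht =>
    (lt_one_div_four_mul ht.1).2 (htβ t ht.2)
  have hv : ∀ t ∈ Icc 0 T, ∀ x, 0 < heatFlow φ t x := fun t ht x =>
    hρ₀.trans_le (hφ.le_heatFlow hβ hρ ht.1 (htβ t ht.2) x)
  have hv' : ∀ t ∈ Ioc 0 T, ∀ x, 0 < heatFlow φ t x := fun t ht => hv t (Ioc_subset_Icc_self ht)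
  exact {
    norm_dir := fun i => by simp
    cont := h.admissible.continuousOn_realOf.comp (hφ.continuousOn_heatFlow hβ hTβ)
      fun p hp => hv p.1 hp.1 p.2
    grad := fun t ht x e =>
      hφ.hasDerivAt_realOf_heatFlow_line h.contDiffOn ht.1 (htβ' t ht) (hv' t ht x) e
    hess := fun t ht x i =>
      hφ.hasDerivAt_smul_heatGrad_line h.contDiffOn ht.1 (htβ' t ht) (hv' t ht x) _
    time := fun t ht x => h.hasDerivAt_realOf_heatFlow_time hφ ht.1 (htβ' t ht) (hv' t ht x) }

end FlowEquation

section LinearGrowth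

variable {n : ℕ} {F : ℝ → EReal} {φ : EuclideanSpace ℝ (Fin n) → ℝ}
  {C β ρ T t a b c m D L N s : ℝ}

lemma ConvexProfile.inv_add_le_of_g_le (h : ConvexProfile F) (hN : N ∈ J F) (hs : 0 ≤ s)
    (hc : 0 ≤ c) (ha : 0 ≤ a) (hg : ∀ z ∈ Icc N (N + s), g F z ≤ c + a * (z - N)) :
    inv F (N + s) ≤ inv F N + invDeriv F N * Real.exp (c * s + a * s ^ 2 / 2) * s := by
  refine h.inv_add_le hN hs fun z hz => ?_
  have hzN : 0 ≤ z - N := sub_nonneg.2 hz.1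
  have hzs : z - N ≤ s := by linarith [hz.2]
  have hgrow := h.invDeriv_add_le (c := c) (a := a) hN hzN fun y hy =>
    hg y ⟨hy.1, by linarith [hy.2, hz.2]⟩
  rw [add_sub_cancel] at hgrow
  have := (h.invDeriv_pos hN).le
  exact hgrow.trans (by gcongr)

lemma ConvexProfile.inv_add_exp_le_inv_add_one (h : ConvexProfile F) (hN : N ∈ J F) (hN₀ : 0 ≤ N)
    (hc : 0 ≤ c) (hg : ∀ z, N ≤ z → |g F z| ≤ c * (1 + |z|)) :
    inv F N + invDeriv F N * Real.exp (-c * (2 + N)) ≤ inv F (N + 1) := by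
  suffices hM : ∀ z ∈ Icc N (N + 1), invDeriv F N * Real.exp (-c * (2 + N)) ≤ invDeriv F z by
    simpa using h.le_inv_add hN zero_le_one hM
  intro z hz
  have hdecay := h.le_invDeriv_add (c := -c * (2 + N)) (a := 0) hN (sub_nonneg.2 hz.1)
      fun y hy => by
    have hy₀ : |y| ≤ N + 1 := by
      rw [abs_of_nonneg (hN₀.trans hy.1)]
      linarith [hy.2, hz.2]
    have : c * (1 + |y|) ≤ c * (2 + N) := mul_le_mul_of_nonneg_left (by linarith) hc
    linarith [neg_abs_le (g F y), hg y hy.1]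
  rw [add_sub_cancel] at hdecay
  refine (mul_le_mul_of_nonneg_left (Real.exp_le_exp.2 ?_) (h.invDeriv_pos hN).le).trans hdecay
  have : c * (2 + N) * (z - N) ≤ c * (2 + N) * 1 := by
    gcongr
    linarith [hz.2]
  linarith

lemma mul_exp_le_exp_gaussian {c₁ c₂ z₀ R Y : ℝ} (ha : 0 ≤ a) (hc₁ : 0 ≤ c₁) (hc₂ : 0 ≤ c₂)
    (hD : 1 ≤ D) (hz₀ : 0 ≤ z₀) (hR : D * z₀ ≤ R) (hRY : R ≤ Y) :
    Real.exp ((c₁ + a * (z₀ + R)) * (Y - R) + a * (Y - R) ^ 2 / 2) * (Y - R) ≤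
      Real.exp (-c₂ * (2 + (z₀ + R))) * Real.exp (-R) *
        Real.exp ((a / 2 + a / D) * Y ^ 2 + (2 + c₁ + 2 * c₂) * Y + (2 + c₁ + 2 * c₂)) := by
  have hD₀ : 0 < D := one_pos.trans_le hD
  have hR₀ : 0 ≤ R := (mul_nonneg hD₀.le hz₀).trans hR
  have hY : 0 ≤ Y := hR₀.trans hRY
  have hz₀Y : z₀ ≤ Y / D := by
    rw [le_div_iff₀ hD₀]
    linarith
  have hz₀Y' : z₀ ≤ Y := hz₀Y.trans (div_le_self hY hD)
  have hlast : Y - R ≤ Real.exp Y := by linarith [Real.add_one_le_exp Y]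
  have hlin : c₁ * (Y - R) ≤ c₁ * Y := by
    gcongr
    linarith
  have hcross : a * z₀ * (Y - R) ≤ a * (Y / D) * Y := by
    gcongr
    linarith
  have hrest : c₂ * (2 + (z₀ + R)) ≤ c₂ * (2 + 2 * Y) := by
    gcongr
    linarith
  have haR : 0 ≤ a * R ^ 2 := by positivity
  calc Real.exp ((c₁ + a * (z₀ + R)) * (Y - R) + a * (Y - R) ^ 2 / 2) * (Y - R)
      ≤ Real.exp ((c₁ + a * (z₀ + R)) * (Y - R) + a * (Y - R) ^ 2 / 2) * Real.exp Y := by gcongr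
    _ = Real.exp (c₁ * (Y - R) + a * z₀ * (Y - R) + a * (Y ^ 2 - R ^ 2) / 2 + Y) := by
      rw [← Real.exp_add]
      ring_nf
    _ ≤ Real.exp (-c₂ * (2 + (z₀ + R)) + -R +
        (a * Y ^ 2 / 2 + a * (Y / D) * Y + (2 + c₁ + 2 * c₂) * Y + (2 + c₁ + 2 * c₂))) :=
      Real.exp_le_exp.2 (by linarith)
    _ = _ := by
      rw [Real.exp_add, Real.exp_add]
      ring_nf

/- For `D` large the Gaussian rate is close to the rate `a / 2` at which `f_F` can grow, so it is
beaten by the Gauss kernel up to the existence time; the prefactor is absorbed in a unit step of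
`f_F`. -/
lemma ConvexProfile.exists_inv_add_le_gaussian (h : ConvexProfile F) (hm : m ∈ J F) (ha : 0 ≤ a)
    (hg : ∀ z z', m ≤ z → z ≤ z' → g F z' - g F z ≤ a * (z' - z)) (hD : 1 ≤ D) :
    ∃ c, ∀ z₀ R Y, m ≤ z₀ → 0 ≤ z₀ → D * z₀ ≤ R → 0 ≤ Y →
      inv F (z₀ + Y) ≤ inv F (z₀ + R) + (inv F (z₀ + R + 1) - inv F (z₀ + R)) * Real.exp (-R) *
        Real.exp ((a / 2 + a / D) * Y ^ 2 + c * Y + c) := by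
  obtain ⟨c₂, hc₂, hgabs⟩ := h.g_linear_bound hm ha fun z hz => hg m z le_rfl hz
  set c₁ := |g F m| + a * |m|
  have hc₁ : 0 ≤ c₁ := by positivity
  refine ⟨2 + c₁ + 2 * c₂, fun z₀ R Y hmz₀ hz₀ hR hY => ?_⟩
  have hR₀ : 0 ≤ R := (mul_nonneg (zero_le_one.trans hD) hz₀).trans hR
  have hz₀J : z₀ ∈ J F := h.mem_J hm hmz₀
  have hN : z₀ + R ∈ J F := h.mem_J hz₀J (by linarith)
  have hslope := (h.invDeriv_pos hN).le
  have hunit := h.inv_add_exp_le_inv_add_one hN (by positivity) hc₂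
    fun z hz => hgabs z (by linarith)
  set G := Real.exp ((a / 2 + a / D) * Y ^ 2 + (2 + c₁ + 2 * c₂) * Y + (2 + c₁ + 2 * c₂))
  suffices hstep : inv F (z₀ + Y) ≤ inv F (z₀ + R) +
      invDeriv F (z₀ + R) * Real.exp (-c₂ * (2 + (z₀ + R))) * Real.exp (-R) * G by
    refine hstep.trans ?_
    gcongr
    linarith
  rcases le_total Y R with hYR | hRY
  · have hmono := h.admissible.strictMonoOn_inv.monotoneOn (h.mem_J hz₀J (by linarith)) hN
      (by linarith : z₀ + Y ≤ z₀ + R)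
    exact le_add_of_le_of_nonneg hmono (by positivity)
  · have hgN : g F (z₀ + R) ≤ c₁ + a * (z₀ + R) := by
      have := mul_le_mul_of_nonneg_left (neg_abs_le m) ha
      linarith [hg m (z₀ + R) le_rfl (by linarith), le_abs_self (g F m)]
    have hfar := h.inv_add_le_of_g_le hN (sub_nonneg.2 hRY) (c := c₁ + a * (z₀ + R)) (a := a)
      (by positivity) ha fun z hz => by linarith [hg (z₀ + R) z (by linarith) hz.1]
    rw [show z₀ + R + (Y - R) = z₀ + Y by ring, mul_assoc] at hfar
    have hexp := mul_le_mul_of_nonneg_left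
      (mul_exp_le_exp_gaussian ha hc₁ hc₂ hD hz₀ hR hRY) hslope
    linarith

lemma integrable_gaussKernel_one_mul_exp_quadratic (hb : b < 1 / 4) (c d : ℝ) :
    Integrable fun z : EuclideanSpace ℝ (Fin n) =>
      gaussKernel z 1 * Real.exp (b * ‖z‖ ^ 2 + c * ‖z‖ + d) := by
  refine (integrable_exp_quadratic (sub_pos.2 hb) ((4 * Real.pi * 1) ^ (-(n : ℝ) / 2) *
    Real.exp d) c).congr (Eventually.of_forall fun z => ?_)
  simp only [gaussKernel]
  rw [mul_assoc _ (Real.exp d), mul_assoc _ (Real.exp _) (Real.exp _), ← Real.exp_add,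
    ← Real.exp_add]
  ring_nf

lemma exists_one_le_add_div_mul_lt {d ε : ℝ} (h : b * d < ε) :
    ∃ D : ℝ, 1 ≤ D ∧ (b + a / D) * d < ε := by
  have hlim : Tendsto (fun D : ℝ => (b + a / D) * d) atTop (𝓝 ((b + 0) * d)) :=
    (tendsto_const_nhds.add (tendsto_const_nhds.div_atTop tendsto_id)).mul_const _
  rw [add_zero] at hlim
  exact ((eventually_ge_atTop 1).and (hlim.eventually_lt_const h)).exists

lemma exp_neg_mul_le_one {R I : ℝ} (h : I ≤ R) : Real.exp (-R) * I ≤ 1 := by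
  rw [Real.exp_neg, inv_mul_le_one₀ (Real.exp_pos R)]
  linarith [Real.add_one_le_exp R]

lemma Admissible.apply_sub_sqrt_smul_le_inv (hF : Admissible F) {u : ℝ} (hL : 0 ≤ L) (htT : t ≤ T)
    (hgrow : ∀ y, realOf F (φ y) ≤ u + L * ‖y‖) {x z : EuclideanSpace ℝ (Fin n)}
    (hpos : 0 < φ (x - √t • z)) (hJ : u + L * ‖x‖ + L * √T * ‖z‖ ∈ J F) :
    φ (x - √t • z) ≤ inv F (u + L * ‖x‖ + L * √T * ‖z‖) := by
  refine (hF.le_inv_iff hpos hJ).2 ((hgrow _).trans ?_)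
  have hnorm := norm_sub_sqrt_smul_le htT x z
  linarith [mul_le_mul_of_nonneg_left hnorm hL]

lemma ConvexProfile.exists_realOf_heatFlow_le (h : ConvexProfile F) (hφ : GaussianGrowth C β φ)
    (hβ : 0 ≤ β) (hρ₀ : 0 < ρ) (hρ : ∀ y, ρ ≤ φ y) (hTβ : β * T < 1 / 4) (hT : 0 ≤ T)
    (hL : 0 ≤ L) (ha : 0 ≤ a)
    (hg : ∀ z z', realOf F ρ ≤ z → z ≤ z' → g F z' - g F z ≤ a * (z' - z))
    (haT : 2 * a * L ^ 2 * T < 1) {u : ℝ} (hu : 0 ≤ u) (hρu : realOf F ρ ≤ u)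
    (hgrow : ∀ y, realOf F (φ y) ≤ u + L * ‖y‖) :
    ∃ D I, 0 ≤ D ∧ 0 ≤ I ∧
      ∀ t ∈ Icc 0 T, ∀ x, realOf F (heatFlow φ t x) ≤ D * (u + L * ‖x‖) + I := by
  obtain ⟨D, hD, hrate⟩ := exists_one_le_add_div_mul_lt (a := a) (b := a / 2) (d := (L * √T) ^ 2)
    (ε := 1 / 4) (by rw [mul_pow, Real.sq_sqrt hT]; linarith)
  have hm := h.admissible.realOf_mem_J hρ₀
  obtain ⟨c, hc⟩ := h.exists_inv_add_le_gaussian hm ha hg hD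
  set Q : EuclideanSpace ℝ (Fin n) → ℝ := fun z =>
    Real.exp ((a / 2 + a / D) * (L * √T * ‖z‖) ^ 2 + c * (L * √T * ‖z‖) + c)
  have hQ : Integrable fun z => gaussKernel z 1 * Q z := by
    simpa only [Q, mul_pow _ ‖_‖, ← mul_assoc] using
      integrable_gaussKernel_one_mul_exp_quadratic (n := n) hrate (c * (L * √T)) c
  set I := ∫ z, gaussKernel z 1 * Q z
  have hI : 0 ≤ I := integral_nonneg fun z =>
    mul_nonneg (gaussKernel_pos z one_pos).le (Real.exp_pos _).le
  refine ⟨1 + D, I + 1, by positivity, by positivity, fun t ht x => ?_⟩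
  set z₀ := u + L * ‖x‖
  have hz₀ : 0 ≤ z₀ := by positivity
  set R := D * z₀ + I
  have hR : D * z₀ ≤ R := le_add_of_nonneg_right hI
  have hDz₀ : 0 ≤ D * z₀ := by positivity
  have hρz₀ : realOf F ρ ≤ z₀ := hρu.trans (le_add_of_nonneg_right (by positivity))
  have hN : z₀ + R ∈ J F := h.mem_J hm (by linarith)
  have hN' : z₀ + R + 1 ∈ J F := h.mem_J hN (by linarith)
  have htβ : β * t < 1 / 4 := (mul_le_mul_of_nonneg_left ht.2 hβ).trans_lt hTβ
  have hstep : 0 ≤ inv F (z₀ + R + 1) - inv F (z₀ + R) :=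
    sub_nonneg.2 (h.admissible.strictMonoOn_inv.monotoneOn hN hN' (by linarith))
  have hflow := hφ.heatFlow_le hβ ht.1 htβ hQ _ _ fun z => by
    have hY : 0 ≤ L * √T * ‖z‖ := by positivity
    exact (h.admissible.apply_sub_sqrt_smul_le_inv hL ht.2 hgrow (hρ₀.trans_le (hρ _))
      (h.mem_J hm (by linarith))).trans (hc z₀ R _ hρz₀ hz₀ hR hY)
  have habsorb : Real.exp (-R) * I ≤ 1 := exp_neg_mul_le_one (le_add_of_nonneg_left hDz₀)
  have hle : heatFlow φ t x ≤ inv F (z₀ + R + 1) := by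
    linarith [mul_le_mul_of_nonneg_left habsorb hstep]
  have hpos := hρ₀.trans_le (hφ.le_heatFlow hβ hρ ht.1 htβ x)
  linarith [(h.admissible.le_inv_iff hpos hN').1 hle]

end LinearGrowth

section LipschitzData

variable {n : ℕ} {F : ℝ → EReal} {φ : EuclideanSpace ℝ (Fin n) → ℝ}
  {a C β ρ t T T₁ L : ℝ}

/-- The solution of `ℓ' = a ℓ³` that blows up at time `T₁`. It bounds the Lipschitz constants of
the solutions of `∂ₜ w = Δ w + g(w) |∇ w|²` when `a` bounds the slopes of `g`. -/
def cubicBlowup (a T₁ t : ℝ) : ℝ := (√(2 * a * (T₁ - t)))⁻¹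

lemma cubicBlowup_pos (ha : 0 < a) (ht : t < T₁) : 0 < cubicBlowup a T₁ t :=
  inv_pos.2 (Real.sqrt_pos.2 (mul_pos (by positivity) (sub_pos.2 ht)))

lemma cubicBlowup_le (ha : 0 < a) (htT : t ≤ T) (hT : T < T₁) :
    cubicBlowup a T₁ t ≤ cubicBlowup a T₁ T := by
  have : 0 < √(2 * a * (T₁ - T)) := inv_pos.1 (cubicBlowup_pos ha hT)
  unfold cubicBlowup
  gcongr

lemma hasDerivAt_cubicBlowup (ha : 0 < a) (ht : t < T₁) :
    HasDerivAt (cubicBlowup a T₁) (a * cubicBlowup a T₁ t ^ 3) t := by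
  have hsqrt : 0 < √(2 * a * (T₁ - t)) := inv_pos.1 (cubicBlowup_pos ha ht)
  have hlin : HasDerivAt (fun t : ℝ => 2 * a * (T₁ - t)) (-(2 * a)) t := by
    simpa using ((hasDerivAt_id t).const_sub T₁).const_mul (2 * a)
  refine ((hlin.sqrt (Real.sqrt_pos.1 hsqrt).ne').inv hsqrt.ne').congr_deriv ?_
  unfold cubicBlowup
  field_simp

lemma cubicBlowup_zero (hL : 0 < L) (hT₁ : 0 < T₁) :
    cubicBlowup (1 / (2 * L ^ 2 * T₁)) T₁ 0 = L := by
  have hsq : 2 * (1 / (2 * L ^ 2 * T₁)) * (T₁ - 0) = L⁻¹ ^ 2 := by field_simp; ring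
  rw [cubicBlowup, hsq, Real.sqrt_sq (by positivity), inv_inv]

lemma heatFlow_zero (φ : EuclideanSpace ℝ (Fin n) → ℝ) : heatFlow φ 0 = φ := by
  ext x
  simp [heatFlow]

lemma Admissible.realOf_le_realOf_heatFlow (hF : Admissible F) (hφ : GaussianGrowth C β φ)
    (hβ : 0 ≤ β) (hρ₀ : 0 < ρ) (hρ : ∀ y, ρ ≤ φ y) (hTβ : β * T < 1 / 4) (ht : t ∈ Icc 0 T)
    (x : EuclideanSpace ℝ (Fin n)) : realOf F ρ ≤ realOf F (heatFlow φ t x) := by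
  have hle := hφ.le_heatFlow hβ hρ ht.1 ((mul_le_mul_of_nonneg_left ht.2 hβ).trans_lt hTβ) x
  exact hF.strictMonoOn_realOf.monotoneOn hρ₀ (hρ₀.trans_le hle) hle

lemma ConvexProfile.exists_abs_realOf_heatFlow_le (h : ConvexProfile F)
    (hφ : GaussianGrowth C β φ) (hβ : 0 ≤ β) (hρ₀ : 0 < ρ) (hρ : ∀ y, ρ ≤ φ y)
    (hTβ : β * T < 1 / 4) (hT : 0 ≤ T) (hL : 0 ≤ L) (ha : 0 ≤ a)
    (hg : ∀ z z', realOf F ρ ≤ z → z ≤ z' → g F z' - g F z ≤ a * (z' - z))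
    (haT : 2 * a * L ^ 2 * T < 1)
    (hlip : ∀ x y, realOf F (φ x) - realOf F (φ y) ≤ L * ‖x - y‖) :
    ∃ K, ∀ t ∈ Icc 0 T, ∀ x, |realOf F (heatFlow φ t x)| ≤ K * (1 + ‖x‖) := by
  set u := |realOf F (φ 0)|
  have hρu : realOf F ρ ≤ u :=
    (h.admissible.strictMonoOn_realOf.monotoneOn hρ₀ (hρ₀.trans_le (hρ 0)) (hρ 0)).trans
      (le_abs_self _)
  have hgrow : ∀ y, realOf F (φ y) ≤ u + L * ‖y‖ := fun y => by
    have hy := hlip y 0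
    rw [sub_zero] at hy
    linarith [le_abs_self (realOf F (φ 0))]
  obtain ⟨D, I, hD, hI, hup⟩ := h.exists_realOf_heatFlow_le hφ hβ hρ₀ hρ hTβ hT hL ha hg haT
    (abs_nonneg _) hρu hgrow
  refine ⟨|realOf F ρ| + D * u + I + D * L, fun t ht x => ?_⟩
  have hlow := h.admissible.realOf_le_realOf_heatFlow hφ hβ hρ₀ hρ hTβ ht x
  have hgain : 0 ≤ (|realOf F ρ| + D * u + I) * ‖x‖ := by positivity
  have hDu : 0 ≤ D * u := by positivity
  have hDL : 0 ≤ D * L := by positivity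
  have hDLx : 0 ≤ D * L * ‖x‖ := by positivity
  exact abs_le.2 ⟨by linarith [neg_abs_le (realOf F ρ)],
    by linarith [hup t ht x, abs_nonneg (realOf F ρ)]⟩

lemma ConvexProfile.exists_flowBounds (h : ConvexProfile F) (hφ : GaussianGrowth C β φ)
    (hβ : 0 ≤ β) (hρ₀ : 0 < ρ) (hρ : ∀ y, ρ ≤ φ y) (hTβ : β * T < 1 / 4) (hT : 0 ≤ T)
    (hL : 0 ≤ L) (ha : 0 ≤ a)
    (hg : ∀ z z', realOf F ρ ≤ z → z ≤ z' → g F z' - g F z ≤ a * (z' - z))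
    (haT : 2 * a * L ^ 2 * T < 1)
    (hlip : ∀ x y, realOf F (φ x) - realOf F (φ y) ≤ L * ‖x - y‖) :
    ∃ B K, FlowBounds (g F) T a B K (realOf F ρ) fun t x => realOf F (heatFlow φ t x) := by
  obtain ⟨K, hgrow⟩ := h.exists_abs_realOf_heatFlow_le hφ hβ hρ₀ hρ hTβ hT hL ha hg haT hlip
  obtain ⟨G, hG, hlin⟩ := h.g_linear_bound (h.admissible.realOf_mem_J hρ₀) ha
    fun z hz => hg _ z le_rfl hz
  have hlow := fun t ht => h.admissible.realOf_le_realOf_heatFlow (t := t) hφ hβ hρ₀ hρ hTβ ht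
  refine ⟨G * (1 + K), K, hgrow, hlow, fun t ht x => ?_, ha, hg⟩
  calc |g F (realOf F (heatFlow φ t x))| ≤ G * (1 + |realOf F (heatFlow φ t x)|) :=
        hlin _ (hlow t ht x)
    _ ≤ G * ((1 + ‖x‖) + K * (1 + ‖x‖)) := by
        gcongr
        exacts [le_add_of_nonneg_right (norm_nonneg x), hgrow t ht x]
    _ = G * (1 + K) * (1 + ‖x‖) := by ring

theorem ConvexProfile.convexOn_heatFlow_of_lipschitz (h : ConvexProfile F)
    (hφ : GaussianGrowth C β φ) (hβ : 0 ≤ β) (hρ₀ : 0 < ρ) (hρ : ∀ y, ρ ≤ φ y)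
    (hTβ : β * T < 1 / 4) (hT : 0 ≤ T) (hTT₁ : T < T₁) (hL : 0 < L)
    (hlip : ∀ x y, realOf F (φ x) - realOf F (φ y) ≤ L * ‖x - y‖)
    (hconv : ConvexOn ℝ univ fun x => realOf F (φ x))
    (hg : ∀ z z', z ∈ J F → z ≤ z' → g F z' - g F z ≤ 1 / (2 * L ^ 2 * T₁) * (z' - z)) :
    ConvexOn ℝ univ fun x => realOf F (heatFlow φ T x) := by
  have hT₁ : 0 < T₁ := hT.trans_lt hTT₁
  set a := 1 / (2 * L ^ 2 * T₁) with ha_def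
  have ha : 0 < a := by positivity
  have hm : Ici (realOf F ρ) ⊆ J F := fun _ => h.mem_J (h.admissible.realOf_mem_J hρ₀)
  have haT : 2 * a * L ^ 2 * T < 1 := by
    have heq : 2 * a * L ^ 2 * T = T / T₁ := by rw [ha_def]; field_simp
    rwa [heq, div_lt_one hT₁]
  obtain ⟨B, K, hbd⟩ := h.exists_flowBounds hφ hβ hρ₀ hρ hTβ hT hL.le ha.le
    (fun z z' hz => hg z z' (hm hz)) haT hlip
  have hflow := h.isFlow hφ hβ hρ₀ hρ hTβ
  have hzero : cubicBlowup a T₁ 0 = L := cubicBlowup_zero hL hT₁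
  have hmono : ∀ t ∈ Icc 0 T, cubicBlowup a T₁ t ≤ cubicBlowup a T₁ T := fun t ht =>
    cubicBlowup_le ha ht.2 hTT₁
  have hderiv : ∀ t ≤ T, HasDerivAt (cubicBlowup a T₁) (a * cubicBlowup a T₁ t ^ 3) t :=
    fun t ht => hasDerivAt_cubicBlowup ha (ht.trans_lt hTT₁)
  have hpropagate : ∀ t ∈ Icc 0 T, ∀ x y,
      realOf F (heatFlow φ t x) - realOf F (heatFlow φ t y) ≤ cubicBlowup a T₁ t * ‖x - y‖ :=
    fun t ht => hflow.lipschitz hbd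
      (fun t ht => (hderiv t ht.2).continuousAt.continuousWithinAt)
      (fun t ht => (cubicBlowup_pos ha (ht.2.trans_lt hTT₁)).le) hmono (fun t ht => hderiv t ht.2)
      (by simpa only [heatFlow_zero, hzero] using hlip) ht
  refine hflow.convexOn hbd (h.convexOn.subset hm (convex_Ici _))
    (cubicBlowup_pos ha hTT₁).le (fun t ht x y => (hpropagate t ht x y).trans ?_)
    (by simpa only [heatFlow_zero] using hconv) ⟨hT, le_rfl⟩
  exact mul_le_mul_of_nonneg_right (hmono t ht) (norm_nonneg _)

end LipschitzData

section Preservation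

variable {n : ℕ} {F : ℝ → EReal} {φ : EuclideanSpace ℝ (Fin n) → ℝ} {C β ρ r t T : ℝ}

lemma convexOn_of_tendsto {E ι : Type*} [AddCommGroup E] [Module ℝ E] {l : Filter ι}
    [l.NeBot] {u : ι → E → ℝ} {v : E → ℝ} (hlim : ∀ x, Tendsto (fun i => u i x) l (𝓝 (v x)))
    (hu : ∀ᶠ i in l, ConvexOn ℝ univ (u i)) : ConvexOn ℝ univ v := by
  refine ⟨convex_univ, fun x _ y _ α β hα hβ hαβ => ?_⟩
  refine le_of_tendsto_of_tendsto (hlim _) (((hlim x).const_smul α).add ((hlim y).const_smul β)) ?_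
  filter_upwards [hu] with i hi
  exact hi.2 (mem_univ x) (mem_univ y) hα hβ hαβ

lemma tendsto_heatFlow_of_dominated {ι : Type*} {l : Filter ι} [l.IsCountablyGenerated]
    {φs : ι → EuclideanSpace ℝ (Fin n) → ℝ} {ψ : EuclideanSpace ℝ (Fin n) → ℝ} (ht : 0 < t)
    {x : EuclideanSpace ℝ (Fin n)} (hψ : Integrable fun y => gaussKernel (x - y) t * ψ y)
    (hcont : ∀ i, Continuous (φs i)) (hle : ∀ᶠ i in l, ∀ y, |φs i y| ≤ ψ y)
    (hlim : ∀ y, Tendsto (fun i => φs i y) l (𝓝 (φ y))) :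
    Tendsto (fun i => heatFlow (φs i) t x) l (𝓝 (heatFlow φ t x)) := by
  have := continuous_gaussKernel (n := n) t
  simp only [heatFlow, if_pos ht]
  refine tendsto_integral_filter_of_dominated_convergence _
    (Eventually.of_forall fun i => Continuous.aestronglyMeasurable ?_) ?_ hψ
    (ae_of_all _ fun y => (hlim y).const_mul _)
  · have := hcont i
    fun_prop
  · filter_upwards [hle] with i hi
    refine ae_of_all _ fun y => ?_
    rw [norm_mul, Real.norm_of_nonneg (gaussKernel_pos _ ht).le]
    exact mul_le_mul_of_nonneg_left (hi y) (gaussKernel_pos _ ht).le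

lemma heatFlow_pos (hφ : Continuous φ) (hφ₀ : ∀ y, 0 ≤ φ y) (ht : 0 < t)
    {x : EuclideanSpace ℝ (Fin n)} (hint : Integrable fun y => gaussKernel (x - y) t * φ y)
    (hne : ∃ y, 0 < φ y) : 0 < heatFlow φ t x := by
  obtain ⟨y, hy⟩ := hne
  have := continuous_gaussKernel (n := n) t
  have hopen : IsOpen (Function.support fun y => gaussKernel (x - y) t * φ y) :=
    Continuous.isOpen_support (by fun_prop)
  simp only [heatFlow, if_pos ht]
  rw [integral_pos_iff_support_of_nonneg
    (fun y => mul_nonneg (gaussKernel_pos _ ht).le (hφ₀ y)) hint]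
  exact hopen.measure_pos volume ⟨y, (mul_pos (gaussKernel_pos _ ht) hy).ne'⟩

lemma GaussianGrowth.max_const (hφ : GaussianGrowth C β φ) (hβ : 0 ≤ β) (hr : 0 ≤ r) :
    GaussianGrowth (C + r) β fun y => max (φ y) r := by
  refine ⟨hφ.continuous.max continuous_const, fun y => ?_⟩
  have hexp : r * 1 ≤ r * Real.exp (β * ‖y‖ ^ 2) := by
    gcongr
    exact Real.one_le_exp (by positivity)
  calc |max (φ y) r| ≤ max |φ y| |r| := abs_max_le_max_abs_abs
    _ ≤ |φ y| + |r| := max_le_add_of_nonneg (abs_nonneg _) (abs_nonneg _)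
    _ ≤ (C + r) * Real.exp (β * ‖y‖ ^ 2) := by
        rw [abs_of_nonneg hr]
        linarith [hφ.abs_le y]

lemma ConvexProfile.exists_lipschitz_approximation (h : ConvexProfile F) (hρ₀ : 0 < ρ)
    (hρ : ∀ y, ρ ≤ φ y) (hconv : ConvexOn ℝ univ fun x => realOf F (φ x)) :
    ∃ φs : ℕ → EuclideanSpace ℝ (Fin n) → ℝ, (∀ k, Continuous (φs k)) ∧ (∀ k x, ρ ≤ φs k x) ∧
      (∀ k x, φs k x ≤ φ x) ∧ (∀ x, Tendsto (fun k => φs k x) atTop (𝓝 (φ x))) ∧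
      (∀ k x y, realOf F (φs k x) - realOf F (φs k y) ≤ k * ‖x - y‖) ∧
      ∀ k, ConvexOn ℝ univ fun x => realOf F (φs k x) := by
  have hF := h.admissible
  have hpos : ∀ y, 0 < φ y := fun y => hρ₀.trans_le (hρ y)
  set u := fun x => realOf F (φ x) with hu_def
  have hu : ∀ x, realOf F ρ ≤ u x := fun x =>
    hF.strictMonoOn_realOf.monotoneOn hρ₀ (hpos x) (hρ x)
  have huJ : ∀ x, u x ∈ J F := fun x => hF.realOf_mem_J (hpos x)
  have hu_cont : Continuous u := continuousOn_univ.1 (hconv.continuousOn isOpen_univ)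
  have hvJ : ∀ (k : ℕ) x, infConv u k x ∈ J F := fun k x =>
    h.mem_J (hF.realOf_mem_J hρ₀) (le_infConv hu k.cast_nonneg x)
  have hv_convex : ∀ k : ℕ, ConvexOn ℝ univ (infConv u k) := fun k =>
    convexOn_infConv hu k.cast_nonneg hconv
  refine ⟨fun k x => inv F (infConv u k x), fun k => continuous_iff_continuousAt.2 fun x => ?_,
    fun k x => (hF.le_inv_iff hρ₀ (hvJ k x)).2 (le_infConv hu k.cast_nonneg x), fun k x => ?_,
    fun x => ?_, fun k => ?_, fun k => ?_⟩
  · exact ContinuousAt.comp (f := infConv u k) (hF.continuousAt_inv (hvJ k x))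
      (((hv_convex k).continuousOn isOpen_univ).continuousAt univ_mem)
  · rw [← hF.inv_realOf (hpos x)]
    exact hF.strictMonoOn_inv.monotoneOn (hvJ k x) (huJ x) (infConv_le_self hu k.cast_nonneg x)
  · have hlim := (hF.continuousAt_inv (huJ x)).tendsto.comp (tendsto_infConv hu hu_cont x)
    rwa [hu_def, hF.inv_realOf (hpos x)] at hlim
  · simpa only [realOf_inv (hvJ k _)] using infConv_sub_le hu k.cast_nonneg
  · simpa only [realOf_inv (hvJ k _)] using hv_convex k

lemma ConvexProfile.convexOn_heatFlow_of_antitoneOn (h : ConvexProfile F)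
    (hφ : GaussianGrowth C β φ) (hβ : 0 ≤ β) (hρ₀ : 0 < ρ) (hρ : ∀ y, ρ ≤ φ y) (ht : 0 < t)
    (htβ : β * t < 1 / 4) (hconv : ConvexOn ℝ univ fun x => realOf F (φ x))
    (hanti : AntitoneOn (g F) (J F)) :
    ConvexOn ℝ univ fun x => realOf F (heatFlow φ t x) := by
  obtain ⟨φs, hcont, hρφs, hle, hlim, hlip, hφs_convex⟩ :=
    h.exists_lipschitz_approximation hρ₀ hρ hconv
  have habs : ∀ k y, |φs k y| ≤ φ y := fun k y => by
    rw [abs_of_pos (hρ₀.trans_le (hρφs k y))]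
    exact hle k y
  refine convexOn_of_tendsto (l := atTop) (u := fun k x => realOf F (heatFlow (φs k) t x))
    (fun x => ?_) ?_
  · exact (h.admissible.continuousOn_realOf.continuousAt (Ioi_mem_nhds
      (hρ₀.trans_le (hφ.le_heatFlow hβ hρ ht.le htβ x)))).tendsto.comp
      (tendsto_heatFlow_of_dominated ht
        (hφ.integrable_gaussKernel_mul ht ((lt_one_div_four_mul ht).2 htβ) x) hcont
        (Eventually.of_forall habs) hlim)
  · filter_upwards [eventually_gt_atTop 0] with k hk
    have hgrowth : GaussianGrowth C β (φs k) :=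
      ⟨hcont k, fun y => (habs k y).trans ((le_abs_self _).trans (hφ.abs_le y))⟩
    refine h.convexOn_heatFlow_of_lipschitz hgrowth hβ hρ₀ (hρφs k) htβ ht.le (lt_add_one t)
      (Nat.cast_pos.2 hk) (hlip k) (hφs_convex k) fun z z' hz hzz' => ?_
    exact (sub_nonpos.2 (hanti hz (h.mem_J hz hzz') hzz')).trans
      (mul_nonneg (by positivity) (sub_nonneg.2 hzz'))

lemma exists_lipschitz_const {E : Type*} [NormedAddCommGroup E] {u : E → ℝ} {S : Set ℝ} {c : ℝ}
    (hu : ∃ x y, u x < u y) (hS : ∃ s ∈ S, 0 < s)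
    (h : ∀ s ∈ S, 0 < s → ∀ k, 0 < k → ∀ x y, x ≠ y → u x + k * ‖y - x‖ ≤ u y → s * k ^ 2 ≤ c) :
    ∃ L, 0 < L ∧ (∀ x y, u x - u y ≤ L * ‖x - y‖) ∧ ∀ s ∈ S, s * L ^ 2 ≤ c := by
  set K : Set ℝ := {k | 0 < k ∧ ∃ x y, x ≠ y ∧ u x + k * ‖y - x‖ ≤ u y}
  have hslope : ∀ x y, u x < u y → 0 < ‖y - x‖ ∧ (u y - u x) / ‖y - x‖ ∈ K := fun x y hxy => by
    have hne : x ≠ y := fun he => hxy.ne (congrArg u he)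
    have hd : 0 < ‖y - x‖ := norm_pos_iff.2 (sub_ne_zero.2 hne.symm)
    refine ⟨hd, div_pos (sub_pos.2 hxy) hd, x, y, hne, ?_⟩
    rw [div_mul_cancel₀ _ hd.ne', add_sub_cancel]
  have hbound : ∀ s ∈ S, 0 < s → √(c / s) ∈ upperBounds K := by
    rintro s hs hs₀ k ⟨hk, x, y, hxy, hle⟩
    refine Real.le_sqrt_of_sq_le ((le_div_iff₀' hs₀).2 ?_)
    exact h s hs hs₀ k hk x y hxy hle
  obtain ⟨s₀, hs₀S, hs₀⟩ := hS
  obtain ⟨x₀, y₀, hxy₀⟩ := hu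
  have hmem := (hslope x₀ y₀ hxy₀).2
  have hc : 0 ≤ c := le_trans (by have := hmem.1; positivity) <|
    (le_div_iff₀' hs₀).1 <| Real.sqrt_pos.1 (hmem.1.trans_le (hbound s₀ hs₀S hs₀ hmem)) |>.le
  have hL : 0 < sSup K := hmem.1.trans_le (le_csSup ⟨_, hbound s₀ hs₀S hs₀⟩ hmem)
  refine ⟨sSup K, hL, fun x y => ?_, fun s hs => ?_⟩
  · rcases le_or_gt (u x) (u y) with hle | hlt
    · exact (sub_nonpos.2 hle).trans (by positivity)
    · obtain ⟨hd, hk⟩ := hslope y x hlt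
      exact (div_le_iff₀ hd).1 (le_csSup ⟨_, hbound s₀ hs₀S hs₀⟩ hk)
  · rcases le_or_gt s 0 with hs₁ | hs₁
    · exact (mul_nonpos_of_nonpos_of_nonneg hs₁ (sq_nonneg _)).trans hc
    · have hle : sSup K ≤ √(c / s) := csSup_le ⟨_, hmem⟩ (hbound s hs hs₁)
      exact (le_div_iff₀' hs₁).1 ((Real.le_sqrt hL.le (by positivity)).1 hle)

/- Positive slopes of `g` and of `F ∘ max φ r` constrain each other, because `φ` is integrable
against the Gauss kernel while `f_F` grows the faster the larger the slopes of `g` are. -/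
lemma ConvexProfile.exists_lipschitz_const_of_not_antitoneOn (h : ConvexProfile F)
    (hφ : FConvex F φ) (hT : 0 < T) (hint : Integrable fun y => gaussKernel (0 - y) T * φ y)
    (hr : 0 < r) (hne : ∃ x y, realOf F (max (φ x) r) < realOf F (max (φ y) r))
    (hanti : ¬AntitoneOn (g F) (J F)) :
    ∃ L, 0 < L ∧
      (∀ x y, realOf F (max (φ x) r) - realOf F (max (φ y) r) ≤ L * ‖x - y‖) ∧
      ∀ z z', z ∈ J F → z ≤ z' → g F z' - g F z ≤ 1 / (2 * L ^ 2 * T) * (z' - z) := by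
  simp only [AntitoneOn, not_forall, not_le] at hanti
  obtain ⟨p, hp, q, -, hpq, hgpq⟩ := hanti
  have hpq' : p < q := hpq.lt_of_ne fun he => hgpq.ne (congrArg (g F) he)
  obtain ⟨L, hL, hlip, hslope⟩ := exists_lipschitz_const
    (S := {s | ∃ p q, p ∈ J F ∧ p < q ∧ s = (g F q - g F p) / (q - p)}) (c := 1 / (2 * T)) hne
    ⟨_, ⟨p, q, hp, hpq', rfl⟩, div_pos (sub_pos.2 hgpq) (sub_pos.2 hpq')⟩ (by
      rintro s ⟨p, q, hp, hpq, rfl⟩ hs k hk x y hxy hle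
      rw [le_div_iff₀ (by positivity)]
      linarith [h.slope_bound hφ hT hint hr hk hxy hle hp hpq hs.le])
  refine ⟨L, hL, hlip, fun z z' hz hzz' => ?_⟩
  rcases hzz'.eq_or_lt with rfl | hlt
  · simp
  · have hs := (le_div_iff₀ (by positivity)).1 (hslope _ ⟨z, z', hz, hlt, rfl⟩)
    rw [← div_le_iff₀ (sub_pos.2 hlt), le_div_iff₀ (by positivity)]
    linarith

lemma ConvexProfile.convexOn_heatFlow_max (h : ConvexProfile F) (hφ : FConvex F φ) (hr : 0 < r)
    (ht : 0 < t) (htm : ENNReal.ofReal t < maxTime φ) :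
    ConvexOn ℝ univ fun x => realOf F (heatFlow (fun y => max (φ y) r) t x) := by
  obtain ⟨T, htT, hTm⟩ := exists_gt_of_lt_maxTime htm
  have hT : 0 < T := ht.trans htT
  have hint := integrable_of_lt_maxTime hT hTm (0 : EuclideanSpace ℝ (Fin n))
  obtain ⟨β, hβT, hβt⟩ := exists_between (show 1 / (4 * T) < 1 / (4 * t) by gcongr)
  have hβ : 0 ≤ β := le_trans (by positivity) hβT.le
  have htβ := (lt_one_div_four_mul ht).1 hβt
  obtain ⟨C, hC⟩ := hφ.gaussianGrowth h.admissible hT hint hβT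
  have hψ := hC.max_const hβ hr.le
  have hψr : ∀ y, r ≤ max (φ y) r := fun y => le_max_right _ _
  have hconv := hφ.convexOn_max h.admissible hr
  by_cases hanti : AntitoneOn (g F) (J F)
  · exact h.convexOn_heatFlow_of_antitoneOn hψ hβ hr hψr ht htβ hconv hanti
  by_cases hne : ∃ x y, realOf F (max (φ x) r) < realOf F (max (φ y) r)
  · obtain ⟨L, hL, hlip, hslope⟩ :=
      h.exists_lipschitz_const_of_not_antitoneOn hφ hT hint hr hne hanti
    exact h.convexOn_heatFlow_of_lipschitz hψ hβ hr hψr htβ ht.le htT hL hlip hconv hslope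
  · push Not at hne
    have hconst : (fun y => max (φ y) r) = fun _ => max (φ 0) r := funext fun x =>
      h.admissible.strictMonoOn_realOf.injOn (hr.trans_le (hψr x)) (hr.trans_le (hψr 0))
        (le_antisymm (hne 0 x) (hne x 0))
    simp only [hconst, heatFlow_const _ ht.le]
    exact convexOn_const _ convex_univ

theorem ConvexProfile.preserved (h : ConvexProfile F) (n : ℕ) : Preserved n F := by
  intro φ hφ _ t ht htm
  have hint := integrable_of_lt_maxTime ht htm
  have hcont := hφ.continuous h.admissible
  by_cases hzero : ∀ y, φ y = 0
  · obtain rfl : φ = fun _ => 0 := funext hzero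
    rwa [funext (heatFlow_const (n := n) 0 ht.le)]
  push Not at hzero
  obtain ⟨y₀, hy₀⟩ := hzero
  have hpos : ∀ x, 0 < heatFlow φ t x := fun x =>
    heatFlow_pos hcont hφ.1 ht (hint x) ⟨y₀, (hφ.1 y₀).lt_of_ne' hy₀⟩
  refine fconvex_of_convexOn h.admissible hpos (convexOn_of_tendsto (l := 𝓝[>] (0 : ℝ))
    (u := fun r x => realOf F (heatFlow (fun y => max (φ y) r) t x)) (fun x => ?_) ?_)
  · refine (h.admissible.continuousOn_realOf.continuousAt (Ioi_mem_nhds (hpos x))).tendsto.comp ?_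
    refine tendsto_heatFlow_of_dominated (ψ := fun y => φ y + 1) ht ?_
      (fun r => hcont.max continuous_const) ?_ fun y => ?_
    · simp only [mul_add]
      exact (hint x).add ((integrable_gaussKernel ht x).mul_const 1)
    · filter_upwards [Ioo_mem_nhdsGT one_pos] with r hr y
      rw [abs_of_nonneg (hr.1.le.trans (le_max_right _ _))]
      exact max_le (le_add_of_nonneg_right zero_le_one) (by linarith [hr.2, hφ.1 y])
    · have hmax : Tendsto (fun r => max (φ y) r) (𝓝 0) (𝓝 (max (φ y) 0)) :=
        Continuous.tendsto (by fun_prop) 0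
      rw [max_eq_left (hφ.1 y)] at hmax
      exact hmax.mono_left nhdsWithin_le_nhds
  · filter_upwards [self_mem_nhdsWithin] with r hr
    exact h.convexOn_heatFlow_max hφ hr ht htm

end Preservation

section SecondDifference

/-- The symmetric second difference `f (x + h) + f (x - h) - 2 f x`. -/
def secondDiff {V : Type*} [AddCommGroup V] (f : V → ℝ) (x h : V) : ℝ :=
  f (x + h) + f (x - h) - 2 * f x

lemma secondDiff_zero {V : Type*} [AddCommGroup V] (f : V → ℝ) (x : V) :
    secondDiff f x 0 = 0 := by
  simp only [secondDiff, add_zero, sub_zero]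
  ring

lemma tendsto_secondDiff_div_sq {f f' : ℝ → ℝ} {z d : ℝ}
    (hf : ∀ᶠ y in 𝓝 z, HasDerivAt f (f' y) y) (hf' : HasDerivAt f' d z) :
    Tendsto (fun s => secondDiff f z s / s ^ 2) (𝓝[≠] 0) (𝓝 d) := by
  have hadd : Tendsto (fun s : ℝ => z + s) (𝓝 0) (𝓝 z) := by
    simpa using (continuous_const.add continuous_id).tendsto (0 : ℝ) (f := fun s : ℝ => z + s)
  have hsub : Tendsto (fun s : ℝ => z - s) (𝓝 0) (𝓝 z) := by
    simpa using (continuous_const.sub continuous_id).tendsto (0 : ℝ) (f := fun s : ℝ => z - s)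
  have hcont : ContinuousAt f z := hf.self_of_nhds.continuousAt
  have hnum : Tendsto (secondDiff f z) (𝓝 0) (𝓝 0) := by
    have h := ((hcont.tendsto.comp hadd).add (hcont.tendsto.comp hsub)).sub_const (2 * f z)
    rwa [show f z + f z - 2 * f z = 0 by ring] at h
  have hden : Tendsto (fun s : ℝ => s ^ 2) (𝓝 0) (𝓝 0) := by
    simpa using (continuous_pow 2).tendsto (0 : ℝ)
  have hquot : Tendsto (fun s => (f' (z + s) - f' (z - s)) / (2 * s)) (𝓝[≠] 0) (𝓝 d) := by
    have hplus : HasDerivAt f' d (z + 0) := by simpa using hf'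
    have hminus : HasDerivAt f' d (z - 0) := by simpa using hf'
    have hderiv := (hplus.comp_const_add z 0).sub (hminus.comp_const_sub z 0)
    have hslope := (hasDerivAt_iff_tendsto_slope.1 hderiv).const_mul (1 / 2)
    rw [show 1 / 2 * (d - -d) = d by ring] at hslope
    refine hslope.congr fun s => ?_
    simp only [slope_def_field, Pi.sub_apply, add_zero, sub_zero, sub_self]
    ring
  refine HasDerivAt.lhopital_zero_nhdsNE (f' := fun s => f' (z + s) - f' (z - s))
    (g' := fun s => 2 * s) ?_ ?_ ?_ (hnum.mono_left nhdsWithin_le_nhds)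
    (hden.mono_left nhdsWithin_le_nhds) hquot
  · refine Eventually.filter_mono nhdsWithin_le_nhds ?_
    filter_upwards [hadd.eventually hf, hsub.eventually hf] with s hs hs'
    exact (((hs.comp_const_add z s).add (hs'.comp_const_sub z s)).sub_const (2 * f z)).congr_deriv
      (by ring)
  · exact Eventually.of_forall fun s => by simpa using hasDerivAt_pow 2 s
  · filter_upwards [self_mem_nhdsWithin] with s hs using mul_ne_zero two_ne_zero hs

lemma GaussianGrowth.abs_secondDiff_le {V : Type*} [NormedAddCommGroup V] {C β : ℝ} {f : V → ℝ}
    (hf : GaussianGrowth C β f) (hβ : 0 ≤ β) (x h : V) :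
    |secondDiff f x h| ≤ 4 * C * Real.exp (2 * β * ‖x‖ ^ 2) * Real.exp (2 * β * ‖h‖ ^ 2) := by
  have hC := hf.const_nonneg
  have hbound : ∀ y : V, ‖y‖ ≤ ‖x‖ + ‖h‖ →
      |f y| ≤ C * Real.exp (2 * β * ‖x‖ ^ 2 + 2 * β * ‖h‖ ^ 2) := fun y hy => by
    have hsq : ‖y‖ ^ 2 ≤ 2 * ‖x‖ ^ 2 + 2 * ‖h‖ ^ 2 := calc
      ‖y‖ ^ 2 ≤ (‖x‖ + ‖h‖) ^ 2 := by gcongr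
      _ ≤ 2 * ‖x‖ ^ 2 + 2 * ‖h‖ ^ 2 := by linarith [add_sq_le (a := ‖x‖) (b := ‖h‖)]
    refine (hf.abs_le y).trans ?_
    gcongr
    linarith [mul_le_mul_of_nonneg_left hsq hβ]
  have hadd := _root_.abs_le.1 (hbound (x + h) (norm_add_le _ _))
  have hsub := _root_.abs_le.1 (hbound (x - h) (norm_sub_le _ _))
  have hmid := _root_.abs_le.1 (hbound x (le_add_of_nonneg_right (norm_nonneg h)))
  rw [mul_assoc, ← Real.exp_add, _root_.abs_le]
  constructor <;> unfold secondDiff <;> linarith [hadd.1, hadd.2, hsub.1, hsub.2, hmid.1, hmid.2]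

lemma exists_abs_le_mul_sq_mul_exp {q : ℝ → ℝ} {d G b : ℝ} (hb : 0 ≤ b) (hq0 : q 0 = 0)
    (hq : Tendsto (fun s => q s / s ^ 2) (𝓝[≠] 0) (𝓝 d))
    (hG : ∀ s, |q s| ≤ G * Real.exp (b * s ^ 2)) :
    ∃ M, ∀ s, |q s| ≤ M * s ^ 2 * Real.exp (b * s ^ 2) := by
  have hG0 : 0 ≤ G := by simpa [hq0] using hG 0
  have hnear := hq.abs.eventually_lt_const (lt_add_one |d|)
  rw [eventually_nhdsWithin_iff, Metric.eventually_nhds_iff] at hnear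
  obtain ⟨δ, hδ, hnear⟩ := hnear
  refine ⟨|d| + 1 + G / δ ^ 2, fun s => ?_⟩
  rcases eq_or_ne s 0 with rfl | hs
  · simp [hq0]
  have hs2 : 0 < s ^ 2 := by positivity
  rcases lt_or_ge (dist s 0) δ with hlt | hge
  · have hle := (hnear hlt hs).le
    rw [abs_div, abs_of_pos hs2, div_le_iff₀ hs2] at hle
    calc |q s| ≤ (|d| + 1) * s ^ 2 * 1 := by rwa [mul_one]
      _ ≤ (|d| + 1 + G / δ ^ 2) * s ^ 2 * Real.exp (b * s ^ 2) := by
        have hone := Real.one_le_exp (show 0 ≤ b * s ^ 2 by positivity)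
        have hM : |d| + 1 ≤ |d| + 1 + G / δ ^ 2 := le_add_of_nonneg_right (by positivity)
        gcongr
  · have hδs : δ ^ 2 ≤ s ^ 2 := by
      rw [← sq_abs s]
      rw [Real.dist_eq, sub_zero] at hge
      gcongr
    have hGs : G ≤ G / δ ^ 2 * s ^ 2 := by
      rw [div_mul_eq_mul_div, le_div_iff₀ (by positivity)]
      gcongr
    refine (hG s).trans ?_
    gcongr
    exact hGs.trans (by gcongr; exact le_add_of_nonneg_left (by positivity))

end SecondDifference

section ShortTime

variable {n : ℕ} {C β d t : ℝ} {f : ℝ → ℝ} {i : Fin n}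

lemma sq_apply_le_norm_sq (y : EuclideanSpace ℝ (Fin n)) (i : Fin n) : y i ^ 2 ≤ ‖y‖ ^ 2 := by
  rw [← sq_abs]
  gcongr
  exact PiLp.norm_apply_le y i

lemma GaussianGrowth.comp_apply (hf : GaussianGrowth C β f) (hβ : 0 ≤ β) (i : Fin n) :
    GaussianGrowth C β fun y : EuclideanSpace ℝ (Fin n) => f (y i) := by
  have hC := hf.const_nonneg
  refine ⟨hf.continuous.comp (by fun_prop), fun y => (hf.abs_le (y i)).trans ?_⟩
  have hsq := sq_apply_le_norm_sq y i
  rw [Real.norm_eq_abs, sq_abs]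
  gcongr

lemma GaussianGrowth.heatFlow_sub_eq_integral_secondDiff {φ : EuclideanSpace ℝ (Fin n) → ℝ}
    (hφ : GaussianGrowth C β φ) (hβ : 0 ≤ β) (ht : 0 ≤ t) (htβ : β * t < 1 / 4)
    (x : EuclideanSpace ℝ (Fin n)) :
    heatFlow φ t x - φ x = ∫ ζ, gaussKernel ζ 1 * (secondDiff φ x (√t • ζ) / 2) := by
  have hint := hφ.integrable_scaled hβ ht htβ x
  have hsum : Integrable fun ζ =>
      gaussKernel ζ 1 * φ (x - √t • ζ) + gaussKernel (-ζ) 1 * φ (x - √t • -ζ) :=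
    hint.add hint.comp_neg
  have hconst := (integrable_gaussKernel_one (n := n)).mul_const (φ x)
  calc heatFlow φ t x - φ x
      = 1 / 2 * ((heatFlow φ t x + heatFlow φ t x) - 2 * φ x) := by ring
    _ = 1 / 2 * ((∫ ζ : EuclideanSpace ℝ (Fin n), gaussKernel ζ 1 * φ (x - √t • ζ)) +
          (∫ ζ : EuclideanSpace ℝ (Fin n), gaussKernel (-ζ) 1 * φ (x - √t • -ζ)) -
            2 * ∫ ζ : EuclideanSpace ℝ (Fin n), gaussKernel ζ 1 * φ x) := by
      rw [integral_neg_eq_self (fun ζ => gaussKernel ζ 1 * φ (x - √t • ζ)),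
        ← heatFlow_eq_scaled φ ht, integral_mul_const, integral_gaussKernel_one, one_mul]
    _ = ∫ ζ, gaussKernel ζ 1 * (secondDiff φ x (√t • ζ) / 2) := by
      rw [← integral_add hint hint.comp_neg, ← integral_const_mul,
        ← integral_sub hsum (hconst.const_mul 2), ← integral_const_mul]
      refine integral_congr_ae (Eventually.of_forall fun ζ => ?_)
      have hneg : gaussKernel (-ζ) 1 = gaussKernel ζ 1 := by simp [gaussKernel]
      simp only [hneg, secondDiff, smul_neg, sub_neg_eq_add]
      ring

/-- Half of the variance of a coordinate under the Gauss kernel at time `1`, which is the constant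
relating the initial speed of the heat flow of `x ↦ f (x i)` to `f''`. -/
def halfVariance (i : Fin n) : ℝ :=
  ∫ ζ : EuclideanSpace ℝ (Fin n), gaussKernel ζ 1 * (ζ i ^ 2 / 2)

lemma halfVariance_pos (i : Fin n) : 0 < halfVariance i := by
  have : Continuous _ := continuous_gaussKernel (n := n) 1
  have hnonneg : ∀ ζ : EuclideanSpace ℝ (Fin n), 0 ≤ gaussKernel ζ 1 * (ζ i ^ 2 / 2) := fun ζ =>
    mul_nonneg (gaussKernel_pos ζ one_pos).le (by positivity)
  have hint : Integrable fun ζ : EuclideanSpace ℝ (Fin n) => gaussKernel ζ 1 * (ζ i ^ 2 / 2) := by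
    refine (integrable_gaussKernel_one_mul_exp_quadratic (b := 0) (by norm_num) 2 0).mono'
      (Continuous.aestronglyMeasurable (by fun_prop)) (Eventually.of_forall fun ζ => ?_)
    have hsq : ζ i ^ 2 ≤ Real.exp (2 * ‖ζ‖) :=
      (sq_apply_le_norm_sq ζ i).trans (sq_le_exp_two_mul (norm_nonneg ζ))
    rw [Real.norm_of_nonneg (hnonneg ζ), zero_mul, zero_add, add_zero]
    exact mul_le_mul_of_nonneg_left (by linarith [sq_nonneg (ζ i)]) (gaussKernel_pos ζ one_pos).le
  refine integral_pos_of_integrable_nonneg_nonzero (x := EuclideanSpace.single i 1) (by fun_prop)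
    hint hnonneg ?_
  simpa using (gaussKernel_pos (EuclideanSpace.single i (1 : ℝ)) one_pos).ne'

lemma tendsto_secondDiff_sqrt_mul_div {z : ℝ}
    (hd : Tendsto (fun s => secondDiff f z s / s ^ 2) (𝓝[≠] 0) (𝓝 d)) (a : ℝ) :
    Tendsto (fun t => secondDiff f z (√t * a) / (2 * t)) (𝓝[>] 0) (𝓝 (a ^ 2 / 2 * d)) := by
  rcases eq_or_ne a 0 with rfl | ha
  · simp [secondDiff_zero]
  have hs : Tendsto (fun t => √t * a) (𝓝[>] 0) (𝓝[≠] 0) := by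
    refine tendsto_nhdsWithin_iff.2 ⟨?_, ?_⟩
    · have h : Tendsto (fun t => √t * a) (𝓝 0) (𝓝 (√0 * a)) := Continuous.tendsto (by fun_prop) 0
      rw [Real.sqrt_zero, zero_mul] at h
      exact h.mono_left nhdsWithin_le_nhds
    · filter_upwards [self_mem_nhdsWithin] with t ht
      exact mul_ne_zero (Real.sqrt_pos.2 ht).ne' ha
  refine ((hd.comp hs).const_mul (a ^ 2 / 2)).congr' ?_
  filter_upwards [self_mem_nhdsWithin] with t ht
  rw [mem_Ioi] at ht
  simp only [Function.comp_apply, mul_pow, Real.sq_sqrt ht.le]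
  field_simp

lemma norm_secondDiff_sqrt_mul_div_le {z M b : ℝ} (hM0 : 0 ≤ M)
    (hM : ∀ s, |secondDiff f z s| ≤ M * s ^ 2 * Real.exp (b * s ^ 2)) (ht : 0 < t)
    (hbt : b * t ≤ 1 / 8) (ζ : EuclideanSpace ℝ (Fin n)) :
    ‖secondDiff f z (√t * ζ i) / (2 * t)‖ ≤
      M * Real.exp (1 / 8 * ‖ζ‖ ^ 2 + 2 * ‖ζ‖ + 0) := by
  have hle := hM (√t * ζ i)
  rw [mul_pow, Real.sq_sqrt ht.le] at hle
  have hnorm := sq_apply_le_norm_sq ζ i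
  have hsq : ζ i ^ 2 ≤ Real.exp (2 * ‖ζ‖) :=
    hnorm.trans (sq_le_exp_two_mul (norm_nonneg ζ))
  have hexponent : b * (t * ζ i ^ 2) ≤ 1 / 8 * ‖ζ‖ ^ 2 := calc
    b * (t * ζ i ^ 2) = b * t * ζ i ^ 2 := by ring
    _ ≤ 1 / 8 * ζ i ^ 2 := by gcongr
    _ ≤ 1 / 8 * ‖ζ‖ ^ 2 := by gcongr
  rw [Real.norm_eq_abs, abs_div, abs_of_pos (by positivity : 0 < 2 * t),
    div_le_iff₀ (by positivity)]
  calc |secondDiff f z (√t * ζ i)| ≤ M * (t * ζ i ^ 2) * Real.exp (b * (t * ζ i ^ 2)) := hle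
    _ ≤ M * (2 * t * Real.exp (2 * ‖ζ‖)) * Real.exp (1 / 8 * ‖ζ‖ ^ 2) := by
      gcongr
      linarith
    _ = M * Real.exp (1 / 8 * ‖ζ‖ ^ 2 + 2 * ‖ζ‖ + 0) * (2 * t) := by
      rw [add_zero, Real.exp_add]
      ring

lemma tendsto_integral_gaussKernel_secondDiff (hf : Continuous f) {z M b : ℝ} (hb : 0 ≤ b)
    (hM : ∀ s, |secondDiff f z s| ≤ M * s ^ 2 * Real.exp (b * s ^ 2))
    (hd : Tendsto (fun s => secondDiff f z s / s ^ 2) (𝓝[≠] 0) (𝓝 d)) :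
    Tendsto (fun t => ∫ ζ : EuclideanSpace ℝ (Fin n),
      gaussKernel ζ 1 * (secondDiff f z (√t * ζ i) / (2 * t))) (𝓝[>] 0)
      (𝓝 (halfVariance i * d)) := by
  have : Continuous _ := continuous_gaussKernel (n := n) 1
  have hM0 : 0 ≤ M := by
    have h := (abs_nonneg _).trans (hM 1)
    rw [one_pow, mul_one] at h
    exact nonneg_of_mul_nonneg_left h (Real.exp_pos _)
  rw [halfVariance, ← integral_mul_const]
  simp only [mul_assoc]
  refine tendsto_integral_filter_of_dominated_convergence
    (fun ζ => M * (gaussKernel ζ 1 * Real.exp (1 / 8 * ‖ζ‖ ^ 2 + 2 * ‖ζ‖ + 0))) ?_ ?_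
    ((integrable_gaussKernel_one_mul_exp_quadratic (by norm_num) 2 0).const_mul M) ?_
  · refine Eventually.of_forall fun t => Continuous.aestronglyMeasurable ?_
    unfold secondDiff
    fun_prop
  · filter_upwards [Ioo_mem_nhdsGT (show (0 : ℝ) < 1 / (8 * (b + 1)) by positivity)] with t ht
    refine Eventually.of_forall fun ζ => ?_
    have hbt : b * t ≤ 1 / 8 := by
      have h := (lt_div_iff₀ (by positivity)).1 ht.2
      linarith [ht.1]
    rw [norm_mul, Real.norm_of_nonneg (gaussKernel_pos ζ one_pos).le, mul_left_comm]
    refine mul_le_mul_of_nonneg_left ?_ (gaussKernel_pos ζ one_pos).le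
    exact norm_secondDiff_sqrt_mul_div_le hM0 hM ht.1 hbt ζ
  · exact Eventually.of_forall fun ζ => (tendsto_secondDiff_sqrt_mul_div hd (ζ i)).const_mul _

lemma GaussianGrowth.hasDerivWithinAt_heatFlow_comp_apply (hf : GaussianGrowth C β f) (hβ : 0 ≤ β)
    {f' : ℝ → ℝ} {x : EuclideanSpace ℝ (Fin n)} (hf' : ∀ᶠ y in 𝓝 (x i), HasDerivAt f (f' y) y)
    (hd : HasDerivAt f' d (x i)) :
    HasDerivWithinAt (fun t => heatFlow (fun y => f (y i)) t x) (halfVariance i * d)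
      (Ioi 0) 0 := by
  have hlim := tendsto_secondDiff_div_sq hf' hd
  obtain ⟨M, hM⟩ := exists_abs_le_mul_sq_mul_exp (b := 2 * β) (by positivity)
    (secondDiff_zero f (x i)) hlim
    fun s => by simpa using hf.abs_secondDiff_le hβ (x i) s
  rw [hasDerivWithinAt_iff_tendsto_slope' self_notMem_Ioi]
  refine (tendsto_integral_gaussKernel_secondDiff hf.continuous (by positivity) hM hlim).congr' ?_
  filter_upwards [Ioo_mem_nhdsGT (show (0 : ℝ) < 1 / (4 * (β + 1)) by positivity)] with t ht
  have htβ : β * t < 1 / 4 := by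
    have h := (lt_div_iff₀ (by positivity)).1 ht.2
    linarith [ht.1]
  rw [slope_def_field, heatFlow_zero, sub_zero,
    (hf.comp_apply hβ i).heatFlow_sub_eq_integral_secondDiff hβ ht.1.le htβ, div_eq_inv_mul,
    ← integral_const_mul]
  refine integral_congr_ae (Eventually.of_forall fun ζ => ?_)
  have ht0 : t ≠ 0 := ht.1.ne'
  simp only [secondDiff, PiLp.add_apply, PiLp.sub_apply, PiLp.smul_apply, smul_eq_mul]
  field_simp

end ShortTime

section TestFunction

variable {n : ℕ} {F : ℝ → EReal} {A C β m z : ℝ} {i : Fin n} {x : EuclideanSpace ℝ (Fin n)}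

lemma Admissible.inv_le_mul_exp (hF : Admissible F) (hT : Tendsto F atTop (𝓝 ⊤)) (hA : 0 ≤ A)
    (hW : weightIntegral F A < ⊤) (hz : realOf F 1 ≤ z) :
    inv F z ≤ (weightIntegral F A).toReal * Real.exp (2 * A + 2 * A * z ^ 2) := by
  have hzJ : z ∈ J F := hF.mem_J_of_le hT (hF.realOf_mem_J one_pos) hz
  have hle : ENNReal.ofReal (Real.exp (-(2 * A + 2 * A * z ^ 2)) * inv F z) ≤
      weightIntegral F A := calc
    ENNReal.ofReal (Real.exp (-(2 * A + 2 * A * z ^ 2)) * inv F z)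
      = ∫⁻ _ in Ioc z (z + 1),
          ENNReal.ofReal (Real.exp (-(2 * A + 2 * A * z ^ 2)) * inv F z) := by
        simp
    _ ≤ ∫⁻ y in Ioc z (z + 1), ENNReal.ofReal (Real.exp (-A * y ^ 2) * inv F y) := by
        refine setLIntegral_mono' measurableSet_Ioc fun y hy => ENNReal.ofReal_le_ofReal ?_
        have hinv : inv F z ≤ inv F y :=
          hF.strictMonoOn_inv.monotoneOn hzJ (hF.mem_J_of_le hT hzJ hy.1.le) hy.1.le
        have hsq : y ^ 2 ≤ 2 + 2 * z ^ 2 := by nlinarith [hy.1, hy.2, sq_nonneg (y - 2 * z)]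
        have hexponent : -(2 * A + 2 * A * z ^ 2) ≤ -A * y ^ 2 := by nlinarith
        have := (inv_pos_of_mem_J hzJ).le
        gcongr
    _ ≤ weightIntegral F A := lintegral_mono_set fun y hy => hz.trans_lt hy.1
  rw [ENNReal.ofReal_le_iff_le_toReal hW.ne, Real.exp_neg, inv_mul_le_iff₀ (Real.exp_pos _)] at hle
  rwa [mul_comm]

lemma Admissible.exists_gaussianGrowth_inv_max (hF : Admissible F) (hT : Tendsto F atTop (𝓝 ⊤))
    (hA : 0 ≤ A) (hW : weightIntegral F A < ⊤) (hm : m ∈ J F) :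
    ∃ C, GaussianGrowth C (2 * A) fun s => inv F (max s m) := by
  set m' := max m (realOf F 1)
  have hmem : ∀ s, max s m ∈ J F := fun s => hF.mem_J_of_le hT hm (le_max_right s m)
  refine ⟨(weightIntegral F A).toReal * Real.exp (2 * A + 2 * A * m' ^ 2), ?_, fun s => ?_⟩
  · exact continuous_iff_continuousAt.2 fun s => ContinuousAt.comp (f := fun s : ℝ => max s m)
      (hF.continuousAt_inv (hmem s)) (by fun_prop)
  have hle : max s m ≤ max s m' := max_le_max_left s (le_max_left _ _)
  have hsq : max s m' ^ 2 ≤ s ^ 2 + m' ^ 2 := by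
    rcases max_choice s m' with h | h <;> rw [h] <;> nlinarith [sq_nonneg s, sq_nonneg m']
  rw [abs_of_pos (inv_pos_of_mem_J (hmem s)), Real.norm_eq_abs, sq_abs, mul_assoc, ← Real.exp_add]
  calc inv F (max s m) ≤ inv F (max s m') :=
        hF.strictMonoOn_inv.monotoneOn (hmem s) (hF.mem_J_of_le hT (hmem s) hle) hle
    _ ≤ (weightIntegral F A).toReal * Real.exp (2 * A + 2 * A * max s m' ^ 2) :=
        hF.inv_le_mul_exp hT hA hW ((le_max_right _ _).trans (le_max_right _ _))
    _ ≤ _ := by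
        refine mul_le_mul_of_nonneg_left (Real.exp_le_exp.2 ?_) ENNReal.toReal_nonneg
        linarith [mul_le_mul_of_nonneg_left hsq hA]

/-- The function `x ↦ f_F (max (x i) m)`: its `F`-transform is the convex function `max (x i) m`,
which is affine on the half-space `x i > m`, so that it probes the equality case of
`F`-convexity. -/
def testFun (F : ℝ → EReal) (m : ℝ) (i : Fin n) (x : EuclideanSpace ℝ (Fin n)) : ℝ :=
  inv F (max (x i) m)

lemma Admissible.realOf_testFun (hF : Admissible F) (hT : Tendsto F atTop (𝓝 ⊤)) (hm : m ∈ J F)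
    (x : EuclideanSpace ℝ (Fin n)) : realOf F (testFun F m i x) = max (x i) m :=
  realOf_inv (hF.mem_J_of_le hT hm (le_max_right _ _))

lemma Admissible.inv_le_testFun (hF : Admissible F) (hT : Tendsto F atTop (𝓝 ⊤)) (hm : m ∈ J F)
    (x : EuclideanSpace ℝ (Fin n)) : inv F m ≤ testFun F m i x :=
  hF.strictMonoOn_inv.monotoneOn hm (hF.mem_J_of_le hT hm (le_max_right _ _)) (le_max_right _ _)

lemma Admissible.fconvex_testFun (hF : Admissible F) (hT : Tendsto F atTop (𝓝 ⊤)) (hm : m ∈ J F)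
    (i : Fin n) : FConvex F (testFun F m i) := by
  refine fconvex_of_convexOn hF
    (fun x => (inv_pos_of_mem_J hm).trans_le (hF.inv_le_testFun hT hm x)) ?_
  simp only [hF.realOf_testFun hT hm]
  exact ((EuclideanSpace.proj i : _ →L[ℝ] ℝ).toLinearMap.convexOn convex_univ).sup
    (convexOn_const m convex_univ)

lemma Admissible.hasDerivWithinAt_realOf_heatFlow_testFun (hF : Admissible F)
    (hC : ContDiffOn ℝ 2 (realOf F) (Ioi 0)) (hT : Tendsto F atTop (𝓝 ⊤)) (hm : m ∈ J F)
    (hgrowth : GaussianGrowth C β fun s => inv F (max s m)) (hβ : 0 ≤ β) (hx : m < x i)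
    (hpos : 0 < deriv (realOf F) (inv F (x i))) :
    HasDerivWithinAt (fun t => realOf F (heatFlow (testFun F m i) t x))
      (halfVariance i * g F (x i)) (Ioi 0) 0 := by
  have hxJ : x i ∈ J F := hF.mem_J_of_le hT hm hx.le
  have hmax : ∀ y, m < y → (fun s => inv F (max s m)) =ᶠ[𝓝 y] inv F := fun y hy => by
    filter_upwards [lt_mem_nhds hy] with s hs
    rw [max_eq_left hs.le]
  have hderiv : ∀ᶠ y in 𝓝 (x i), HasDerivAt (fun s => inv F (max s m)) (invDeriv F y) y := by
    have hcont := (hF.hasDerivAt_deriv_realOf_inv hC hxJ hpos).continuousAt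
    filter_upwards [lt_mem_nhds hx, hcont.eventually_const_lt hpos] with y hy hy'
    exact (hF.hasDerivAt_inv hC (hF.mem_J_of_le hT hm hy.le) hy').congr_of_eventuallyEq (hmax y hy)
  have hflow : HasDerivWithinAt (fun t => heatFlow (testFun F m i) t x) _ (Ioi 0) 0 :=
    hgrowth.hasDerivWithinAt_heatFlow_comp_apply hβ hderiv (hF.hasDerivAt_invDeriv hC hxJ hpos)
  have hF' : HasDerivAt (realOf F) (invDeriv F (x i))⁻¹ (heatFlow (testFun F m i) 0 x) := by
    rw [heatFlow_zero, testFun, max_eq_left hx.le, invDeriv, inv_inv]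
    exact hasDerivAt_realOf hC (inv_pos_of_mem_J hxJ)
  refine (hF'.comp_hasDerivWithinAt (0 : ℝ) hflow).congr_deriv ?_
  have hne : invDeriv F (x i) ≠ 0 := (inv_pos.2 hpos).ne'
  field_simp

end TestFunction

section Necessity

variable {n : ℕ} {F : ℝ → EReal} {A C β ρ r : ℝ} {φ : EuclideanSpace ℝ (Fin n) → ℝ}

lemma GaussianGrowth.le_maxTime (hφ : GaussianGrowth C β φ) (hβ : 0 < β) :
    ENNReal.ofReal (1 / (4 * β)) ≤ maxTime φ := by
  refine le_sSup fun t ht htβ x =>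
    hφ.integrable_gaussKernel_mul ht ((lt_one_div_four_mul ht).2 ?_) x
  rw [ENNReal.ofReal_lt_ofReal_iff (by positivity), lt_div_iff₀ (by positivity)] at htβ
  linarith

lemma Preserved.eventually_convexOn_heatFlow (hP : Preserved n F) (hF : Admissible F)
    (hφF : FConvex F φ) (hφ : GaussianGrowth C β φ) (hβ : 0 < β) (hρ : 0 < ρ)
    (hρφ : ∀ y, ρ ≤ φ y) :
    ∀ᶠ t in 𝓝[>] 0, ConvexOn ℝ univ fun x => realOf F (heatFlow φ t x) := by
  have hβ4 : 0 < 1 / (4 * β) := by positivity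
  filter_upwards [Ioo_mem_nhdsGT hβ4] with t ht
  have htβ : β * t < 1 / 4 := by
    linarith [(lt_div_iff₀ (by positivity : 0 < 4 * β)).1 ht.2]
  have hconv := hP φ hφF ((ENNReal.ofReal_pos.2 hβ4).trans_le (hφ.le_maxTime hβ)) t ht.1
    (((ENNReal.ofReal_lt_ofReal_iff hβ4).2 ht.2).trans_le (hφ.le_maxTime hβ))
  have hmax : ∀ x, max (heatFlow φ t x) ρ = heatFlow φ t x := fun x =>
    max_eq_left (hφ.le_heatFlow hβ.le hρφ ht.1.le htβ x)
  simpa only [hmax] using hconv.convexOn_max hF hρ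

lemma le_of_hasDerivWithinAt_of_convexOn {E : Type*} [AddCommGroup E] [Module ℝ E]
    {w : ℝ → E → ℝ} {x y : E} {a b p q s : ℝ} (hw : ∀ᶠ t in 𝓝[>] 0, ConvexOn ℝ univ (w t))
    (ha : 0 ≤ a) (hb : 0 ≤ b) (hab : a + b = 1) (h0 : w 0 (a • x + b • y) = a * w 0 x + b * w 0 y)
    (hx : HasDerivWithinAt (fun t => w t x) p (Ioi 0) 0)
    (hy : HasDerivWithinAt (fun t => w t y) q (Ioi 0) 0)
    (hxy : HasDerivWithinAt (fun t => w t (a • x + b • y)) s (Ioi 0) 0) : s ≤ a * p + b * q := by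
  have hdiff := (hxy.sub (hx.const_mul a)).sub (hy.const_mul b)
  rw [hasDerivWithinAt_iff_tendsto_slope' self_notMem_Ioi] at hdiff
  suffices s - a * p - b * q ≤ 0 by linarith
  refine le_of_tendsto hdiff ?_
  filter_upwards [hw, self_mem_nhdsWithin] with t ht ht0
  have hle := ht.2 (mem_univ x) (mem_univ y) ha hb hab
  rw [smul_eq_mul, smul_eq_mul] at hle
  rw [slope_def_field]
  refine div_nonpos_of_nonpos_of_nonneg ?_ (sub_nonneg.2 (mem_Ioi.1 ht0).le)
  simp only [Pi.sub_apply]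
  linarith

lemma Admissible.exists_mem_J_lt_and_lt (hF : Admissible F) {z₁ z₂ : ℝ} (hz₁ : z₁ ∈ J F)
    (hz₂ : z₂ ∈ J F) : ∃ m ∈ J F, m < z₁ ∧ m < z₂ := by
  have hmin : min z₁ z₂ ∈ J F := by
    rcases min_choice z₁ z₂ with h | h <;> rwa [h]
  have hnhds : ∀ᶠ z in 𝓝[<] min z₁ z₂, z ∈ J F :=
    Eventually.filter_mono nhdsWithin_le_nhds (hF.isOpen_J.mem_nhds hmin)
  obtain ⟨m, hm, hlt⟩ := (hnhds.and self_mem_nhdsWithin).exists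
  exact ⟨m, hm, lt_min_iff.1 hlt⟩

lemma Preserved.convexOn_g (hP : Preserved n F) (hn : 1 ≤ n) (hF : Admissible F)
    (hC : ContDiffOn ℝ 2 (realOf F) (Ioi 0)) (hT : Tendsto F atTop (𝓝 ⊤)) (hA : 0 < A)
    (hW : weightIntegral F A < ⊤) {S : Set ℝ} (hS : Convex ℝ S) (hSJ : S ⊆ J F)
    (hpos : ∀ z ∈ S, 0 < deriv (realOf F) (inv F z)) : ConvexOn ℝ S (g F) := by
  refine ⟨hS, fun z₁ hz₁ z₂ hz₂ a b ha hb hab => ?_⟩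
  obtain ⟨m, hm, hm₁, hm₂⟩ := hF.exists_mem_J_lt_and_lt (hSJ hz₁) (hSJ hz₂)
  obtain ⟨C, hgrowth⟩ := hF.exists_gaussianGrowth_inv_max hT hA.le hW hm
  let i : Fin n := ⟨0, hn⟩
  let x : ℝ → EuclideanSpace ℝ (Fin n) := EuclideanSpace.single i
  have hxi : ∀ z, x z i = z := fun z => by simp [x]
  have hcomb : a • x z₁ + b • x z₂ = x (a * z₁ + b * z₂) := by
    ext j
    rcases eq_or_ne j i with rfl | hj <;> simp [x, *]
  have hm₃ : m < a * z₁ + b * z₂ := (convex_Ioi m) hm₁ hm₂ ha hb hab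
  have hderiv : ∀ z ∈ S, m < z → HasDerivWithinAt
      (fun t => realOf F (heatFlow (testFun F m i) t (x z))) (halfVariance i * g F z)
      (Ioi 0) 0 := fun z hz hmz => by
    simpa only [hxi] using hF.hasDerivWithinAt_realOf_heatFlow_testFun hC hT hm hgrowth
      (by positivity) (i := i) (x := x z) (by rwa [hxi]) (by rw [hxi]; exact hpos z hz)
  have hinit : ∀ z, m < z → realOf F (heatFlow (testFun F m i) 0 (x z)) = z := fun z hmz => by
    rw [heatFlow_zero, hF.realOf_testFun hT hm, hxi, max_eq_left hmz.le]
  have hle := le_of_hasDerivWithinAt_of_convexOn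
    (hP.eventually_convexOn_heatFlow hF (hF.fconvex_testFun hT hm i)
      (hgrowth.comp_apply (by positivity) i) (by positivity) (inv_pos_of_mem_J hm)
      (hF.inv_le_testFun hT hm)) ha hb hab
    (by rw [hcomb, hinit _ hm₁, hinit _ hm₂, hinit _ hm₃]) (hderiv z₁ hz₁ hm₁) (hderiv z₂ hz₂ hm₂)
    (by rw [hcomb]; exact hderiv _ (hS hz₁ hz₂ ha hb hab) hm₃)
  refine le_of_mul_le_mul_left ?_ (halfVariance_pos i)
  simp only [smul_eq_mul]
  linarith

lemma Admissible.deriv_realOf_nonneg (hF : Admissible F) (hr : 0 < r) :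
    0 ≤ deriv (realOf F) r := by
  rw [← derivWithin_of_isOpen isOpen_Ioi (mem_Ioi.2 hr)]
  exact hF.strictMonoOn_realOf.monotoneOn.derivWithin_nonneg

lemma exists_last_nonpos {f : ℝ → ℝ} {a b : ℝ} (hf : ContinuousOn f (Icc a b)) (hab : a ≤ b)
    (ha : f a ≤ 0) (hb : 0 < f b) : ∃ c ∈ Ico a b, f c ≤ 0 ∧ ∀ s ∈ Ioc c b, 0 < f s := by
  have hcompact : IsCompact (Icc a b ∩ f ⁻¹' Iic 0) := isCompact_Icc.of_isClosed_subset
    (hf.preimage_isClosed_of_isClosed isClosed_Icc isClosed_Iic) inter_subset_left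
  obtain ⟨c, ⟨hc, hfc⟩, hmax⟩ := hcompact.exists_isGreatest ⟨a, ⟨le_rfl, hab⟩, ha⟩
  have hcb : c ≠ b := by
    rintro rfl
    exact hb.not_ge hfc
  refine ⟨c, ⟨hc.1, hc.2.lt_of_ne hcb⟩, hfc, fun s hs => ?_⟩
  by_contra! hle
  exact hs.1.not_ge (hmax ⟨⟨hc.1.trans hs.1.le, hs.2⟩, hle⟩)

lemma exists_le_of_convexOn_Ioc {G : ℝ → ℝ} {a b c : ℝ} (hG : ConvexOn ℝ (Ioc a b) G)
    (hc : c ∈ Ioo a b) : ∃ K, ∀ z ∈ Ioc a c, K ≤ G z := by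
  set σ := (G b - G c) / (b - c)
  refine ⟨G c - |σ| * (c - a), fun z hz => ?_⟩
  have hca : 0 ≤ |σ| * (z - a) := mul_nonneg (abs_nonneg σ) (sub_nonneg.2 hz.1.le)
  rcases hz.2.eq_or_lt with rfl | hzc
  · linarith
  have hslope : (G c - G z) / (c - z) ≤ |σ| := (hG.slope_mono_adjacent
    ⟨hz.1, hzc.le.trans hc.2.le⟩ (right_mem_Ioc.2 (hc.1.trans hc.2)) hzc hc.2).trans
    (le_abs_self σ)
  rw [div_le_iff₀ (sub_pos.2 hzc)] at hslope
  linarith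

lemma Admissible.tendsto_log_invDeriv (hF : Admissible F) (hC : ContDiffOn ℝ 2 (realOf F) (Ioi 0))
    {z : ℝ} (hz : z ∈ J F) (h0 : deriv (realOf F) (inv F z) = 0)
    (hpos : ∀ᶠ y in 𝓝[>] z, 0 < deriv (realOf F) (inv F y)) :
    Tendsto (fun y => Real.log (invDeriv F y)) (𝓝[>] z) atTop := by
  have hcont : ContinuousAt (fun y => deriv (realOf F) (inv F y)) z := ContinuousAt.comp
    (hasDerivAt_deriv_realOf hC (inv_pos_of_mem_J hz)).continuousAt (hF.continuousAt_inv hz)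
  have hlim := hcont.tendsto.mono_left (nhdsWithin_le_nhds (s := Ioi z))
  rw [h0] at hlim
  exact Real.tendsto_log_atTop.comp
    (tendsto_inv_nhdsGT_zero.comp (tendsto_nhdsWithin_iff.2 ⟨hlim, hpos⟩))

/- A convex `g_F = (log f_F')'` would be bounded below at the left end of the interval, and so
`log f_F'` bounded above there. -/
lemma Admissible.not_convexOn_g_Ioc (hF : Admissible F) (hC : ContDiffOn ℝ 2 (realOf F) (Ioi 0))
    {a b : ℝ} (hab : a < b) (haJ : a ∈ J F) (hJ : Ioc a b ⊆ J F)
    (h0 : deriv (realOf F) (inv F a) = 0)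
    (hpos : ∀ z ∈ Ioc a b, 0 < deriv (realOf F) (inv F z)) : ¬ ConvexOn ℝ (Ioc a b) (g F) := by
  intro hconv
  obtain ⟨c, hc⟩ := exists_between hab
  obtain ⟨K, hK⟩ := exists_le_of_convexOn_Ioc hconv hc
  have hbounded : ∀ z ∈ Ioc a c,
      Real.log (invDeriv F z) ≤ Real.log (invDeriv F c) + |K| * (c - a) := fun z hz => by
    have hmem : ∀ y ∈ Icc z (z + (c - z)), y ∈ Ioc a c := fun y hy =>
      ⟨hz.1.trans_le hy.1, hy.2.trans_eq (add_sub_cancel z c)⟩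
    have hle := le_of_linear_le_hasDerivAt (c := K) (a := 0) (sub_nonneg.2 hz.2)
      (fun y hy => hF.hasDerivAt_log_invDeriv hC (hJ ⟨(hmem y hy).1, (hmem y hy).2.trans hc.2.le⟩)
        (hpos y ⟨(hmem y hy).1, (hmem y hy).2.trans hc.2.le⟩))
      (fun y hy => by simpa using hK y (hmem y hy))
    rw [add_sub_cancel, zero_mul, zero_div, add_zero] at hle
    have hKz : -(|K| * (c - a)) ≤ K * (c - z) := calc
      -(|K| * (c - a)) ≤ -(|K| * (c - z)) := by gcongr; exact hz.1.le
      _ = -|K| * (c - z) := by ring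
      _ ≤ K * (c - z) := mul_le_mul_of_nonneg_right (neg_abs_le K) (sub_nonneg.2 hz.2)
    linarith
  have hlim := hF.tendsto_log_invDeriv hC haJ h0 <| by
    filter_upwards [Ioc_mem_nhdsGT hab] with z hz using hpos z hz
  obtain ⟨z, hz, hzc⟩ :=
    ((hlim.eventually_gt_atTop _).and (Ioc_mem_nhdsGT hc.1)).exists
  exact (hbounded z hzc).not_gt hz

lemma Admissible.exists_deriv_realOf_pos (hF : Admissible F)
    (hC : ContDiffOn ℝ 2 (realOf F) (Ioi 0)) (hr : 0 < r) :
    ∃ s, r < s ∧ 0 < deriv (realOf F) s := by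
  obtain ⟨s, hs, hslope⟩ := exists_deriv_eq_slope (realOf F) (lt_add_one r)
    (hC.continuousOn.mono fun s hs => hr.trans_le hs.1)
    (fun s hs => (hasDerivAt_realOf hC (hr.trans hs.1)).differentiableAt.differentiableWithinAt)
  refine ⟨s, hs.1, hslope ▸ div_pos (sub_pos.2 ?_) (by linarith)⟩
  exact hF.strictMonoOn_realOf hr (hr.trans (lt_add_one r)) (lt_add_one r)

lemma Preserved.deriv_pos (hP : Preserved n F) (hn : 1 ≤ n) (hF : Admissible F)
    (hC : ContDiffOn ℝ 2 (realOf F) (Ioi 0)) (hT : Tendsto F atTop (𝓝 ⊤)) (hA : 0 < A)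
    (hW : weightIntegral F A < ⊤) (hr : 0 < r) : 0 < deriv (realOf F) r := by
  by_contra! hr0
  obtain ⟨s, hrs, hs⟩ := hF.exists_deriv_realOf_pos hC hr
  have hcont : ContinuousOn (deriv (realOf F)) (Icc r s) := fun y hy =>
    (hasDerivAt_deriv_realOf hC (hr.trans_le hy.1)).continuousAt.continuousWithinAt
  obtain ⟨c, hc, hc0, hcpos⟩ := exists_last_nonpos hcont hrs.le hr0 hs
  have hc' : 0 < c := hr.trans_le hc.1
  have hs' : 0 < s := hr.trans hrs
  have hcJ : realOf F c ∈ J F := hF.realOf_mem_J hc'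
  have hJ : Ioc (realOf F c) (realOf F s) ⊆ J F := fun z hz => hF.mem_J_of_le hT hcJ hz.1.le
  have hpos : ∀ z ∈ Ioc (realOf F c) (realOf F s), 0 < deriv (realOf F) (inv F z) :=
    fun z hz => by
      have hlt := hF.strictMonoOn_inv hcJ (hJ hz) hz.1
      have hle := hF.strictMonoOn_inv.monotoneOn (hJ hz) (hF.realOf_mem_J hs') hz.2
      rw [hF.inv_realOf hc'] at hlt
      rw [hF.inv_realOf hs'] at hle
      exact hcpos _ ⟨hlt, hle⟩
  refine hF.not_convexOn_g_Ioc hC (hF.strictMonoOn_realOf hc' hs' hc.2) hcJ hJ ?_ hpos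
    (hP.convexOn_g hn hF hC hT hA hW (convex_Ioc _ _) hJ hpos)
  rw [hF.inv_realOf hc']
  exact hc0.antisymm (hF.deriv_realOf_nonneg hc')

theorem Preserved.convexProfile (hP : Preserved n F) (hn : 1 ≤ n) (hF : Admissible F)
    (hC : ContDiffOn ℝ 2 (realOf F) (Ioi 0)) (hT : Tendsto F atTop (𝓝 ⊤)) (hA : 0 < A)
    (hW : weightIntegral F A < ⊤) : ConvexProfile F := by
  have hpos : ∀ r : ℝ, 0 < r → 0 < deriv (realOf F) r := fun r hr =>
    hP.deriv_pos hn hF hC hT hA hW hr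
  exact ⟨hF, hC, hT, hpos, hP.convexOn_g hn hF hC hT hA hW hF.ordConnected_J.convex Subset.rfl
    fun z hz => hpos _ (inv_pos_of_mem_J hz)⟩

end Necessity

end HeatFConvex

end

theorem theorem1p1 (n : ℕ) (hn : 1 ≤ n) (F : ℝ → EReal) (hF : HeatFConvex.Admissible F) :
    ((∃ L : EReal, L < ⊤ ∧ Tendsto F atTop (𝓝 L)) →
      HeatFConvex.OnlyTriviallyPreserved n F) ∧
    (Tendsto F atTop (𝓝 ⊤) →
      (∀ A : ℝ, 0 < A → HeatFConvex.weightIntegral F A = ⊤) →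
      HeatFConvex.OnlyTriviallyPreserved n F) ∧
    (ContDiffOn ℝ 2 (HeatFConvex.realOf F) (Ioi 0) →
      Tendsto F atTop (𝓝 ⊤) →
      (∃ A : ℝ, 0 < A ∧ HeatFConvex.weightIntegral F A < ⊤) →
      (HeatFConvex.Preserved n F ↔
        (∀ r : ℝ, 0 < r → 0 < deriv (HeatFConvex.realOf F) r) ∧
          ConvexOn ℝ (HeatFConvex.J F) (HeatFConvex.g F))) := by
  refine ⟨HeatFConvex.onlyTriviallyPreserved_of_bounded hF,
    HeatFConvex.onlyTriviallyPreserved_of_weightIntegral_eq_top hF,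
    fun hC hT ⟨A, hA, hW⟩ => ⟨fun hP => ?_, fun h => ?_⟩⟩
  · have hprofile := hP.convexProfile hn hF hC hT hA hW
    exact ⟨hprofile.deriv_pos, hprofile.convexOn⟩
  · exact HeatFConvex.ConvexProfile.preserved ⟨hF, hC, hT, h.1, h.2⟩ n
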